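/- **Theorem (Graph Reconstruction).** Let $d\ge 2$. A graph $(V,E)$ immersed in $\mathbb R^d$ has a finite vertex set $V\subset\mathbb R^d$ and straight edges; put $n=|V|$, $m=|E|$. It is *GP-immersed* if any $d+1$ vertices are affinely independent, no three vertices are collinear after orthogonal projection to the $(e_1,e_2)$-plane, and all vertices have distinct heights in direction $e_2$. The graph is unknown; an algorithm (on a real RAM that is given only $d$) can query an oracle which, for a direction $s\in\mathbb S^{d-1}$, returns the augmented persistence diagram (dimensions $0$ and $1$ together count as one diagram, pairs with equal birth and death are kept) of the lower-star filtration of $(V,E)$ by height in direction $s$, its points sorted by birth and by death. Let $\Pi$ be the time of one query; it consists of an arbitrary time in which the oracle computes the diagram and a time $n+m+1$ for writing its answer, which has size $\Theta(n+m)$. There is an absolute constant $C>0$ (independent of $d$, of the graph, of $\Pi$ and of the vertex reconstruction method) such that the following holds. Let $M$ be a vertex reconstruction method, that is, an algorithm that computes from oracle queries the list of all vertices of every unknown graph in some class $\mathcal C$ of GP-immersed graphs, in time at most $T$ and with at most $K$ diagrams, where $T$ and $K$ may depend on the graph. Then there is an algorithm, which depends only on $M$, that reconstructs every unknown graph in $\mathcal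 C$, that is, computes the lists of all its vertices and of all its edges, with at most $$K+1+C\,m\log n$$ diagrams and in time at most $$T+C\bigl(n^2+(m\log n+1)(d+\Pi)\bigr).$$ (Here $\log 0$ is read as $0$ if $n=0$. If $m\ge 1$, then $n\ge 2$, and the two bounds are $K+O(m\log n)$ and $T+O(n^2+m\log n\,(d+\Pi))$.) -/

import Mathlib

open scoped Classical

/-! ## Graphs immersed in Euclidean space -/

/-- A finite simple graph with straight edges immersed in `ℝ^d`, `d ≥ 2`. The vertices are distinct
points of `ℝ^d`; the labels `Fin n` are only names for them. -/
structure ImmersedGraph where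
  d : ℕ
  two_le_d : 2 ≤ d
  n : ℕ
  pos : Fin n → EuclideanSpace ℝ (Fin d)
  pos_injective : Function.Injective pos
  graph : SimpleGraph (Fin n)

namespace ImmersedGraph

variable (X : ImmersedGraph)

/-- The coordinate of a vertex in direction `e₁`. -/
def fstCoord (i : Fin X.n) : ℝ := X.pos i ⟨0, by have := X.two_le_d; omega⟩

/-- The coordinate of a vertex in direction `e₂`. -/
def sndCoord (i : Fin X.n) : ℝ := X.pos i ⟨1, by have := X.two_le_d; omega⟩

/-- The orthogonal projection of a vertex to the plane spanned by `e₁` and `e₂`. -/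
def proj (i : Fin X.n) : EuclideanSpace ℝ (Fin 2) := !₂[X.fstCoord i, X.sndCoord i]

/-- General position: any `d + 1` vertices are affinely independent, no three vertices are collinear
after projection to the `(e₁, e₂)`-plane, and the heights in direction `e₂` are distinct. -/
structure GeneralPosition : Prop where
  affineIndependent : ∀ s : Finset (Fin X.n), s.card = X.d + 1 →
    AffineIndependent ℝ (fun i : s => X.pos i)
  not_collinear : ∀ i j k : Fin X.n, i ≠ j → j ≠ k → i ≠ k →
    ¬ Collinear ℝ {X.proj i, X.proj j, X.proj k}
  height_injective : Function.Injective X.sndCoord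

/-- The edges, each listed once, as the pair of its endpoints in increasing order of labels. -/
noncomputable def edges : Finset (Fin X.n × Fin X.n) :=
  Finset.univ.filter fun e => e.1 < e.2 ∧ X.graph.Adj e.1 e.2

/-- The number of edges. -/
noncomputable def m : ℕ := X.edges.card

/-! ## Augmented persistence diagrams of lower-star filtrations -/

variable (s : EuclideanSpace ℝ (Fin X.d))

/-- The height of a vertex in direction `s`. -/
noncomputable def height (i : Fin X.n) : ℝ := inner ℝ s (X.pos i)

/-- The height of an edge in direction `s`: the maximum over its endpoints. -/
noncomputable def edgeHeight (e : Fin X.n × Fin X.n) : ℝ :=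
  max (X.height s e.1) (X.height s e.2)

/-- The order in which edges enter the filtration: by height, edges of equal height in the
lexicographic order of their endpoints. -/
def EntersBefore (e f : Fin X.n × Fin X.n) : Prop :=
  toLex (X.edgeHeight s e, toLex e) < toLex (X.edgeHeight s f, toLex f)

/-- The graph on all vertices formed by the edges that enter before the edge `e`. -/
def graphBefore (e : Fin X.n × Fin X.n) : SimpleGraph (Fin X.n) :=
  SimpleGraph.fromRel fun i j => (i, j) ∈ X.edges ∧ X.EntersBefore s (i, j) e

/-- The height at which the connected component of the vertex `i` in the graph `H` is born: the
minimal height of a vertex of this component. -/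
noncomputable def birthHeight (H : SimpleGraph (Fin X.n)) (i : Fin X.n) : ℝ :=
  (Finset.univ.filter fun j => H.Reachable i j).inf' ⟨i, by simp⟩ (X.height s)

/-- An edge is a death event in dimension zero if it merges two components, that is, if its
endpoints are in different components when it enters; otherwise it is a birth event in dimension
one. -/
def MergesComponents (e : Fin X.n × Fin X.n) : Prop :=
  ¬ (X.graphBefore s e).Reachable e.1 e.2

/-- The zero-dimensional augmented persistence diagram in direction `s`. An edge that merges two
components ends the one that was born last (elder rule); pairs with equal birth and death are kept.
Each component of the whole graph gives a point that never dies. -/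
noncomputable def dgm0 : Multiset (ℝ × WithTop ℝ) :=
  (X.edges.filter (X.MergesComponents s)).val.map
      (fun e => (max (X.birthHeight s (X.graphBefore s e) e.1)
          (X.birthHeight s (X.graphBefore s e) e.2), (X.edgeHeight s e : WithTop ℝ)))
    + (Finset.univ : Finset X.graph.ConnectedComponent).val.map
      (fun c => (X.birthHeight s X.graph c.out, (⊤ : WithTop ℝ)))

/-- The one-dimensional augmented persistence diagram in direction `s`. An edge that closes a cycle
is a birth; a graph has no two-dimensional simplices, so that there are no deaths. -/
noncomputable def dgm1 : Multiset (ℝ × WithTop ℝ) :=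
  (X.edges.filter fun e => ¬ X.MergesComponents s e).val.map
    (fun e => (X.edgeHeight s e, (⊤ : WithTop ℝ)))

end ImmersedGraph

/-! ## A real random access machine with a diagram oracle

The memory consists of banks of cells that hold natural numbers, and banks of cells that hold real
numbers; a program addresses finitely many banks by name and computes the index of a cell. -/

/-- The content of the memory: `nat b i` and `real b i` are the `i`-th cells of the `b`-th banks. -/
structure Memory where
  nat : ℕ → ℕ → ℕ
  real : ℕ → ℕ → ℝ

/-- The memory with zeros in all cells. -/
def Memory.init : Memory := ⟨fun _ _ => 0, fun _ _ => 0⟩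

/-- Write a number into one cell. -/
def Memory.setNat (μ : Memory) (b i v : ℕ) : Memory :=
  { μ with nat := Function.update μ.nat b (Function.update (μ.nat b) i v) }

/-- Write a real number into one cell. -/
noncomputable def Memory.setReal (μ : Memory) (b i : ℕ) (v : ℝ) : Memory :=
  { μ with real := Function.update μ.real b (Function.update (μ.real b) i v) }

/-- Write a list of points of a diagram: the births into the real bank `r`, the deaths into the real
bank `r + 1` (zero if the death is `∞`), and into the natural bank `k` the number `1` if the death
is finite and `0` if it is `∞`. Cells beyond the length of the list are unchanged. -/
noncomputable def Memory.writePoints (μ : Memory) (k r : ℕ) (l : List (ℝ × WithTop ℝ)) : Memory where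
  nat b i := if b = k ∧ i < l.length then
      (if (l.getD i (0, ⊤)).2 = ⊤ then 0 else 1) else μ.nat b i
  real b i := if b = r ∧ i < l.length then (l.getD i (0, ⊤)).1
    else if b = r + 1 ∧ i < l.length then (l.getD i (0, ⊤)).2.untopD 0 else μ.real b i

/-- The points of a diagram sorted by birth (ties: by death). -/
noncomputable def sortByBirth (D : Multiset (ℝ × WithTop ℝ)) : List (ℝ × WithTop ℝ) :=
  ((D.map fun p => toLex (p.1, p.2)).sort).map fun p => ((ofLex p).1, (ofLex p).2)

/-- The points of a diagram sorted by death (ties: by birth). -/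
noncomputable def sortByDeath (D : Multiset (ℝ × WithTop ℝ)) : List (ℝ × WithTop ℝ) :=
  ((D.map fun p => toLex (p.2, p.1)).sort).map fun p => ((ofLex p).2, (ofLex p).1)

/-- The answer `D₀, D₁` of the oracle, written from bank `b` on: the numbers of points into the cells
`0` and `1` of the natural bank `b`, then the points of `D₀` sorted by birth, of `D₀` sorted by
death, of `D₁` sorted by birth and of `D₁` sorted by death. -/
noncomputable def Memory.writeAnswer (μ : Memory) (b : ℕ) (D₀ D₁ : Multiset (ℝ × WithTop ℝ)) :
    Memory :=
  (((((μ.setNat b 0 D₀.card).setNat b 1 D₁.card).writePoints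
    (b + 1) b (sortByBirth D₀)).writePoints
    (b + 2) (b + 2) (sortByDeath D₀)).writePoints
    (b + 3) (b + 4) (sortByBirth D₁)).writePoints
    (b + 4) (b + 6) (sortByDeath D₁)

/-- Expressions for natural numbers; `dim` is the ambient dimension, the only input. -/
inductive NExp where
  | const (c : ℕ)
  | dim
  | read (bank : ℕ) (idx : NExp)
  | add (x y : NExp)
  | sub (x y : NExp)
  | half (x : NExp)

/-- Expressions for real numbers. -/
inductive RExp where
  | ofNat (x : NExp)
  | read (bank : ℕ) (idx : NExp)
  | add (x y : RExp)
  | sub (x y : RExp)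
  | mul (x y : RExp)
  | div (x y : RExp)
  | sqrt (x : RExp)
  | sin (x : RExp)
  | cos (x : RExp)
  | arctan (x : RExp)

/-- Conditions. -/
inductive Cond where
  | natLt (x y : NExp)
  | natEq (x y : NExp)
  | realLt (x y : RExp)
  | realEq (x y : RExp)
  | not (c : Cond)
  | and (c c' : Cond)

/-- Programs. The command `query r b` asks the oracle for the diagram in the direction whose
coordinates are the first `d` cells of the real bank `r`, and has the answer written from bank `b`
on. -/
inductive Program where
  | skip
  | setNat (bank : ℕ) (idx : NExp) (val : NExp)
  | setReal (bank : ℕ) (idx : NExp) (val : RExp)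
  | query (r b : ℕ)
  | seq (P Q : Program)
  | ite (c : Cond) (P Q : Program)
  | while (c : Cond) (P : Program)

/-- Value of an expression (`sub` is truncated, `half` rounds down). -/
def NExp.eval (d : ℕ) (μ : Memory) : NExp → ℕ
  | const c => c
  | dim => d
  | read b i => μ.nat b (i.eval d μ)
  | add x y => x.eval d μ + y.eval d μ
  | sub x y => x.eval d μ - y.eval d μ
  | half x => x.eval d μ / 2

/-- The number of operations of an expression. -/
def NExp.cost : NExp → ℕ
  | const _ => 1
  | dim => 1
  | read _ i => i.cost + 1
  | add x y => x.cost + y.cost + 1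
  | sub x y => x.cost + y.cost + 1
  | half x => x.cost + 1

/-- Value of an expression in exact real arithmetic. -/
noncomputable def RExp.eval (d : ℕ) (μ : Memory) : RExp → ℝ
  | ofNat x => (x.eval d μ : ℝ)
  | read b i => μ.real b (i.eval d μ)
  | add x y => x.eval d μ + y.eval d μ
  | sub x y => x.eval d μ - y.eval d μ
  | mul x y => x.eval d μ * y.eval d μ
  | div x y => x.eval d μ / y.eval d μ
  | sqrt x => Real.sqrt (x.eval d μ)
  | sin x => Real.sin (x.eval d μ)
  | cos x => Real.cos (x.eval d μ)
  | arctan x => Real.arctan (x.eval d μ)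

/-- The number of operations of an expression. -/
def RExp.cost : RExp → ℕ
  | ofNat x => x.cost + 1
  | read _ i => i.cost + 1
  | add x y => x.cost + y.cost + 1
  | sub x y => x.cost + y.cost + 1
  | mul x y => x.cost + y.cost + 1
  | div x y => x.cost + y.cost + 1
  | sqrt x => x.cost + 1
  | sin x => x.cost + 1
  | cos x => x.cost + 1
  | arctan x => x.cost + 1

/-- Truth of a condition. -/
def Cond.Holds (d : ℕ) (μ : Memory) : Cond → Prop
  | natLt x y => x.eval d μ < y.eval d μ
  | natEq x y => x.eval d μ = y.eval d μ
  | realLt x y => x.eval d μ < y.eval d μ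
  | realEq x y => x.eval d μ = y.eval d μ
  | not c => ¬ c.Holds d μ
  | and c c' => c.Holds d μ ∧ c'.Holds d μ

/-- The number of operations of a condition. -/
def Cond.cost : Cond → ℕ
  | natLt x y => x.cost + y.cost + 1
  | natEq x y => x.cost + y.cost + 1
  | realLt x y => x.cost + y.cost + 1
  | realEq x y => x.cost + y.cost + 1
  | not c => c.cost + 1
  | and c c' => c.cost + c'.cost + 1

/-- The vector stored in the first `d` cells of a real bank. -/
noncomputable def Memory.vector (μ : Memory) (d r : ℕ) : EuclideanSpace ℝ (Fin d) :=
  WithLp.toLp 2 fun j : Fin d => μ.real r j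

/-- The time `Π` of one oracle query about the graph `X`: the time `τ X` in which the oracle
computes the diagram (an arbitrary parameter), and the time in which its answer, which has a size
of order `n + m`, is written into the memory. -/
noncomputable def oracleTime (τ : ImmersedGraph → ℕ) (X : ImmersedGraph) : ℕ :=
  τ X + (X.n + X.m) + 1

/-- `Run τ X P μ μ' t q`: with the oracle for the graph `X`, the program `P` started in the memory
`μ` halts in the memory `μ'` after `t` steps and `q` oracle queries. A query whose direction is not
a unit vector is an error. -/
inductive Run (τ : ImmersedGraph → ℕ) (X : ImmersedGraph) :
    Program → Memory → Memory → ℕ → ℕ → Prop where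
  | skip (μ : Memory) : Run τ X .skip μ μ 1 0
  | setNat (μ : Memory) (b : ℕ) (i v : NExp) :
      Run τ X (.setNat b i v) μ (μ.setNat b (i.eval X.d μ) (v.eval X.d μ)) (i.cost + v.cost + 1) 0
  | setReal (μ : Memory) (b : ℕ) (i : NExp) (v : RExp) :
      Run τ X (.setReal b i v) μ (μ.setReal b (i.eval X.d μ) (v.eval X.d μ)) (i.cost + v.cost + 1) 0
  | query (μ : Memory) (r b : ℕ) (h : ‖μ.vector X.d r‖ = 1) :
      Run τ X (.query r b) μ
        (μ.writeAnswer b (X.dgm0 (μ.vector X.d r)) (X.dgm1 (μ.vector X.d r))) (oracleTime τ X) 1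
  | seq {P Q : Program} {μ μ' μ'' : Memory} {t t' q q' : ℕ} (h : Run τ X P μ μ' t q)
      (h' : Run τ X Q μ' μ'' t' q') : Run τ X (.seq P Q) μ μ'' (t + t') (q + q')
  | ite_true {c : Cond} {P Q : Program} {μ μ' : Memory} {t q : ℕ} (hc : c.Holds X.d μ)
      (h : Run τ X P μ μ' t q) : Run τ X (.ite c P Q) μ μ' (c.cost + t) q
  | ite_false {c : Cond} {P Q : Program} {μ μ' : Memory} {t q : ℕ} (hc : ¬ c.Holds X.d μ)
      (h : Run τ X Q μ μ' t q) : Run τ X (.ite c P Q) μ μ' (c.cost + t) q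
  | while_false {c : Cond} {P : Program} {μ : Memory} (hc : ¬ c.Holds X.d μ) :
      Run τ X (.while c P) μ μ c.cost 0
  | while_true {c : Cond} {P : Program} {μ μ' μ'' : Memory} {t t' q q' : ℕ} (hc : c.Holds X.d μ)
      (h : Run τ X P μ μ' t q) (h' : Run τ X (.while c P) μ' μ'' t' q') :
      Run τ X (.while c P) μ μ'' (c.cost + t + t') (q + q')

/-! ## Reconstruction -/

/-- The memory holds the vertices of `X`, listed in the order `σ`: their number is the first cell of
the natural bank `0`, and the coordinates of the `i`-th vertex of the list are the cells
`i * d, …, i * d + d - 1` of the real bank `0`. -/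
def HoldsVertices (X : ImmersedGraph) (σ : Equiv.Perm (Fin X.n)) (μ : Memory) : Prop :=
  μ.nat 0 0 = X.n ∧
    ∀ (i : Fin X.n) (j : Fin X.d), μ.real 0 (i * X.d + j) = X.pos (σ i) j

/-- The memory holds the edges of `X`, where the vertices are listed in the order `σ`: their number
is the first cell of the natural bank `1`, and the places of the endpoints of the `k`-th edge in the
list of vertices are the `k`-th cells of the natural banks `2` and `3`. Each edge occurs once. -/
def HoldsEdges (X : ImmersedGraph) (σ : Equiv.Perm (Fin X.n)) (μ : Memory) : Prop :=
  μ.nat 1 0 = X.m ∧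
    ∃ u v : Fin X.m → Fin X.n,
      (∀ k : Fin X.m, μ.nat 2 k = u k ∧ μ.nat 3 k = v k) ∧
      Function.Injective (fun k => s(σ (u k), σ (v k))) ∧
      Set.range (fun k => s(σ (u k), σ (v k))) = X.graph.edgeSet

/-- The program `P` reconstructs the vertices of every unknown graph `X` of the class `𝒞` in time at
most `T X`, with at most `K X` diagrams. Nothing but the dimension is known at the start. -/
def ReconstructsVertices (P : Program) (𝒞 : Set ImmersedGraph) (τ : ImmersedGraph → ℕ)
    (T K : ImmersedGraph → ℝ) : Prop :=
  ∀ X ∈ 𝒞, ∃ (μ : Memory) (t q : ℕ), Run τ X P Memory.init μ t q ∧ (t : ℝ) ≤ T X ∧ (q : ℝ) ≤ K X ∧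
    ∃ σ : Equiv.Perm (Fin X.n), HoldsVertices X σ μ

/-- The program `P` reconstructs every unknown graph `X` of the class `𝒞`, vertices and edges, in
time at most `T X`, with at most `K X` diagrams. -/
def ReconstructsGraphs (P : Program) (𝒞 : Set ImmersedGraph) (τ : ImmersedGraph → ℕ)
    (T K : ImmersedGraph → ℝ) : Prop :=
  ∀ X ∈ 𝒞, ∃ (μ : Memory) (t q : ℕ), Run τ X P Memory.init μ t q ∧ (t : ℝ) ≤ T X ∧ (q : ℝ) ≤ K X ∧
    ∃ σ : Equiv.Perm (Fin X.n), HoldsVertices X σ μ ∧ HoldsEdges X σ μ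

/-!
The program `A` runs the vertex reconstruction `M` and then the program `findAllEdges`, whose
working memory consists of banks that `M` never writes.

*What a query tells.* An edge is a death in dimension zero or a birth in dimension one, at its
height, so a diagram determines the number of edges of each height (`countP_dgm_eq_card_edges`).
If `v` is the only vertex of its height in direction `s`, the number for this height is the number
of neighbors of `v` that are lower than `v` in direction `s` (`card_edges_height`). Reading it off
takes time linear in the size of the diagram, hence at most a constant times the time of the query
itself.

*The sweep.* One query in direction `e₂` gives for every vertex the number of its lower neighbors.
The vertices are then processed by decreasing height in direction `e₂`, so that when `v` is
processed, the edges from its upper neighbors are known. If `v` has lower neighbors at all, the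
other vertices are sorted by the angles `φ ∈ (-π/2, π/2)` between `e₂` and the lines from `v` to
them, in the `(e₁, e₂)`-plane; no three projected vertices are collinear, so these angles are
distinct. In the direction `(cos θ, - sin θ)` the neighbors that are lower than `v` are the
neighbors below it in direction `e₂` with `φ > θ` and the neighbors above it with `φ < θ`
(`GeneralPosition.height_lt_iff`). The latter are known, so that a query with `θ` between two
consecutive angles gives the number of lower neighbors in a tail of the angular order
(`SortedBy.card_probe`), and each lower neighbor is found by bisection with at most `⌈log₂ n⌉`
queries (`ends_findEdge`).

*The time.* Everything besides sorting and bisection takes `O(n (n + m + 1) + Π)` steps. Sorting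
at `v` takes `O(n log n)` steps; it is done only if `v` has a lower neighbor, and is charged to
the edges found at `v`. Together with the bisections this is `O(log n · Π)` for each of the `m`
edges. Sorting is selection with a tournament tree, where a selected vertex is removed by raising
its key to `2 > π/2` and playing again the games on the path from its leaf to the root
(`ends_extractWinner`).

Total correctness of programs, with bounds for time and queries, is expressed by `Ends`; the
numerical constants in the bounds are generous. Banks that a program cannot write keep their content
(`Run.frame`), so that invariants mention only banks that are written.

*The memory.* Natural and real banks are numbered independently; a single number is kept in the
cell `0` of its bank. The vertices are named by their places in the list that `M` computes, and
the edges are appended to the output banks `2` and `3`, upper endpoint first. The other banks of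
`findAllEdges B` are as follows.

* Natural banks: `B + 4, …, B + 8` answers of the oracle; `B + 9`, `B + 10`, `B + 20` loop
  counters; `B + 11` result of `countEdges`; `B + 12` place in the list of coordinates; `B + 13`
  numbers of lower neighbors; `B + 14` marks of processed vertices; `B + 15` current vertex `v`;
  `B + 16` tournament tree; `B + 17` vertices in angular order at `v`; `B + 18` node of the tree;
  `B + 19` extracted vertex; `B + 21`, `B + 22`, `B + 23` bounds and middle of the bisection;
  `B + 24` number to compare with in the bisection.
* Real banks: `B + 4, …, B + 11` answers of the oracle; `B + 12` direction of the queries;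
  `B + 13`, `B + 14` coordinates in directions `e₁` and `e₂`; `B + 15` angles at `v`; `B + 16` keys in
  the tournament; `B + 17` angles in increasing order; `B + 18` height of the edges to be counted;
  `B + 19` angle `θ`.
-/

/-! ### Programs, the banks they write, and programs without loops and queries -/

/-- The number in the cell `0` of a natural bank. -/
abbrev NExp.var (b : ℕ) : NExp := .read b (.const 0)

/-- The number in the cell `0` of a real bank. -/
abbrev RExp.var (b : ℕ) : RExp := .read b (.const 0)

namespace Program

/-- The program may change the natural bank `x`. -/
def WritesNat : Program → ℕ → Prop
  | skip, _ => False
  | setNat b _ _, x => x = b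
  | setReal _ _ _, _ => False
  | query _ b, x => b ≤ x ∧ x ≤ b + 4
  | seq P Q, x => P.WritesNat x ∨ Q.WritesNat x
  | ite _ P Q, x => P.WritesNat x ∨ Q.WritesNat x
  | .while _ P, x => P.WritesNat x

/-- The program may change the real bank `x`. -/
def WritesReal : Program → ℕ → Prop
  | skip, _ => False
  | setNat _ _ _, _ => False
  | setReal b _ _, x => x = b
  | query _ b, x => b ≤ x ∧ x ≤ b + 7
  | seq P Q, x => P.WritesReal x ∨ Q.WritesReal x
  | ite _ P Q, x => P.WritesReal x ∨ Q.WritesReal x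
  | .while _ P, x => P.WritesReal x

/-- A program addresses finitely many banks, so that there are banks for another program to use. -/
theorem exists_bank_bound (P : Program) :
    ∃ B, ∀ b, B ≤ b → ¬ P.WritesNat b ∧ ¬ P.WritesReal b := by
  induction P with
  | skip => exact ⟨0, fun b _ => ⟨id, id⟩⟩
  | setNat b _ _ => exact ⟨b + 1, fun c hc => by
      simp only [WritesNat, WritesReal, not_false_eq_true, and_true]; omega⟩
  | setReal b _ _ => exact ⟨b + 1, fun c hc => by
      simp only [WritesNat, WritesReal, not_false_eq_true, true_and]; omega⟩
  | query r b => exact ⟨b + 8, fun c hc => by simp only [WritesNat, WritesReal]; omega⟩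
  | seq P Q hP hQ =>
    obtain ⟨B, hB⟩ := hP
    obtain ⟨B', hB'⟩ := hQ
    refine ⟨max B B', fun b hb => ?_⟩
    have h₁ := hB b (by omega)
    have h₂ := hB' b (by omega)
    simp only [WritesNat, WritesReal]
    tauto
  | ite c P Q hP hQ =>
    obtain ⟨B, hB⟩ := hP
    obtain ⟨B', hB'⟩ := hQ
    refine ⟨max B B', fun b hb => ?_⟩
    have h₁ := hB b (by omega)
    have h₂ := hB' b (by omega)
    simp only [WritesNat, WritesReal]
    tauto
  | _ c P hP => exact hP

/-- The program contains no loop and no query. -/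
def IsStraight : Program → Prop
  | skip => True
  | setNat _ _ _ => True
  | setReal _ _ _ => True
  | query _ _ => False
  | seq P Q => P.IsStraight ∧ Q.IsStraight
  | ite _ P Q => P.IsStraight ∧ Q.IsStraight
  | .while _ _ => False

/-- The effect of a program without loops and queries (junk for other programs). -/
noncomputable def exec (d : ℕ) : Program → Memory → Memory
  | skip, μ => μ
  | setNat b i v, μ => μ.setNat b (i.eval d μ) (v.eval d μ)
  | setReal b i v, μ => μ.setReal b (i.eval d μ) (v.eval d μ)
  | query _ _, μ => μ
  | seq P Q, μ => Q.exec d (P.exec d μ)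
  | ite c P Q, μ => if c.Holds d μ then P.exec d μ else Q.exec d μ
  | .while _ _, μ => μ

/-- An upper bound for the time of a program without loops and queries. -/
def maxCost : Program → ℕ
  | skip => 1
  | setNat _ i v => i.cost + v.cost + 1
  | setReal _ i v => i.cost + v.cost + 1
  | query _ _ => 0
  | seq P Q => P.maxCost + Q.maxCost
  | ite c P Q => c.cost + (P.maxCost + Q.maxCost)
  | .while _ _ => 0

/-- The loop that runs `P` for the values `0, 1, …` of the counter in bank `i` below `N`. -/
def forLoop (i : ℕ) (N : NExp) (P : Program) : Program :=
  .seq (.setNat i (.const 0) (.const 0))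
    (.while (.natLt (.read i (.const 0)) N)
      (.seq P (.setNat i (.const 0) (.add (.read i (.const 0)) (.const 1)))))

end Program

namespace Memory

variable (μ : Memory) {b b' : ℕ} (i v : ℕ) (r : ℝ)

@[simp] theorem setNat_nat : (μ.setNat b i v).nat b = Function.update (μ.nat b) i v := by
  simp [setNat]

@[simp] theorem setNat_nat_of_ne (h : b' ≠ b) : (μ.setNat b i v).nat b' = μ.nat b' := by
  simp [setNat, h]

@[simp] theorem setNat_real : (μ.setNat b i v).real = μ.real := rfl

@[simp] theorem setReal_real : (μ.setReal b i r).real b = Function.update (μ.real b) i r := by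
  simp [setReal]

@[simp] theorem setReal_real_of_ne (h : b' ≠ b) : (μ.setReal b i r).real b' = μ.real b' := by
  simp [setReal, h]

@[simp] theorem setReal_nat : (μ.setReal b i r).nat = μ.nat := rfl

end Memory

/-- The memories agree on all banks that the program does not write. -/
structure Frame (P : Program) (μ μ' : Memory) : Prop where
  nat : ∀ {b}, ¬ P.WritesNat b → μ'.nat b = μ.nat b
  real : ∀ {b}, ¬ P.WritesReal b → μ'.real b = μ.real b

theorem Frame.refl (P : Program) (μ : Memory) : Frame P μ μ := ⟨fun _ => rfl, fun _ => rfl⟩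

theorem Frame.trans {P : Program} {μ μ' μ'' : Memory} (h : Frame P μ μ') (h' : Frame P μ' μ'') :
    Frame P μ μ'' :=
  ⟨fun hb => (h'.nat hb).trans (h.nat hb), fun hb => (h'.real hb).trans (h.real hb)⟩

theorem Frame.of_writes {P Q : Program} {μ μ' : Memory} (h : Frame P μ μ')
    (hn : ∀ b, P.WritesNat b → Q.WritesNat b) (hr : ∀ b, P.WritesReal b → Q.WritesReal b) :
    Frame Q μ μ' :=
  ⟨fun hb => h.nat fun h' => hb (hn _ h'), fun hb => h.real fun h' => hb (hr _ h')⟩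

theorem Memory.writePoints_nat_of_ne (μ : Memory) {k r b : ℕ} (l : List (ℝ × WithTop ℝ))
    (h : b ≠ k) : (μ.writePoints k r l).nat b = μ.nat b := by
  funext i; simp [writePoints, h]

theorem Memory.writePoints_real_of_ne (μ : Memory) {k r b : ℕ} (l : List (ℝ × WithTop ℝ))
    (h : b ≠ r) (h' : b ≠ r + 1) : (μ.writePoints k r l).real b = μ.real b := by
  funext i; simp [writePoints, h, h']

theorem Frame.query (μ : Memory) (r b : ℕ) (D₀ D₁ : Multiset (ℝ × WithTop ℝ)) :
    Frame (.query r b) μ (μ.writeAnswer b D₀ D₁) := by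
  constructor <;> intro x hx <;> simp only [Program.WritesNat, Program.WritesReal] at hx
  · unfold Memory.writeAnswer
    iterate 4 rw [Memory.writePoints_nat_of_ne _ _ (by omega)]
    iterate 2 rw [Memory.setNat_nat_of_ne _ _ _ (by omega)]
  · unfold Memory.writeAnswer
    iterate 4 rw [Memory.writePoints_real_of_ne _ _ (by omega) (by omega)]
    simp

/-! ### Rules for total correctness with resource bounds -/

section Verification

variable {τ : ImmersedGraph → ℕ} {X : ImmersedGraph}

/-- Banks that a program does not write keep their content. -/
theorem Run.frame {P : Program} {μ μ' : Memory} {t q : ℕ} (h : Run τ X P μ μ' t q) :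
    Frame P μ μ' := by
  induction h with
  | skip μ => exact Frame.refl _ _
  | setNat μ b i v =>
    exact ⟨fun hb => Memory.setNat_nat_of_ne _ _ _ hb, fun _ => rfl⟩
  | setReal μ b i v =>
    exact ⟨fun _ => rfl, fun hb => Memory.setReal_real_of_ne _ _ _ hb⟩
  | query μ r b h => exact Frame.query _ _ _ _ _
  | seq h h' ih ih' =>
    exact (ih.of_writes (fun _ => Or.inl) (fun _ => Or.inl)).trans
      (ih'.of_writes (fun _ => Or.inr) (fun _ => Or.inr))
  | ite_true hc h ih => exact ih.of_writes (fun _ => Or.inl) (fun _ => Or.inl)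
  | ite_false hc h ih => exact ih.of_writes (fun _ => Or.inr) (fun _ => Or.inr)
  | while_false hc => exact Frame.refl _ _
  | while_true hc h h' ih ih' => exact Frame.trans ⟨ih.nat, ih.real⟩ ih'

variable (τ X) in
/-- Total correctness with resource bounds: started in `μ`, the program halts within `t` steps and
`q` queries, in a memory with the property `Q`. -/
def Ends (P : Program) (μ : Memory) (t q : ℕ) (Q : Memory → Prop) : Prop :=
  ∃ (μ' : Memory) (t' q' : ℕ), Run τ X P μ μ' t' q' ∧ t' ≤ t ∧ q' ≤ q ∧ Q μ'

variable {P P' : Program} {c : Cond} {μ : Memory} {t t' q q' : ℕ} {Q Q' : Memory → Prop}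

theorem Ends.mono (h : Ends τ X P μ t q Q) (ht : t ≤ t') (hq : q ≤ q')
    (hQ : ∀ μ', Frame P μ μ' → Q μ' → Q' μ') : Ends τ X P μ t' q' Q' := by
  obtain ⟨μ', s, r, hr, hs, hr', hQ'⟩ := h
  exact ⟨μ', s, r, hr, hs.trans ht, hr'.trans hq, hQ μ' hr.frame hQ'⟩

theorem Ends.seq {R : Memory → Prop} (h : Ends τ X P μ t q R)
    (h' : ∀ μ', Frame P μ μ' → R μ' → Ends τ X P' μ' t' q' Q) :
    Ends τ X (.seq P P') μ (t + t') (q + q') Q := by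
  obtain ⟨μ', s, r, hr, hs, hr', hR⟩ := h
  obtain ⟨μ'', s', r', hrr, hss, hrr', hQ⟩ := h' μ' hr.frame hR
  exact ⟨μ'', _, _, .seq hr hrr, by omega, by omega, hQ⟩

/-- The rule for compositions, with the bounds of the two programs left free. -/
theorem Ends.seq_le {R : Memory → Prop} {t₁ t₂ q₁ q₂ : ℕ} (h : Ends τ X P μ t₁ q₁ R)
    (h' : ∀ μ', Frame P μ μ' → R μ' → Ends τ X P' μ' t₂ q₂ Q)
    (ht : t₁ + t₂ ≤ t) (hq : q₁ + q₂ ≤ q) :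
    Ends τ X (.seq P P') μ t q Q :=
  (h.seq h').mono ht hq fun _ _ h => h

theorem Ends.ite (h : c.Holds X.d μ → Ends τ X P μ t q Q)
    (h' : ¬ c.Holds X.d μ → Ends τ X P' μ t q Q) :
    Ends τ X (.ite c P P') μ (c.cost + t) q Q := by
  by_cases hc : c.Holds X.d μ
  · obtain ⟨μ', s, r, hr, hs, hr', hR⟩ := h hc
    exact ⟨μ', _, _, .ite_true hc hr, by omega, hr', hR⟩
  · obtain ⟨μ', s, r, hr, hs, hr', hR⟩ := h' hc
    exact ⟨μ', _, _, .ite_false hc hr, by omega, hr', hR⟩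

theorem Program.IsStraight.run {P : Program} (hP : P.IsStraight) (μ : Memory) :
    ∃ s ≤ P.maxCost, Run τ X P μ (P.exec X.d μ) s 0 := by
  induction P generalizing μ with
  | skip => exact ⟨_, le_rfl, .skip μ⟩
  | setNat b i v => exact ⟨_, le_rfl, .setNat μ b i v⟩
  | setReal b i v => exact ⟨_, le_rfl, .setReal μ b i v⟩
  | query r b => exact hP.elim
  | seq P Q ihP ihQ =>
    obtain ⟨s, hs, h⟩ := ihP hP.1 μ
    obtain ⟨s', hs', h'⟩ := ihQ hP.2 (P.exec X.d μ)
    exact ⟨_, Nat.add_le_add hs hs', .seq h h'⟩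
  | ite c P Q ihP ihQ =>
    by_cases hc : c.Holds X.d μ
    · obtain ⟨s, hs, h⟩ := ihP hP.1 μ
      refine ⟨_, ?_, by simpa only [exec, if_pos hc] using Run.ite_true hc h⟩
      simp only [maxCost]; omega
    · obtain ⟨s, hs, h⟩ := ihQ hP.2 μ
      refine ⟨_, ?_, by simpa only [exec, if_neg hc] using Run.ite_false hc h⟩
      simp only [maxCost]; omega
  | _ c P _ => exact hP.elim

/-- For programs without loops and queries, total correctness is a statement about `exec`. -/
theorem Ends.straight (hP : P.IsStraight) (h : Q (P.exec X.d μ)) (ht : P.maxCost ≤ t) :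
    Ends τ X P μ t q Q := by
  obtain ⟨s, hs, hr⟩ := hP.run (τ := τ) μ
  exact ⟨_, s, 0, hr, hs.trans ht, Nat.zero_le _, h⟩

/-- The rule for loops: `I l` is an invariant that leaves at most `l` further iterations. -/
theorem Ends.while (I : ℕ → Memory → Prop) {l : ℕ} (h0 : I l μ)
    (hs : ∀ l' μ', Frame P μ μ' → I l' μ' → c.Holds X.d μ' →
      0 < l' ∧ Ends τ X P μ' t q (I (l' - 1))) :
    Ends τ X (.while c P) μ (l * (c.cost + t) + c.cost) (l * q)
      (fun μ' => ¬ c.Holds X.d μ' ∧ ∃ l', I l' μ') := by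
  suffices H : ∀ l μ', Frame P μ μ' → I l μ' →
      Ends τ X (.while c P) μ' (l * (c.cost + t) + c.cost) (l * q)
        (fun μ' => ¬ c.Holds X.d μ' ∧ ∃ l', I l' μ') from H l μ (Frame.refl _ _) h0
  intro l
  induction l with
  | zero =>
    intro μ' hf hI
    have hc : ¬ c.Holds X.d μ' := fun hc => (hs 0 μ' hf hI hc).1.ne' rfl
    exact ⟨μ', _, _, .while_false hc, by omega, by omega, hc, 0, hI⟩
  | succ l ih =>
    intro μ' hf hI
    by_cases hc : c.Holds X.d μ'
    · obtain ⟨-, μ₁, s, r, hr, hs', hr', hI'⟩ := hs _ μ' hf hI hc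
      obtain ⟨μ₂, s₂, r₂, hr₂, hs₂, hr₂', hQ⟩ := ih μ₁ (hf.trans hr.frame) hI'
      refine ⟨μ₂, _, _, .while_true hc hr hr₂, ?_, ?_, hQ⟩
      · rw [Nat.succ_mul]; omega
      · rw [Nat.succ_mul]; omega
    · exact ⟨μ', _, _, .while_false hc, by omega, by omega, hc, _, hI⟩

/-- The rule for counting loops whose iterations have different costs: `J k a` is an invariant
before the iteration `k`, where `a` is what is left of an additional budget. Every iteration has `t`
steps and `q` queries for free, and pays one unit of this budget for `t'` further steps and `q'`
further queries. -/
theorem Ends.forLoop_budget {i n : ℕ} {N : NExp} (J : ℕ → ℕ → Memory → Prop) {a : ℕ}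
    (hi : ¬ P.WritesNat i)
    (hN : ∀ μ', Frame (.forLoop i N P) μ μ' → N.eval X.d μ' = n)
    (h0 : J 0 a (μ.setNat i 0 0))
    (hs : ∀ k a, k < n → ∀ μ', Frame (.forLoop i N P) μ μ' → μ'.nat i 0 = k → J k a μ' →
      ∃ e ≤ a, Ends τ X P μ' (t + e * t') (q + e * q')
        (fun μ'' => J (k + 1) (a - e) (μ''.setNat i 0 (k + 1)))) :
    Ends τ X (.forLoop i N P) μ (n * (t + N.cost + 9) + a * t' + (N.cost + 6)) (n * q + a * q')
      (fun μ' => ∃ a', J n a' μ') := by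
  set body : Program := .seq P (.setNat i (.const 0) (.add (.read i (.const 0)) (.const 1)))
    with hbody
  set cond : Cond := .natLt (.read i (.const 0)) N with hcond
  have hcost : cond.cost = N.cost + 3 := by simp [hcond, Cond.cost, NExp.cost]; omega
  have hfr : ∀ {μ₁ μ₂}, Frame body μ₁ μ₂ → Frame (.forLoop i N P) μ₁ μ₂ := fun h =>
    h.of_writes (fun _ => Or.inr) (fun _ => Or.inr)
  have main : ∀ l k a μ', k + l = n → Frame (.forLoop i N P) μ μ' → μ'.nat i 0 = k → J k a μ' →
      Ends τ X (.while cond body) μ' (l * (t + N.cost + 9) + a * t' + (N.cost + 3))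
        (l * q + a * q') (fun μ' => ∃ a', J n a' μ') := by
    intro l
    induction l with
    | zero =>
      intro k a μ' hk hf hi' hJ
      have hc : ¬ cond.Holds X.d μ' := by
        simp only [hcond, Cond.Holds, NExp.eval, hN μ' hf, hi']; omega
      obtain rfl : k = n := by omega
      exact ⟨μ', _, _, .while_false hc, by omega, by omega, a, hJ⟩
    | succ l ih =>
      intro k a μ' hk hf hi' hJ
      have hc : cond.Holds X.d μ' := by
        simp only [hcond, Cond.Holds, NExp.eval, hN μ' hf, hi']; omega
      obtain ⟨e, he, μ₁, s, r, hr, hs', hr', hJ'⟩ := hs k a (by omega) μ' hf hi' hJ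
      have hi₁ : μ₁.nat i 0 = k := by rw [hr.frame.nat hi, hi']
      have hr₂ : Run τ X body μ' (μ₁.setNat i 0 (k + 1)) (s + 6) r := by
        have := Run.seq hr (Run.setNat (τ := τ) (X := X) μ₁ i (.const 0)
          (.add (.read i (.const 0)) (.const 1)))
        simpa [NExp.eval, NExp.cost, hi₁] using this
      obtain ⟨μ₂, s₂, r₂, hr₃, hs₃, hr₃', hQ⟩ := ih (k + 1) (a - e) _ (by omega)
        (hf.trans (hfr hr₂.frame)) (by simp) hJ'
      refine ⟨μ₂, _, _, .while_true hc hr₂ hr₃, ?_, ?_, hQ⟩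
      · obtain ⟨f, rfl⟩ := Nat.exists_eq_add_of_le he
        rw [Nat.add_sub_cancel_left] at hs₃
        rw [Nat.succ_mul, Nat.add_mul e f]; omega
      · obtain ⟨f, rfl⟩ := Nat.exists_eq_add_of_le he
        rw [Nat.add_sub_cancel_left] at hr₃'
        rw [Nat.succ_mul, Nat.add_mul e f]; omega
  have hstart : Run τ X (.setNat i (.const 0) (.const 0)) μ (μ.setNat i 0 0) 3 0 :=
    Run.setNat μ i (.const 0) (.const 0)
  obtain ⟨μ', s, r, hr, hs', hr', hQ⟩ := main n 0 a (μ.setNat i 0 0) (by omega)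
    (hstart.frame.of_writes (fun _ => Or.inl) (fun _ => Or.inl)) (by simp) h0
  exact ⟨μ', _, _, .seq hstart hr, by omega, by omega, hQ⟩

/-- The rule for counting loops: `I k` is an invariant before the iteration `k`. -/
theorem Ends.forLoop {i n : ℕ} {N : NExp} (I : ℕ → Memory → Prop)
    (hi : ¬ P.WritesNat i)
    (hN : ∀ μ', Frame (.forLoop i N P) μ μ' → N.eval X.d μ' = n)
    (h0 : I 0 (μ.setNat i 0 0))
    (hs : ∀ k, k < n → ∀ μ', Frame (.forLoop i N P) μ μ' → μ'.nat i 0 = k → I k μ' →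
      Ends τ X P μ' t q (fun μ'' => I (k + 1) (μ''.setNat i 0 (k + 1)))) :
    Ends τ X (.forLoop i N P) μ (n * (t + N.cost + 9) + (N.cost + 6)) (n * q) (I n) := by
  refine (Ends.forLoop_budget (a := 0) (t := t) (q := q) (t' := 0) (q' := 0) (fun k _ => I k) hi hN
    h0 fun k a hk μ' hf hi' hI => ⟨0, Nat.zero_le _, ?_⟩).mono (by omega) (by omega)
      fun μ' _ h => h.elim fun _ h => h
  simpa using hs k hk μ' hf hi' hI

end Verification

/-! ### A loop that counts -/

section Counting

theorem card_filter_range_getD {α : Type*} (l : List α) (a : α) (p : α → Prop) [DecidablePred p] :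
    ((Finset.range l.length).filter fun k => p (l.getD k a)).card = l.countP (fun x => p x) := by
  induction l using List.reverseRecOn with
  | nil => simp
  | append_singleton l b ih =>
    rw [List.length_append, List.length_singleton, Finset.range_add_one, Finset.filter_insert,
      List.countP_append, ← ih]
    have h : (Finset.range l.length).filter (fun k => p ((l ++ [b]).getD k a))
        = (Finset.range l.length).filter (fun k => p (l.getD k a)) :=
      Finset.filter_congr fun k hk => by
        rw [List.getD_append _ _ _ _ (Finset.mem_range.1 hk)]
    rw [h]
    by_cases hb : p b <;> simp [hb]

variable {τ : ImmersedGraph → ℕ} {X : ImmersedGraph}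

/-- Add to the cell `0` of the natural bank `acc` the number of the values `j < N` with `c`. -/
def Program.countLoop (j acc : ℕ) (N : NExp) (c : Cond) : Program :=
  .forLoop j N (.ite c
    (.setNat acc (.const 0) (.add (.read acc (.const 0)) (.const 1))) .skip)

theorem Ends.countLoop {j acc n : ℕ} {N : NExp} {c : Cond} {μ : Memory} (p : ℕ → Prop)
    (hj : j ≠ acc)
    (hN : ∀ μ', Frame (.countLoop j acc N c) μ μ' → N.eval X.d μ' = n)
    (hc : ∀ k, k < n → ∀ μ', Frame (.countLoop j acc N c) μ μ' → μ'.nat j 0 = k →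
      (c.Holds X.d μ' ↔ p k)) :
    Ends τ X (.countLoop j acc N c) μ (n * (c.cost + N.cost + 16) + (N.cost + 6)) 0
      (fun μ' => μ'.nat acc 0 = μ.nat acc 0 + ((Finset.range n).filter p).card) := by
  refine (Ends.forLoop (t := c.cost + 7) (q := 0)
    (fun k μ' => μ'.nat acc 0 = μ.nat acc 0 + ((Finset.range k).filter p).card)
    (by simpa [Program.WritesNat] using hj) hN (by simp [hj.symm]) ?_).mono
      (Nat.add_le_add_right (Nat.mul_le_mul_left _ (by omega)) _) (by omega) fun _ _ h => h
  intro k hk μ' hf hk' hI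
  refine Ends.straight ⟨trivial, trivial⟩ ?_
    (by simp [Program.maxCost, NExp.cost])
  have := hc k hk μ' hf hk'
  by_cases h : p k
  · simp [Program.exec, this.2 h, NExp.eval, Finset.range_add_one, Finset.filter_insert, h,
      hj.symm, hI]
    omega
  · simp [Program.exec, mt this.1 h, Finset.range_add_one, Finset.filter_insert, h, hj.symm, hI]

end Counting

/-! ### Edges at a vertex and diagrams -/

namespace ImmersedGraph

variable (X : ImmersedGraph) (s : EuclideanSpace ℝ (Fin X.d))

theorem mem_edges {e : Fin X.n × Fin X.n} : e ∈ X.edges ↔ e.1 < e.2 ∧ X.graph.Adj e.1 e.2 := by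
  simp [edges]

/-- Every edge is either a death in dimension zero or a birth in dimension one, so that the diagram
determines the number of edges of each height. -/
theorem countP_dgm_eq_card_edges (h : ℝ) :
    (X.dgm0 s).countP (fun p => p.2 = (h : WithTop ℝ)) + (X.dgm1 s).countP (fun p => p.1 = h)
      = (X.edges.filter fun e => X.edgeHeight s e = h).card := by
  have h₀ : (X.dgm0 s).countP (fun p => p.2 = (h : WithTop ℝ))
      = ((X.edges.filter (X.MergesComponents s)).filter fun e => X.edgeHeight s e = h).card := by
    rw [dgm0, Multiset.countP_add, Multiset.countP_map, Multiset.countP_map]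
    simp [Finset.card_def, WithTop.coe_inj]
  have h₁ : (X.dgm1 s).countP (fun p => p.1 = h)
      = ((X.edges.filter fun e => ¬ X.MergesComponents s e).filter
          fun e => X.edgeHeight s e = h).card := by
    rw [dgm1, Multiset.countP_map]
    simp [Finset.card_def]
  rw [h₀, h₁, Finset.filter_filter, Finset.filter_filter, ← Finset.card_union_of_disjoint,
    ← Finset.filter_or]
  · exact congrArg _ (Finset.filter_congr fun e _ => by tauto)
  · exact Finset.disjoint_filter.2 fun e _ => by tauto

theorem card_dgm0_le : (X.dgm0 s).card ≤ X.n + X.m := by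
  have h₁ := Finset.card_filter_le X.edges (X.MergesComponents s)
  have h₂ : (Finset.univ : Finset X.graph.ConnectedComponent).card ≤ X.n := by
    have := Fintype.card_le_of_surjective X.graph.connectedComponentMk
      (fun c => c.ind fun v => ⟨v, rfl⟩)
    simpa using this
  simp only [dgm0, Multiset.card_add, Multiset.card_map, m]
  rw [Finset.card_def] at h₁ h₂
  omega

theorem card_dgm1_le : (X.dgm1 s).card ≤ X.m := by
  simp only [dgm1, Multiset.card_map, m]
  exact Finset.card_filter_le _ _

/-- If no other vertex has the height of `v`, then the edges of this height are the edges from `v`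
to lower vertices. -/
theorem card_edges_height {v : Fin X.n} (hv : ∀ u, u ≠ v → X.height s u ≠ X.height s v) :
    (X.edges.filter fun e => X.edgeHeight s e = X.height s v).card
      = (Finset.univ.filter fun u => X.graph.Adj v u ∧ X.height s u < X.height s v).card := by
  refine Finset.card_bij' (fun e _ => if e.1 = v then e.2 else e.1)
    (fun u _ => if v < u then (v, u) else (u, v)) ?_ ?_ ?_ ?_
  · rintro ⟨a, b⟩ he
    rw [Finset.mem_filter, mem_edges] at he
    simp only [edgeHeight, Finset.mem_filter, Finset.mem_univ, true_and] at he ⊢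
    obtain ⟨⟨hab, hadj⟩, hmax⟩ := he
    by_cases ha : a = v
    · subst ha
      have := hv b hadj.ne'
      rw [if_pos rfl]
      exact ⟨hadj, lt_of_le_of_ne (hmax ▸ le_max_right _ _) this⟩
    · rw [if_neg ha]
      have hb : b = v := by
        by_contra hb
        rcases max_choice (X.height s a) (X.height s b) with h | h
        · exact hv a ha (h ▸ hmax)
        · exact hv b hb (h ▸ hmax)
      subst hb
      exact ⟨hadj.symm, lt_of_le_of_ne (hmax ▸ le_max_left _ _) (hv a ha)⟩
  · intro u hu
    rw [Finset.mem_filter, mem_edges]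
    simp only [edgeHeight, Finset.mem_filter, Finset.mem_univ, true_and] at hu ⊢
    split_ifs with h
    · exact ⟨⟨h, hu.1⟩, max_eq_left hu.2.le⟩
    · exact ⟨⟨lt_of_le_of_ne (not_lt.1 h) hu.1.ne', hu.1.symm⟩, max_eq_right hu.2.le⟩
  · rintro ⟨a, b⟩ he
    rw [Finset.mem_filter, mem_edges] at he
    simp only [edgeHeight] at he ⊢
    obtain ⟨⟨hab, hadj⟩, hmax⟩ := he
    by_cases ha : a = v
    · subst ha; simp [hab]
    · have hb : b = v := by
        by_contra hb
        rcases max_choice (X.height s a) (X.height s b) with h | h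
        · exact hv a ha (h ▸ hmax)
        · exact hv b hb (h ▸ hmax)
      subst hb
      simp [ha, hab.not_gt]
  · intro u hu
    simp only [Finset.mem_filter, Finset.mem_univ, true_and] at hu
    by_cases h : v < u
    · simp [h]
    · simp [h, hu.1.ne']

variable {X} (σ : Equiv.Perm (Fin X.n))

/-- The `e₁`-coordinate of the vertex at the place `a` of the list `σ` (zero beyond the list). -/
noncomputable def xAt (a : ℕ) : ℝ := if h : a < X.n then X.fstCoord (σ ⟨a, h⟩) else 0

/-- The `e₂`-coordinate of the vertex at the place `a` of the list `σ` (zero beyond the list). -/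
noncomputable def yAt (a : ℕ) : ℝ := if h : a < X.n then X.sndCoord (σ ⟨a, h⟩) else 0

/-- The vertices at the places `a` and `b` of the list `σ` are adjacent. -/
def AdjAt (a b : ℕ) : Prop :=
  ∃ (ha : a < X.n) (hb : b < X.n), X.graph.Adj (σ ⟨a, ha⟩) (σ ⟨b, hb⟩)

variable {σ}

theorem AdjAt.symm {a b : ℕ} (h : AdjAt σ a b) : AdjAt σ b a :=
  ⟨h.2.1, h.1, h.2.2.symm⟩

theorem AdjAt.ne {a b : ℕ} (h : AdjAt σ a b) : a ≠ b := by
  rintro rfl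
  exact h.2.2.ne rfl

/-- A direction in the plane of `e₁` and `e₂` sees only the first two coordinates. -/
theorem vector_inner {μ : Memory} {r : ℕ} (h0 : ∀ j, 2 ≤ j → μ.real r j = 0)
    (p : EuclideanSpace ℝ (Fin X.d)) :
    inner ℝ (μ.vector X.d r) p
      = μ.real r 0 * p ⟨0, by have := X.two_le_d; omega⟩
        + μ.real r 1 * p ⟨1, by have := X.two_le_d; omega⟩ := by
  have hd := X.two_le_d
  rw [PiLp.inner_apply]
  have : ∀ j : Fin X.d, j ∉ ({⟨0, by omega⟩, ⟨1, by omega⟩} : Finset (Fin X.d)) →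
      inner ℝ (μ.vector X.d r j) (p j) = 0 := by
    intro j hj
    have : 2 ≤ (j : ℕ) := by
      simp only [Finset.mem_insert, Finset.mem_singleton, Fin.ext_iff] at hj
      omega
    simp [Memory.vector, h0 _ this]
  rw [← Finset.sum_subset (Finset.subset_univ
    ({⟨0, by omega⟩, ⟨1, by omega⟩} : Finset (Fin X.d))) fun j _ hj => this j hj,
    Finset.sum_pair (by simp [Fin.ext_iff])]
  simp [Memory.vector, mul_comm]

theorem norm_vector {μ : Memory} {r : ℕ} (h0 : ∀ j, 2 ≤ j → μ.real r j = 0)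
    (h1 : μ.real r 0 ^ 2 + μ.real r 1 ^ 2 = 1) : ‖μ.vector X.d r‖ = 1 := by
  have := vector_inner (X := X) h0 (μ.vector X.d r)
  have h2 : ‖μ.vector X.d r‖ ^ 2 = 1 := by
    rw [← real_inner_self_eq_norm_sq, this, ← h1, sq, sq]
    rfl
  exact (pow_eq_one_iff_of_nonneg (norm_nonneg _) two_ne_zero).1 h2

theorem height_vector {μ : Memory} {r : ℕ} (h0 : ∀ j, 2 ≤ j → μ.real r j = 0) {a : ℕ}
    (ha : a < X.n) :
    X.height (μ.vector X.d r) (σ ⟨a, ha⟩) = μ.real r 0 * xAt σ a + μ.real r 1 * yAt σ a := by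
  rw [height, vector_inner h0]
  simp [xAt, yAt, ha, fstCoord, sndCoord]

/-- The number of edges of the height of `v`, in terms of the listed vertices. -/
theorem card_edges_vector {μ : Memory} {r : ℕ} (h0 : ∀ j, 2 ≤ j → μ.real r j = 0) {v : ℕ}
    (hv : v < X.n)
    (hne : ∀ u, u < X.n → u ≠ v → μ.real r 0 * xAt σ u + μ.real r 1 * yAt σ u
      ≠ μ.real r 0 * xAt σ v + μ.real r 1 * yAt σ v) :
    (X.edges.filter fun e => X.edgeHeight (μ.vector X.d r) e
        = μ.real r 0 * xAt σ v + μ.real r 1 * yAt σ v).card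
      = ((Finset.range X.n).filter fun u => AdjAt σ v u ∧
          μ.real r 0 * xAt σ u + μ.real r 1 * yAt σ u
            < μ.real r 0 * xAt σ v + μ.real r 1 * yAt σ v).card := by
  rw [← height_vector h0 hv, card_edges_height]
  · refine Finset.card_bij' (fun u _ => (σ.symm u : ℕ))
      (fun u hu => σ ⟨u, Finset.mem_range.1 (Finset.mem_filter.1 hu).1⟩) ?_ ?_ ?_ ?_
    · intro u hu
      simp only [Finset.mem_filter, Finset.mem_univ, true_and, Finset.mem_range] at hu ⊢
      refine ⟨(σ.symm u).2, ⟨hv, (σ.symm u).2, by simpa using hu.1⟩, ?_⟩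
      rw [← height_vector h0 (σ.symm u).2]
      simpa using hu.2
    · intro u hu
      simp only [Finset.mem_filter, Finset.mem_univ, true_and, Finset.mem_range] at hu ⊢
      refine ⟨hu.2.1.2.2, ?_⟩
      rw [height_vector h0]
      exact hu.2.2
    · intro u _; simp
    · intro u _; simp
  · intro u hu
    have h₁ := hne (σ.symm u) (σ.symm u).2 (by
      rintro h
      apply hu
      rw [← σ.apply_symm_apply u]
      congr 1
      exact Fin.ext h)
    rw [← height_vector h0 (σ.symm u).2, ← height_vector h0 hv] at h₁
    simpa using h₁

end ImmersedGraph

/-! ### Reading the answer of the oracle -/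

section Answer

variable {τ : ImmersedGraph → ℕ} {X : ImmersedGraph} {μ : Memory}

/-- The part of an answer of the oracle, written from bank `b` on, from which the number of edges of
each height can be read off. -/
structure HoldsAnswer (b : ℕ) (D₀ D₁ : Multiset (ℝ × WithTop ℝ)) (μ : Memory) : Prop where
  card₀ : μ.nat b 0 = D₀.card
  card₁ : μ.nat b 1 = D₁.card
  count₀ : ∀ h : ℝ, ((Finset.range D₀.card).filter fun i =>
    μ.nat (b + 1) i = 1 ∧ μ.real (b + 1) i = h).card = D₀.countP (fun p => p.2 = (h : WithTop ℝ))
  count₁ : ∀ h : ℝ, ((Finset.range D₁.card).filter fun i =>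
    μ.real (b + 4) i = h).card = D₁.countP (fun p => p.1 = h)

theorem coe_sortByBirth (D : Multiset (ℝ × WithTop ℝ)) : (sortByBirth D : Multiset _) = D := by
  rw [sortByBirth, ← Multiset.map_coe, Multiset.sort_eq, Multiset.map_map]
  exact Multiset.map_id D

theorem Memory.holdsAnswer_writeAnswer (μ : Memory) (b : ℕ) (D₀ D₁ : Multiset (ℝ × WithTop ℝ)) :
    HoldsAnswer b D₀ D₁ (μ.writeAnswer b D₀ D₁) := by
  have len : ∀ D : Multiset (ℝ × WithTop ℝ), (sortByBirth D).length = D.card := fun D => by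
    rw [← Multiset.coe_card, coe_sortByBirth]
  have cnt : ∀ (D : Multiset (ℝ × WithTop ℝ)) (p : ℝ × WithTop ℝ → Prop) [DecidablePred p],
      D.countP p = (sortByBirth D).countP (fun x => p x) := fun D p _ => by
    conv_lhs => rw [← coe_sortByBirth D, Multiset.coe_countP]
  constructor
  · unfold writeAnswer
    iterate 4 rw [writePoints_nat_of_ne _ _ (by omega)]
    simp
  · unfold writeAnswer
    iterate 4 rw [writePoints_nat_of_ne _ _ (by omega)]
    simp
  · intro h
    have hn : ∀ i < D₀.card, (μ.writeAnswer b D₀ D₁).nat (b + 1) i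
        = if ((sortByBirth D₀).getD i (0, ⊤)).2 = ⊤ then 0 else 1 := fun i hi => by
      unfold writeAnswer
      iterate 3 rw [writePoints_nat_of_ne _ _ (by omega)]
      simp [writePoints, len, hi]
    have hr : ∀ i < D₀.card, (μ.writeAnswer b D₀ D₁).real (b + 1) i
        = ((sortByBirth D₀).getD i (0, ⊤)).2.untopD 0 := fun i hi => by
      unfold writeAnswer
      iterate 3 rw [writePoints_real_of_ne _ _ (by omega) (by omega)]
      simp [writePoints, len, hi]
    rw [cnt, ← card_filter_range_getD _ (0, ⊤), len]
    refine congrArg _ (Finset.filter_congr fun i hi => ?_)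
    rw [Finset.mem_range] at hi
    rw [hn i hi, hr i hi]
    cases ((sortByBirth D₀).getD i (0, ⊤)).2 <;> simp
  · intro h
    have hr : ∀ i < D₁.card, (μ.writeAnswer b D₀ D₁).real (b + 4) i
        = ((sortByBirth D₁).getD i (0, ⊤)).1 := fun i hi => by
      unfold writeAnswer
      iterate 1 rw [writePoints_real_of_ne _ _ (by omega) (by omega)]
      simp [writePoints, len, hi]
    rw [cnt, ← card_filter_range_getD _ (0, ⊤), len]
    refine congrArg _ (Finset.filter_congr fun i hi => ?_)
    rw [Finset.mem_range] at hi
    rw [hr i hi]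

theorem Ends.query {r b : ℕ} (h0 : ∀ j, 2 ≤ j → μ.real r j = 0)
    (h1 : μ.real r 0 ^ 2 + μ.real r 1 ^ 2 = 1) :
    Ends τ X (.query r b) μ (oracleTime τ X) 1
      (HoldsAnswer b (X.dgm0 (μ.vector X.d r)) (X.dgm1 (μ.vector X.d r))) :=
  ⟨_, _, _, .query μ r b (ImmersedGraph.norm_vector h0 h1), le_rfl, le_rfl,
    μ.holdsAnswer_writeAnswer _ _ _⟩

/-- Count the edges whose height is the number in the real bank `B + 18`, from the answer of the
oracle in the banks from `B + 4` on; the result goes into the natural bank `B + 11`. -/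
def countEdges (B : ℕ) : Program :=
  .seq (.setNat (B + 11) (.const 0) (.const 0)) (.seq
    (.countLoop (B + 10) (B + 11) (.var (B + 4))
      (.and (.natEq (.read (B + 5) (.var (B + 10))) (.const 1))
        (.realEq (.read (B + 5) (.var (B + 10))) (.var (B + 18)))))
    (.countLoop (B + 10) (B + 11) (.read (B + 4) (.const 1))
      (.realEq (.read (B + 8) (.var (B + 10))) (.var (B + 18)))))

theorem ends_countEdges {B : ℕ} {s : EuclideanSpace ℝ (Fin X.d)}
    (hA : HoldsAnswer (B + 4) (X.dgm0 s) (X.dgm1 s) μ) :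
    Ends τ X (countEdges B) μ (100 * (X.n + X.m + 1)) 0
      (fun μ' => μ'.nat (B + 11) 0
        = (X.edges.filter fun e => X.edgeHeight s e = μ.real (B + 18) 0).card) := by
  have e₁ : Ends τ X (.setNat (B + 11) (.const 0) (.const 0)) μ 3 0
      (fun μ' => μ'.nat (B + 11) 0 = 0) :=
    Ends.straight (by trivial) (by simp [Program.exec, NExp.eval]) le_rfl
  refine e₁.seq_le (t₂ := (X.dgm0 s).card * 30 + 10 + ((X.dgm1 s).card * 30 + 10)) (q₂ := 0)
    (fun μ₁ f₁ h₁ => ?_) ?_ le_rfl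
  · refine (Ends.countLoop (j := B + 10) (acc := B + 11) (n := (X.dgm0 s).card)
        (fun i => μ.nat (B + 5) i = 1 ∧ μ.real (B + 5) i = μ.real (B + 18) 0) (by simp)
        (fun μ' f => ?_) (fun k hk μ' f hk' => ?_)).seq_le (fun μ₂ f₂ h₂ =>
      (Ends.countLoop (j := B + 10) (acc := B + 11) (n := (X.dgm1 s).card)
        (fun i => μ.real (B + 8) i = μ.real (B + 18) 0) (by simp)
        (fun μ' f => ?_) (fun k hk μ' f hk' => ?_)).mono (t' := (X.dgm1 s).card * 30 + 10)
        ?_ le_rfl fun μ' _ h => ?_) ?_ le_rfl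
    · simp only [Program.countLoop, Program.forLoop] at f
      rw [NExp.eval, f.nat (by simp [Program.WritesNat]), f₁.nat (by simp [Program.WritesNat])]
      exact hA.card₀
    · simp only [Program.countLoop, Program.forLoop] at f
      simp only [Cond.Holds, NExp.eval, RExp.eval, hk']
      rw [f.nat (by simp [Program.WritesNat]), f₁.nat (by simp [Program.WritesNat]),
        f.real (by simp [Program.WritesReal]), f₁.real (by simp [Program.WritesReal]),
        f.real (by simp [Program.WritesReal]), f₁.real (by simp [Program.WritesReal])]
    · simp only [Program.countLoop, Program.forLoop] at f f₂
      rw [NExp.eval, f.nat (by simp [Program.WritesNat]), f₂.nat (by simp [Program.WritesNat]),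
        f₁.nat (by simp [Program.WritesNat])]
      exact hA.card₁
    · simp only [Program.countLoop, Program.forLoop] at f f₂
      simp only [Cond.Holds, NExp.eval, RExp.eval, hk']
      rw [f.real (by simp [Program.WritesReal]), f₂.real (by simp [Program.WritesReal]),
        f₁.real (by simp [Program.WritesReal]),
        f.real (by simp [Program.WritesReal]), f₂.real (by simp [Program.WritesReal]),
        f₁.real (by simp [Program.WritesReal])]
    · simp only [Cond.cost, NExp.cost, RExp.cost]
      omega
    · rw [h, h₂, h₁, ← X.countP_dgm_eq_card_edges, ← hA.count₀, ← hA.count₁, Nat.zero_add]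
      congr!
    · simp only [Cond.cost, NExp.cost, RExp.cost]
      omega
  · have := X.card_dgm0_le s
    have := X.card_dgm1_le s
    omega

end Answer

/-! ### Tournament trees and selection sort -/

section Tournament

/-- The node `k'` lies on the path from the node `k` to the root. -/
def OnPath (k k' : ℕ) : Prop := ∃ i, k' = k / 2 ^ i

theorem OnPath.refl (k : ℕ) : OnPath k k := ⟨0, by simp⟩

theorem OnPath.half {k k' : ℕ} (h : OnPath k k') : OnPath k (k' / 2) := by
  obtain ⟨i, rfl⟩ := h
  exact ⟨i + 1, by rw [pow_succ, Nat.div_div_eq_div_mul]⟩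

theorem OnPath.eq_or_half {k k' : ℕ} (h : OnPath k k') : k' = k ∨ OnPath (k / 2) k' := by
  obtain ⟨i, rfl⟩ := h
  cases i with
  | zero => simp
  | succ i => exact Or.inr ⟨i, by rw [pow_succ', Nat.div_div_eq_div_mul]⟩

theorem not_onPath_zero {k : ℕ} (hk : 1 ≤ k) : ¬ OnPath 0 k := by
  rintro ⟨i, rfl⟩
  simp at hk

/-- The player `w` wins against the winners at the two children of the node `k`: it is one of them,
and its key is not larger. -/
def Wins (t : ℕ → ℕ) (key : ℕ → ℝ) (k w : ℕ) : Prop :=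
  (w = t (2 * k) ∨ w = t (2 * k + 1)) ∧ key w ≤ key (t (2 * k)) ∧ key w ≤ key (t (2 * k + 1))

/-- The nodes of a tournament between the players `0, …, n - 1`, with the children `2 k` and
`2 k + 1` of a node `k < n`, the player `u` at the leaf `n + u`, and the winner of the subtree of
`k`, which starts at a leaf below `k`, in `t k`. Nothing is said about the nodes up to `k₀`. -/
structure Shape (n : ℕ) (t : ℕ → ℕ) (k₀ : ℕ) : Prop where
  leaf : ∀ u < n, t (n + u) = u
  lt : ∀ k, k₀ < k → k < 2 * n → t k < n
  path : ∀ k, k₀ < k → k < 2 * n → OnPath (n + t k) k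

variable {n : ℕ} {t : ℕ → ℕ} {key : ℕ → ℝ} {k w : ℕ}

/-- Playing at the node `k` keeps the shape, and extends it to `k` if it was missing there. -/
theorem Shape.update {k₀ k₁ : ℕ} (h : Shape n t k₀) (hk₀ : k₀ ≤ k)
    (hk₁ : k₀ ≤ k₁ ∨ k₀ = k ∧ k ≤ k₁ + 1) (hk : k < n) (hk1 : 1 ≤ k) (hw : Wins t key k w) :
    Shape n (Function.update t k w) k₁ := by
  have hw' : w < n ∧ OnPath (n + w) k := by
    rcases hw.1 with rfl | rfl
    · refine ⟨h.lt _ (by omega) (by omega), ?_⟩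
      have := (h.path (2 * k) (by omega) (by omega)).half
      rwa [show 2 * k / 2 = k by omega] at this
    · refine ⟨h.lt _ (by omega) (by omega), ?_⟩
      have := (h.path (2 * k + 1) (by omega) (by omega)).half
      rwa [show (2 * k + 1) / 2 = k by omega] at this
  refine ⟨fun u hu => ?_, fun k' hk' hk'' => ?_, fun k' hk' hk'' => ?_⟩
  · rw [Function.update_of_ne (by omega)]
    exact h.leaf u hu
  · by_cases e : k' = k
    · subst e; simpa using hw'.1
    · rw [Function.update_of_ne e]
      exact h.lt _ (by omega) hk''
  · by_cases e : k' = k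
    · subst e; simpa using hw'.2
    · rw [Function.update_of_ne e]
      exact h.path _ (by omega) hk''

theorem Wins.update_of_ne {k' : ℕ} (h : Wins t key k' (t k')) (hne : k' ≠ k) (hk : k' ≠ k / 2) :
    Wins (Function.update t k w) key k' (Function.update t k w k') := by
  unfold Wins
  rw [Function.update_of_ne hne, Function.update_of_ne (by omega),
    Function.update_of_ne (by omega)]
  exact h

theorem Wins.update_self (h : Wins t key k w) (hk : 1 ≤ k) :
    Wins (Function.update t k w) key k (Function.update t k w k) := by
  unfold Wins
  rw [Function.update_self, Function.update_of_ne (by omega), Function.update_of_ne (by omega)]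
  exact h

/-- Raising the key of one player spoils only the nodes where this player wins. -/
theorem Wins.raise {u : ℕ} {a : ℝ} (h : Wins t key k (t k)) (hu : t k ≠ u) (ha : key u ≤ a) :
    Wins t (Function.update key u a) k (t k) := by
  have : ∀ x, key x ≤ Function.update key u a x := fun x => by
    by_cases hx : x = u
    · subst hx; simpa using ha
    · rw [Function.update_of_ne hx]
  refine ⟨h.1, ?_, ?_⟩ <;> rw [Function.update_of_ne hu]
  · exact h.2.1.trans (this _)
  · exact h.2.2.trans (this _)

/-- The winner at the root has the smallest key. -/
theorem root_le (h : ∀ k, 1 ≤ k → k < n → Wins t key k (t k)) :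
    ∀ k, 1 ≤ k → k < 2 * n → key (t 1) ≤ key (t k) := by
  intro k
  induction k using Nat.strong_induction_on with
  | _ k ih =>
    intro hk hkn
    by_cases hk1 : k = 1
    · rw [hk1]
    · refine (ih (k / 2) (by omega) (by omega) (by omega)).trans ?_
      have := (h (k / 2) (by omega) (by omega)).2
      rcases Nat.mod_two_eq_zero_or_one k with e | e
      · rw [show 2 * (k / 2) = k by omega] at this; exact this.1
      · rw [show 2 * (k / 2) + 1 = k by omega] at this; exact this.2

/-- The state of selection sort with a tournament after `j` of the players other than `v` have been
listed in `ord`, with their keys `φ` in `skey`; the key of a listed player and of `v` is `2`. -/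
structure Extracted (n v : ℕ) (φ : ℕ → ℝ) (j : ℕ) (ord : ℕ → ℕ) (skey key : ℕ → ℝ) : Prop where
  lt : ∀ i < j, ord i < n
  ne : ∀ i < j, ord i ≠ v
  eq : ∀ i < j, skey i = φ (ord i)
  mono : ∀ i i', i < i' → i' < j → skey i < skey i'
  self : key v = 2
  listed : ∀ i < j, key (ord i) = 2
  rest : ∀ u < n, u ≠ v → (∀ i < j, ord i ≠ u) → key u = φ u
  gt : ∀ u < n, u ≠ v → (∀ i < j, ord i ≠ u) → ∀ i < j, skey i < φ u

/-- The places other than `v` are listed in `ord` by increasing `φ`, with the values of `φ` in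
`skey`. -/
structure SortedBy (n v : ℕ) (φ : ℕ → ℝ) (ord : ℕ → ℕ) (skey : ℕ → ℝ) : Prop where
  lt : ∀ i < n - 1, ord i < n
  ne : ∀ i < n - 1, ord i ≠ v
  eq : ∀ i < n - 1, skey i = φ (ord i)
  mono : ∀ i i', i < i' → i' < n - 1 → skey i < skey i'
  surj : ∀ u < n, u ≠ v → ∃ i < n - 1, ord i = u

variable {v j : ℕ} {φ : ℕ → ℝ} {ord : ℕ → ℕ} {skey : ℕ → ℝ}

/-- Before the last step a player other than `v` is left, by counting. -/
theorem exists_rest (h : j + 1 < n) (ord : ℕ → ℕ) (v : ℕ) :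
    ∃ u < n, u ≠ v ∧ ∀ i < j, ord i ≠ u := by
  by_contra! hcon
  have hsub : Finset.range n ⊆ insert v ((Finset.range j).image ord) := fun u hu => by
    by_cases huv : u = v
    · simp [huv]
    · obtain ⟨i, hi, rfl⟩ := hcon u (Finset.mem_range.1 hu) huv
      exact Finset.mem_insert_of_mem (Finset.mem_image_of_mem _ (Finset.mem_range.2 hi))
  have h₁ := Finset.card_le_card hsub
  have h₂ := Finset.card_insert_le v ((Finset.range j).image ord)
  have h₃ := Finset.card_image_le (s := Finset.range j) (f := ord)
  simp only [Finset.card_range] at h₁ h₃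
  omega

theorem Extracted.sortedBy (hv : v < n) (h : Extracted n v φ (n - 1) ord skey key) :
    SortedBy n v φ ord skey := by
  refine ⟨h.lt, h.ne, h.eq, h.mono, fun u hu huv => ?_⟩
  have hinj : Set.InjOn ord (Finset.range (n - 1) : Set ℕ) := by
    intro a ha b hb hab
    simp only [Finset.coe_range, Set.mem_Iio] at ha hb
    rcases lt_trichotomy a b with hlt | rfl | hlt
    · have := h.mono a b hlt hb
      rw [h.eq a ha, h.eq b hb, hab] at this
      exact absurd this (lt_irrefl _)
    · rfl
    · have := h.mono b a hlt ha
      rw [h.eq a ha, h.eq b hb, hab] at this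
      exact absurd this (lt_irrefl _)
  have heq : (Finset.range (n - 1)).image ord = (Finset.range n).erase v := by
    refine Finset.eq_of_subset_of_card_le (fun x hx => ?_) ?_
    · obtain ⟨i, hi, rfl⟩ := Finset.mem_image.1 hx
      rw [Finset.mem_range] at hi
      exact Finset.mem_erase.2 ⟨h.ne i hi, Finset.mem_range.2 (h.lt i hi)⟩
    · rw [Finset.card_image_of_injOn hinj, Finset.card_erase_of_mem (Finset.mem_range.2 hv)]
      simp
  have : u ∈ (Finset.range (n - 1)).image ord := by
    rw [heq]; exact Finset.mem_erase.2 ⟨huv, Finset.mem_range.2 hu⟩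
  obtain ⟨i, hi, rfl⟩ := Finset.mem_image.1 this
  exact ⟨i, Finset.mem_range.1 hi, rfl⟩

/-- The player with the smallest key comes next in the order; its key is below `2`, so that it is
neither `v` nor listed. -/
theorem Extracted.step (h : Extracted n v φ j ord skey key) (hj : j + 1 < n)
    (hφ : ∀ u < n, φ u < 2)
    (hinj : ∀ a < n, a ≠ v → ∀ b < n, b ≠ v → φ a = φ b → a = b) {u : ℕ} (hu : u < n)
    (hmin : ∀ a < n, key u ≤ key a) :
    Extracted n v φ (j + 1) (Function.update ord j u) (Function.update skey j (key u))
      (Function.update key u 2) := by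
  obtain ⟨w, hw, hwv, hwi⟩ := exists_rest hj ord v
  have hlt : key u < 2 := (hmin w hw).trans_lt (h.rest w hw hwv hwi ▸ hφ w hw)
  have huv : u ≠ v := fun e => by rw [e, h.self] at hlt; exact lt_irrefl _ hlt
  have hui : ∀ i < j, ord i ≠ u := fun i hi e => by
    rw [← e, h.listed i hi] at hlt; exact lt_irrefl _ hlt
  have hold : ∀ i < j, Function.update ord j u i = ord i := fun i hi =>
    Function.update_of_ne hi.ne _ _
  have holds : ∀ i < j, Function.update skey j (key u) i = skey i := fun i hi =>
    Function.update_of_ne hi.ne _ _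
  have hku := h.rest u hu huv hui
  constructor
  · intro i hi
    rcases Nat.lt_succ_iff_lt_or_eq.1 hi with hi | rfl
    · rw [hold i hi]; exact h.lt i hi
    · simpa using hu
  · intro i hi
    rcases Nat.lt_succ_iff_lt_or_eq.1 hi with hi | rfl
    · rw [hold i hi]; exact h.ne i hi
    · simpa using huv
  · intro i hi
    rcases Nat.lt_succ_iff_lt_or_eq.1 hi with hi | rfl
    · rw [hold i hi, holds i hi]; exact h.eq i hi
    · simpa using hku
  · intro i i' hii hi'
    rcases Nat.lt_succ_iff_lt_or_eq.1 hi' with hi' | rfl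
    · rw [holds i (hii.trans hi'), holds i' hi']; exact h.mono i i' hii hi'
    · rw [holds i hii, Function.update_self, hku]
      exact h.gt u hu huv hui i hii
  · rw [Function.update_of_ne huv.symm]; exact h.self
  · intro i hi
    rcases Nat.lt_succ_iff_lt_or_eq.1 hi with hi | rfl
    · rw [hold i hi, Function.update_of_ne (hui i hi)]; exact h.listed i hi
    · simp
  · intro a ha hav hai
    have : a ≠ u := fun e => hai j (Nat.lt_succ_self j) (by simp [e])
    rw [Function.update_of_ne this]
    exact h.rest a ha hav fun i hi => hold i hi ▸ hai i (by omega)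
  · intro a ha hav hai i hi
    have hau : a ≠ u := fun e => hai j (Nat.lt_succ_self j) (by simp [e])
    have hai' : ∀ i < j, ord i ≠ a := fun i hi => hold i hi ▸ hai i (by omega)
    rcases Nat.lt_succ_iff_lt_or_eq.1 hi with hi | rfl
    · rw [holds i hi]; exact h.gt a ha hav hai' i hi
    · rw [Function.update_self, hku]
      refine lt_of_le_of_ne ?_ fun e => hau (hinj u hu huv a ha hav e).symm
      rw [← hku, ← h.rest a ha hav hai']
      exact hmin a ha

end Tournament

/-! ### A program that sorts by angle -/

section SortProgram

variable {τ : ImmersedGraph → ℕ} {X : ImmersedGraph} {μ : Memory} {B n v : ℕ} {φ : ℕ → ℝ}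

/-- Let the winners at the children of the node `k` (bank `B + 18`) compete at `k`. -/
def compete (B : ℕ) : Program :=
  .ite (.realLt
      (.read (B + 16) (.read (B + 16) (.add (.add (.var (B + 18)) (.var (B + 18))) (.const 1))))
      (.read (B + 16) (.read (B + 16) (.add (.var (B + 18)) (.var (B + 18))))))
    (.setNat (B + 16) (.var (B + 18))
      (.read (B + 16) (.add (.add (.var (B + 18)) (.var (B + 18))) (.const 1))))
    (.setNat (B + 16) (.var (B + 18)) (.read (B + 16) (.add (.var (B + 18)) (.var (B + 18)))))

theorem exec_compete (d : ℕ) (μ : Memory) (B : ℕ) :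
    ∃ w, Wins (μ.nat (B + 16)) (μ.real (B + 16)) (μ.nat (B + 18) 0) w ∧
      (compete B).exec d μ = μ.setNat (B + 16) (μ.nat (B + 18) 0) w := by
  simp only [compete, Program.exec, Cond.Holds, NExp.eval, RExp.eval, ← two_mul]
  split_ifs with h
  · exact ⟨_, ⟨Or.inr rfl, h.le, le_rfl⟩, rfl⟩
  · exact ⟨_, ⟨Or.inl rfl, le_rfl, not_lt.1 h⟩, rfl⟩

/-- Compute the angles `φ u` of the lines from the vertex `v` (bank `B + 15`) to the other vertices
into the real bank `B + 15`, and prepare the tournament: the key of `u` is `φ u`, and `2`, which is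
larger than all angles, for `u = v`. -/
def computeAngles (B : ℕ) : Program :=
  .seq
    (.forLoop (B + 10) (.var 0)
      (.seq (.setReal (B + 15) (.var (B + 10))
          (.arctan (.div
            (.sub (.read (B + 13) (.var (B + 10))) (.read (B + 13) (.var (B + 15))))
            (.sub (.read (B + 14) (.var (B + 10))) (.read (B + 14) (.var (B + 15)))))))
        (.seq (.setReal (B + 16) (.var (B + 10)) (.read (B + 15) (.var (B + 10))))
          (.setNat (B + 16) (.add (.var 0) (.var (B + 10))) (.var (B + 10))))))
    (.setReal (B + 16) (.var (B + 15)) (.ofNat (.const 2)))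

/-- Play the tournament at the nodes `n - 1, …, 1`. -/
def playTournament (B : ℕ) : Program :=
  .seq (.setNat (B + 18) (.const 0) (.sub (.var 0) (.const 1)))
    (.while (.natLt (.const 0) (.var (B + 18)))
      (.seq (compete B) (.setNat (B + 18) (.const 0) (.sub (.var (B + 18)) (.const 1)))))

/-- Append the winner of the tournament to the list in the natural bank `B + 17`, and its key to the
list in the real bank `B + 17`. Then raise its key to `2` and play again at the nodes from its leaf
to the root. -/
def extractWinner (B : ℕ) : Program :=
  .seq
    (.seq (.setNat (B + 19) (.const 0) (.read (B + 16) (.const 1)))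
      (.seq (.setNat (B + 17) (.var (B + 10)) (.var (B + 19)))
        (.seq (.setReal (B + 17) (.var (B + 10)) (.read (B + 16) (.var (B + 19))))
          (.seq (.setReal (B + 16) (.var (B + 19)) (.ofNat (.const 2)))
            (.setNat (B + 18) (.const 0) (.half (.add (.var 0) (.var (B + 19)))))))))
    (.while (.natLt (.const 0) (.var (B + 18)))
      (.seq (compete B) (.setNat (B + 18) (.const 0) (.half (.var (B + 18))))))

/-- Sort the other vertices by the angles of the lines from `v`. -/
def sortByAngle (B : ℕ) : Program :=
  .seq (computeAngles B) (.seq (playTournament B)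
    (.forLoop (B + 10) (.sub (.var 0) (.const 1)) (extractWinner B)))

theorem ends_computeAngles (hn : μ.nat 0 0 = n) (hv : μ.nat (B + 15) 0 = v)
    (hφ : ∀ u < n, φ u = Real.arctan ((μ.real (B + 13) u - μ.real (B + 13) v)
      / (μ.real (B + 14) u - μ.real (B + 14) v))) :
    Ends τ X (computeAngles B) μ (80 * n + 20) 0 (fun μ' =>
      (∀ u < n, μ'.real (B + 15) u = φ u) ∧ (∀ u < n, u ≠ v → μ'.real (B + 16) u = φ u) ∧
      μ'.real (B + 16) v = 2 ∧ ∀ u < n, μ'.nat (B + 16) (n + u) = u) := by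
  refine (Ends.forLoop (n := n) (t := 40) (q := 0) (fun k μ' =>
      (∀ u < k, μ'.real (B + 15) u = φ u) ∧ (∀ u < k, μ'.real (B + 16) u = φ u) ∧
      ∀ u < k, μ'.nat (B + 16) (n + u) = u)
      (by simp [Program.WritesNat]) (fun μ' f => ?_) (by simp) ?_).seq_le (t₂ := 10) (q₂ := 0)
    (fun μ₁ f₁ h₁ => ?_) ?_ (by simp)
  · rw [NExp.eval, f.nat (by simp [Program.forLoop, Program.WritesNat])]
    exact hn
  · intro k hk μ' f hk' ⟨h₁, h₂, h₃⟩
    have e₀ : μ'.nat 0 0 = n := by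
      rw [f.nat (by simp [Program.forLoop, Program.WritesNat]), hn]
    have e₁ : μ'.nat (B + 15) 0 = v := by
      rw [f.nat (by simp [Program.forLoop, Program.WritesNat]), hv]
    have e₂ : μ'.real (B + 13) = μ.real (B + 13) :=
      f.real (by simp [Program.forLoop, Program.WritesReal])
    have e₃ : μ'.real (B + 14) = μ.real (B + 14) :=
      f.real (by simp [Program.forLoop, Program.WritesReal])
    refine Ends.straight (by simp [Program.IsStraight]) ?_
      (by simp [Program.maxCost, NExp.cost, RExp.cost])
    simp only [Program.exec, NExp.eval, RExp.eval, hk', e₁, e₂, e₃]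
    simp only [← hφ k hk]
    refine ⟨fun u hu => ?_, fun u hu => ?_, fun u hu => ?_⟩
    · by_cases e : u = k
      · subst e; simp
      · simp [e, h₁ u (by omega)]
    · by_cases e : u = k
      · subst e; simp [hk', e₀]
      · simp [e, hk', e₀, h₂ u (by omega)]
    · by_cases e : u = k
      · subst e; simp [hk', e₀]
      · simp [e, hk', e₀, h₃ u (by omega)]
  · have e₁ : μ₁.nat (B + 15) 0 = v := by
      rw [f₁.nat (by simp [Program.forLoop, Program.WritesNat]), hv]
    refine Ends.straight (by simp [Program.IsStraight]) ?_
      (by simp [Program.maxCost, NExp.cost, RExp.cost])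
    simp only [Program.exec, NExp.eval, RExp.eval, e₁]
    refine ⟨fun u hu => by simp [h₁.1 u hu], fun u hu e => by simp [e, h₁.2.1 u hu], by simp,
      fun u hu => by simp [h₁.2.2 u hu]⟩
  · simp only [NExp.cost]; omega

theorem ends_playTournament (hn : μ.nat 0 0 = n) (hn1 : 1 ≤ n)
    (hleaf : ∀ u < n, μ.nat (B + 16) (n + u) = u) :
    Ends τ X (playTournament B) μ (80 * n + 20) 0 (fun μ' => Shape n (μ'.nat (B + 16)) 0 ∧
      ∀ k, 1 ≤ k → k < n → Wins (μ'.nat (B + 16)) (μ'.real (B + 16)) k (μ'.nat (B + 16) k)) := by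
  have e₁ : Ends τ X (.setNat (B + 18) (.const 0) (.sub (.var 0) (.const 1))) μ 10 0
      (fun μ' => μ'.nat (B + 18) 0 = n - 1) :=
    Ends.straight (by simp [Program.IsStraight]) (by simp [Program.exec, NExp.eval, hn])
      (by simp [Program.maxCost, NExp.cost])
  refine e₁.seq_le (t₂ := 70 * n + 10) (q₂ := 0)
    (fun μ₁ f₁ h₁ => (Ends.while (l := n - 1) (t := 60) (q := 0) (fun l μ' =>
    μ'.nat (B + 18) 0 = l ∧ l < n ∧ Shape n (μ'.nat (B + 16)) l ∧
      ∀ k, l < k → k < n → Wins (μ'.nat (B + 16)) (μ'.real (B + 16)) k (μ'.nat (B + 16) k))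
      ⟨h₁, by omega, ?_, fun k _ _ => by omega⟩ ?_).mono ?_ (by simp)
      fun μ' f h => ?_) (by omega) (by simp)
  · have : ∀ u < n, μ₁.nat (B + 16) (n + u) = u := by
      rw [f₁.nat (by simp [Program.WritesNat])]; exact hleaf
    refine ⟨this, fun k hk hk' => ?_, fun k hk hk' => ?_⟩
    · obtain ⟨u, rfl⟩ := Nat.exists_eq_add_of_le (show n ≤ k by omega)
      rw [this u (by omega)]; omega
    · obtain ⟨u, rfl⟩ := Nat.exists_eq_add_of_le (show n ≤ k by omega)
      rw [this u (by omega)]; exact OnPath.refl _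
  · rintro l μ' f ⟨hl, hln, hS, hW⟩ hc
    have hl0 : 0 < l := by simpa [Cond.Holds, NExp.eval, hl] using hc
    refine ⟨hl0, Ends.straight (by simp [Program.IsStraight, compete]) ?_
      (by simp [Program.maxCost, NExp.cost, compete, Cond.cost, RExp.cost])⟩
    obtain ⟨w, hw, he⟩ := exec_compete X.d μ' B
    rw [hl] at hw he
    simp only [Program.exec, he, NExp.eval]
    have h1 := hS.update (k₁ := l - 1) le_rfl (Or.inr ⟨rfl, by omega⟩) hln hl0 hw
    refine ⟨by simp [hl], by omega, by simpa using h1, fun k hk hkn => ?_⟩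
    simp only [Memory.setNat_nat_of_ne _ _ _ (show B + 16 ≠ B + 18 by simp), Memory.setNat_nat,
      Memory.setNat_real]
    by_cases e : k = l
    · subst e; exact hw.update_self hl0
    · exact (hW k (by omega) hkn).update_of_ne e (by omega)
  · simp only [Cond.cost, NExp.cost]; omega
  · obtain ⟨hc, l, hl, hln, hS, hW⟩ := h
    have hl0 : l = 0 := by simpa [Cond.Holds, NExp.eval, hl] using hc
    subst hl0
    exact ⟨hS, fun k hk => hW k hk⟩

/-- Each pass through the loop moves the only possible place of a wrong winner one level up. -/
theorem ends_extractWinner {L j : ℕ} (hn : μ.nat 0 0 = n) (hL : n ≤ 2 ^ L)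
    (hj : μ.nat (B + 10) 0 = j) (hjn : j + 1 < n)
    (hφ : ∀ u < n, φ u < 2)
    (hinj : ∀ a < n, a ≠ v → ∀ b < n, b ≠ v → φ a = φ b → a = b)
    (hS : Shape n (μ.nat (B + 16)) 0)
    (hW : ∀ k, 1 ≤ k → k < n → Wins (μ.nat (B + 16)) (μ.real (B + 16)) k (μ.nat (B + 16) k))
    (hE : Extracted n v φ j (μ.nat (B + 17)) (μ.real (B + 17)) (μ.real (B + 16))) :
    Ends τ X (extractWinner B) μ (80 * L + 80) 0 (fun μ' => Shape n (μ'.nat (B + 16)) 0 ∧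
      (∀ k, 1 ≤ k → k < n → Wins (μ'.nat (B + 16)) (μ'.real (B + 16)) k (μ'.nat (B + 16) k)) ∧
      Extracted n v φ (j + 1) (μ'.nat (B + 17)) (μ'.real (B + 17)) (μ'.real (B + 16))) := by
  set u := μ.nat (B + 16) 1 with hu
  have hun : u < n := hS.lt 1 one_pos (by omega)
  have hmin : ∀ a < n, μ.real (B + 16) u ≤ μ.real (B + 16) a := fun a ha => by
    have := root_le hW (n + a) (by omega) (by omega)
    rwa [hS.leaf a ha] at this
  have hku : μ.real (B + 16) u ≤ 2 := by
    obtain ⟨w, hw, hwv, hwi⟩ := exists_rest hjn (μ.nat (B + 17)) v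
    exact (hmin w hw).trans (hE.rest w hw hwv hwi ▸ (hφ w hw).le)
  have hstep := hE.step hjn hφ hinj hun hmin
  refine Ends.seq_le (t₁ := 60) (q₁ := 0) (R := fun μ' => μ'.nat (B + 18) 0 = (n + u) / 2 ∧
      μ'.nat (B + 16) = μ.nat (B + 16) ∧
      μ'.real (B + 16) = Function.update (μ.real (B + 16)) u 2 ∧
      μ'.nat (B + 17) = Function.update (μ.nat (B + 17)) j u ∧
      μ'.real (B + 17) = Function.update (μ.real (B + 17)) j (μ.real (B + 16) u)) ?_
    (t₂ := 80 * L + 20) (q₂ := 0) (fun μ₁ f₁ h₁ => ?_) (by omega) (by simp)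
  · refine Ends.straight (by simp [Program.IsStraight]) ?_
      (by simp [Program.maxCost, NExp.cost, RExp.cost])
    simp [Program.exec, NExp.eval, RExp.eval, hn, hj, ← hu]
  · obtain ⟨h18, h16, hr16, h17, hr17⟩ := h₁
    refine (Ends.while (l := L) (t := 60) (q := 0) (fun l μ' => ∃ k,
      μ'.nat (B + 18) 0 = k ∧ k < 2 ^ l ∧ k < n ∧ Shape n (μ'.nat (B + 16)) 0 ∧
      (∀ k', 1 ≤ k' → k' < n → OnPath k k' ∨
        Wins (μ'.nat (B + 16)) (μ'.real (B + 16)) k' (μ'.nat (B + 16) k')))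
      ⟨(n + u) / 2, h18, by omega, by omega, h16 ▸ hS, fun k' hk' hkn => ?_⟩ ?_).mono
        ?_ (by simp) fun μ' f h => ?_
    · -- raising the key of `u` spoils only nodes where `u` wins, and these lie above its leaf
      rw [h16, hr16]
      by_cases e : μ.nat (B + 16) k' = u
      · have := hS.path k' hk' (by omega)
        rw [e] at this
        rcases this.eq_or_half with h | h
        · omega
        · exact Or.inl h
      · exact Or.inr ((hW k' hk' hkn).raise e hku)
    · rintro l μ' f ⟨k, hk, hkl, hkn, hS', hW'⟩ hc
      have hk0 : 0 < k := by simpa [Cond.Holds, NExp.eval, hk] using hc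
      have hl0 : 0 < l := by
        rcases Nat.eq_zero_or_pos l with rfl | h
        · simp at hkl; omega
        · exact h
      refine ⟨hl0, Ends.straight (by simp [Program.IsStraight, compete]) ?_
        (by simp [Program.maxCost, NExp.cost, compete, Cond.cost, RExp.cost])⟩
      obtain ⟨w, hw, he⟩ := exec_compete X.d μ' B
      rw [hk] at hw he
      simp only [Program.exec, he, NExp.eval]
      have h1 := hS'.update (k₁ := 0) (k := k) (by omega) (Or.inl le_rfl) hkn hk0 hw
      have hpow : 2 ^ l = 2 * 2 ^ (l - 1) := by
        rw [← pow_succ']; congr 1; omega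
      refine ⟨k / 2, by simp [hk], by omega, by omega, by simpa using h1, fun k' hk' hkn' => ?_⟩
      simp only [Memory.setNat_nat_of_ne _ _ _ (show B + 16 ≠ B + 18 by simp), Memory.setNat_nat,
        Memory.setNat_real]
      by_cases e : k' = k
      · subst e; exact Or.inr (hw.update_self hk0)
      by_cases e' : k' = k / 2
      · subst e'; exact Or.inl (OnPath.refl _)
      rcases hW' k' hk' hkn' with h | h
      · exact Or.inl (h.eq_or_half.resolve_left e)
      · exact Or.inr (h.update_of_ne e e')
    · simp only [Cond.cost, NExp.cost]; omega
    · obtain ⟨hc, l, k, hk, hkl, hkn, hS', hW'⟩ := h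
      have hk0 : k = 0 := by simpa [Cond.Holds, NExp.eval, hk] using hc
      subst hk0
      refine ⟨hS', fun k' hk' hkn' => (hW' k' hk' hkn').resolve_left (not_onPath_zero hk'), ?_⟩
      rw [f.nat (by simp [Program.WritesNat, compete]),
        f.real (by simp [Program.WritesReal, compete]),
        f.real (b := B + 16) (by simp [Program.WritesReal, compete]), hr16, h17, hr17]
      exact hstep

theorem ends_sortByAngle {L : ℕ} (hn : μ.nat 0 0 = n) (hL : n ≤ 2 ^ L)
    (hv : μ.nat (B + 15) 0 = v) (hvn : v < n)
    (hφ : ∀ u < n, φ u = Real.arctan ((μ.real (B + 13) u - μ.real (B + 13) v)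
      / (μ.real (B + 14) u - μ.real (B + 14) v)))
    (hinj : ∀ a < n, a ≠ v → ∀ b < n, b ≠ v → φ a = φ b → a = b) :
    Ends τ X (sortByAngle B) μ (400 * n * (L + 1)) 0 (fun μ' =>
      (∀ u < n, μ'.real (B + 15) u = φ u) ∧
        SortedBy n v φ (μ'.nat (B + 17)) (μ'.real (B + 17))) := by
  have hφ2 : ∀ u < n, φ u < 2 := fun u hu => by
    rw [hφ u hu]
    have := Real.arctan_lt_pi_div_two ((μ.real (B + 13) u - μ.real (B + 13) v)
      / (μ.real (B + 14) u - μ.real (B + 14) v))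
    linarith [Real.pi_le_four]
  refine (ends_computeAngles hn hv hφ).seq_le (t₂ := 80 * n + 20 + (n * (80 * L + 100) + 20))
    (q₂ := 0) (fun μ₁ f₁ h₁ => ?_) ?_ (by simp)
  · obtain ⟨h15, h16, h16v, hleaf⟩ := h₁
    have hn₁ : μ₁.nat 0 0 = n := by
      rw [f₁.nat (by simp [Program.forLoop, Program.WritesNat, computeAngles]), hn]
    refine (ends_playTournament hn₁ (by omega) hleaf).seq_le (t₂ := n * (80 * L + 100) + 20)
      (q₂ := 0) (fun μ₂ f₂ h₂ => ?_) (by omega) (by simp)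
    have hn₂ : μ₂.nat 0 0 = n := by
      rw [f₂.nat (by simp [Program.WritesNat, playTournament, compete]), hn₁]
    have hr16 : μ₂.real (B + 16) = μ₁.real (B + 16) :=
      f₂.real (by simp [Program.WritesReal, playTournament, compete])
    have hr15 : μ₂.real (B + 15) = μ₁.real (B + 15) :=
      f₂.real (by simp [Program.WritesReal, playTournament, compete])
    refine (Ends.forLoop (n := n - 1) (t := 80 * L + 80) (q := 0) (fun j μ' =>
      Shape n (μ'.nat (B + 16)) 0 ∧
      (∀ k, 1 ≤ k → k < n → Wins (μ'.nat (B + 16)) (μ'.real (B + 16)) k (μ'.nat (B + 16) k)) ∧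
      Extracted n v φ j (μ'.nat (B + 17)) (μ'.real (B + 17)) (μ'.real (B + 16)))
      (by simp [extractWinner, Program.WritesNat, compete]) (fun μ' f => ?_) ?_ ?_).mono
        ?_ (by simp) fun μ' f h => ⟨?_, h.2.2.sortedBy hvn⟩
    · rw [NExp.eval, NExp.eval, NExp.eval,
        f.nat (by simp [Program.forLoop, Program.WritesNat, extractWinner, compete])]
      simp [NExp.eval, hn₂]
    · simp only [Memory.setNat_nat_of_ne _ _ _ (show B + 16 ≠ B + 10 by simp),
        Memory.setNat_nat_of_ne _ _ _ (show B + 17 ≠ B + 10 by simp), Memory.setNat_real]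
      refine ⟨h₂.1, h₂.2, ?_⟩
      rw [hr16]
      exact ⟨by simp, by simp, by simp, by simp, h16v, by simp, fun u hu huv _ => h16 u hu huv,
        by simp⟩
    · intro j hj μ' f hj' ⟨hS, hW, hE⟩
      refine (ends_extractWinner (by
        rw [f.nat (by simp [Program.forLoop, Program.WritesNat, extractWinner, compete]), hn₂])
        hL hj' (by omega) hφ2 hinj hS hW hE).mono le_rfl le_rfl fun μ'' _ h => ?_
      simpa using h
    · have : (n - 1) * (80 * L + 80 + (1 + 1 + 1 + 1) + 9) ≤ n * (80 * L + 100) :=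
        Nat.mul_le_mul (by omega) (by omega)
      simp only [NExp.cost]
      omega
    · rw [f.real (by simp [Program.forLoop, Program.WritesReal, extractWinner, compete]), hr15]
      exact h15
  · have : 1 ≤ n := by omega
    have h₂ : 400 * n * (L + 1) = 400 * (n * L) + 400 * n := by ring
    have h₃ : n * (80 * L + 100) = 80 * (n * L) + 100 * n := by ring
    omega

end SortProgram

/-! ### Geometry of lines through a vertex -/

namespace ImmersedGraph

variable {X : ImmersedGraph} {σ : Equiv.Perm (Fin X.n)}

variable (σ) in
/-- The vertex at the place `b` is a neighbor of the one at the place `a`, and lower in direction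
`e₂`. -/
def LowerAt (a b : ℕ) : Prop := AdjAt σ a b ∧ yAt σ b < yAt σ a

variable (σ) in
/-- The number of lower neighbors. -/
noncomputable def lowerDegree (a : ℕ) : ℕ := ((Finset.range X.n).filter (LowerAt σ a)).card

variable (σ) in
/-- The angle between the direction `e₂` and the line from the vertex at the place `v` to the one at
the place `u`, both projected to the plane, in the interval `(-π/2, π/2)`. -/
noncomputable def angleAt (v u : ℕ) : ℝ :=
  Real.arctan ((xAt σ u - xAt σ v) / (yAt σ u - yAt σ v))

theorem LowerAt.lt_left {a b : ℕ} (h : LowerAt σ a b) : a < X.n := h.1.1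

theorem LowerAt.lt_right {a b : ℕ} (h : LowerAt σ a b) : b < X.n := h.1.2.1

theorem LowerAt.asymm {a b : ℕ} (h : LowerAt σ a b) : ¬ LowerAt σ b a := fun h' =>
  lt_asymm h.2 h'.2

theorem GeneralPosition.yAt_ne (hX : X.GeneralPosition) {a b : ℕ} (ha : a < X.n) (hb : b < X.n)
    (hab : a ≠ b) : yAt σ a ≠ yAt σ b := by
  simp only [yAt, ha, hb, dif_pos]
  intro h
  have := σ.injective (hX.height_injective h)
  exact hab (Fin.mk.inj_iff.1 this)

/-- Equal angles would mean three collinear projections. -/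
theorem GeneralPosition.angleAt_injective (hX : X.GeneralPosition) {v : ℕ} (hv : v < X.n) :
    ∀ a < X.n, a ≠ v → ∀ b < X.n, b ≠ v → angleAt σ v a = angleAt σ v b → a = b := by
  intro a ha hav b hb hbv h
  by_contra hab
  have hc := Real.arctan_injective h
  have hya : yAt σ a - yAt σ v ≠ 0 := sub_ne_zero.2 (hX.yAt_ne ha hv hav)
  have hyb : yAt σ b - yAt σ v ≠ 0 := sub_ne_zero.2 (hX.yAt_ne hb hv hbv)
  set c := (xAt σ a - xAt σ v) / (yAt σ a - yAt σ v) with hcdef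
  have hxa : xAt σ a - xAt σ v = c * (yAt σ a - yAt σ v) := by rw [hcdef]; field_simp
  have hxb : xAt σ b - xAt σ v = c * (yAt σ b - yAt σ v) := by rw [hc]; field_simp
  have hproj : ∀ u (hu : u < X.n), X.proj (σ ⟨u, hu⟩) = !₂[xAt σ u, yAt σ u] := fun u hu => by
    simp [proj, xAt, yAt, hu]
  refine hX.not_collinear (σ ⟨a, ha⟩) (σ ⟨b, hb⟩) (σ ⟨v, hv⟩) ?_ ?_ ?_ ?_
  · simpa using hab
  · simpa using hbv
  · simpa using hav
  rw [collinear_iff_of_mem (p₀ := X.proj (σ ⟨v, hv⟩)) (by simp)]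
  refine ⟨!₂[c, 1], ?_⟩
  have key : ∀ u (hu : u < X.n), xAt σ u - xAt σ v = c * (yAt σ u - yAt σ v) →
      ∃ r : ℝ, X.proj (σ ⟨u, hu⟩) = r • !₂[c, 1] +ᵥ X.proj (σ ⟨v, hv⟩) := fun u hu h => by
    refine ⟨yAt σ u - yAt σ v, ?_⟩
    rw [hproj, hproj]
    ext i
    fin_cases i
    · simp; linarith
    · simp
  rintro p (rfl | rfl | rfl)
  · exact key a ha hxa
  · exact key b hb hxb
  · exact key v hv (by simp)

/-- The height of a vertex relative to `v` in the direction `(cos θ, - sin θ)` has the sign of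
`φ - θ` or of `θ - φ`, where `φ` is its angle at `v`, according as it lies above or below `v`. -/
theorem GeneralPosition.height_sub (hX : X.GeneralPosition) {v u : ℕ} (hv : v < X.n) (hu : u < X.n)
    (huv : u ≠ v) (θ : ℝ) :
    Real.cos θ * xAt σ u + -Real.sin θ * yAt σ u - (Real.cos θ * xAt σ v + -Real.sin θ * yAt σ v)
      = (yAt σ u - yAt σ v) * (Real.sin (angleAt σ v u - θ) / Real.cos (angleAt σ v u)) := by
  have hy : yAt σ u - yAt σ v ≠ 0 := sub_ne_zero.2 (hX.yAt_ne hu hv huv)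
  have hcos : Real.cos (angleAt σ v u) ≠ 0 := (Real.cos_arctan_pos _).ne'
  have htan : Real.sin (angleAt σ v u) / Real.cos (angleAt σ v u)
      = (xAt σ u - xAt σ v) / (yAt σ u - yAt σ v) := by
    rw [← Real.tan_eq_sin_div_cos, angleAt, Real.tan_arctan]
  rw [Real.sin_sub, sub_div, mul_div_right_comm, htan]
  field_simp
  ring

theorem GeneralPosition.height_lt_iff (hX : X.GeneralPosition) {v u : ℕ} (hv : v < X.n)
    (hu : u < X.n) (huv : u ≠ v) {θ : ℝ} (h₁ : -(Real.pi / 2) < θ) (h₂ : θ < Real.pi / 2) :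
    Real.cos θ * xAt σ u + -Real.sin θ * yAt σ u < Real.cos θ * xAt σ v + -Real.sin θ * yAt σ v ↔
      (yAt σ u < yAt σ v ∧ θ < angleAt σ v u) ∨ (yAt σ v < yAt σ u ∧ angleAt σ v u < θ) := by
  have hφ₁ := Real.neg_pi_div_two_lt_arctan ((xAt σ u - xAt σ v) / (yAt σ u - yAt σ v))
  have hφ₂ := Real.arctan_lt_pi_div_two ((xAt σ u - xAt σ v) / (yAt σ u - yAt σ v))
  have hcos : 0 < Real.cos (angleAt σ v u) := Real.cos_arctan_pos _
  rw [← sub_neg, hX.height_sub hv hu huv θ, mul_neg_iff, sub_pos, sub_neg]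
  change -(Real.pi / 2) < angleAt σ v u at hφ₁
  change angleAt σ v u < Real.pi / 2 at hφ₂
  generalize angleAt σ v u = φ at *
  have hpos : 0 < Real.sin (φ - θ) / Real.cos φ ↔ θ < φ := by
    rw [div_pos_iff_of_pos_right hcos]
    refine ⟨fun h => ?_, fun h => Real.sin_pos_of_pos_of_lt_pi (by linarith) (by linarith)⟩
    by_contra! hle
    exact absurd h (not_lt.2 (Real.sin_nonpos_of_nonpos_of_neg_pi_le (by linarith) (by linarith)))
  have hneg : Real.sin (φ - θ) / Real.cos φ < 0 ↔ φ < θ := by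
    rw [div_lt_iff₀ hcos, zero_mul]
    refine ⟨fun h => ?_, fun h => Real.sin_neg_of_neg_of_neg_pi_lt (by linarith) (by linarith)⟩
    by_contra! hle
    exact absurd h (not_lt.2 (Real.sin_nonneg_of_nonneg_of_le_pi (by linarith) (by linarith)))
  rw [hpos, hneg]
  tauto

theorem GeneralPosition.height_ne (hX : X.GeneralPosition) {v u : ℕ} (hv : v < X.n)
    (hu : u < X.n) (huv : u ≠ v) {θ : ℝ} (h₁ : -(Real.pi / 2) < θ) (h₂ : θ < Real.pi / 2)
    (hθ : angleAt σ v u ≠ θ) :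
    Real.cos θ * xAt σ u + -Real.sin θ * yAt σ u
      ≠ Real.cos θ * xAt σ v + -Real.sin θ * yAt σ v := by
  have hφ₁ := Real.neg_pi_div_two_lt_arctan ((xAt σ u - xAt σ v) / (yAt σ u - yAt σ v))
  have hφ₂ := Real.arctan_lt_pi_div_two ((xAt σ u - xAt σ v) / (yAt σ u - yAt σ v))
  have hcos : 0 < Real.cos (angleAt σ v u) := Real.cos_arctan_pos _
  rw [← sub_ne_zero, hX.height_sub hv hu huv θ]
  refine mul_ne_zero (sub_ne_zero.2 (hX.yAt_ne hu hv huv)) (div_ne_zero ?_ hcos.ne')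
  change -(Real.pi / 2) < angleAt σ v u at hφ₁
  change angleAt σ v u < Real.pi / 2 at hφ₂
  rw [Ne, Real.sin_eq_zero_iff_of_lt_of_lt (by linarith) (by linarith)]
  exact sub_ne_zero.2 hθ

/-! ### Lower neighbors in angular order -/

variable (σ) in
/-- The number of lower neighbors of `v` from the place `p` of the list `ord` on. -/
noncomputable def tailDegree (v : ℕ) (ord : ℕ → ℕ) (p : ℕ) : ℕ :=
  ((Finset.Ico p (X.n - 1)).filter fun j => LowerAt σ v (ord j)).card

variable {v : ℕ} {ord : ℕ → ℕ} {skey : ℕ → ℝ}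

theorem tailDegree_succ {p : ℕ} (hp : p < X.n - 1) :
    tailDegree σ v ord p
      = tailDegree σ v ord (p + 1) + if LowerAt σ v (ord p) then 1 else 0 := by
  rw [tailDegree, tailDegree, ← Finset.insert_Ico_add_one_left_eq_Ico hp, Finset.filter_insert]
  split_ifs with h
  · rw [Finset.card_insert_of_notMem (by simp)]
  · rfl

theorem tailDegree_last : tailDegree σ v ord (X.n - 1) = 0 := by simp [tailDegree]

theorem tailDegree_anti {p p' : ℕ} (h : p ≤ p') : tailDegree σ v ord p' ≤ tailDegree σ v ord p :=
  Finset.card_le_card (Finset.filter_subset_filter _ (Finset.Ico_subset_Ico_left h))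

end ImmersedGraph

section

variable {X : ImmersedGraph} {σ : Equiv.Perm (Fin X.n)} {v : ℕ} {ord : ℕ → ℕ} {skey : ℕ → ℝ}

open ImmersedGraph

theorem SortedBy.injOn {n : ℕ} {φ : ℕ → ℝ} (h : SortedBy n v φ ord skey) {i j : ℕ}
    (hi : i < n - 1) (hj : j < n - 1) (hij : ord i = ord j) : i = j := by
  rcases lt_trichotomy i j with hlt | rfl | hlt
  · have := h.mono i j hlt hj
    rw [h.eq i hi, h.eq j hj, hij] at this
    exact absurd this (lt_irrefl _)
  · rfl
  · have := h.mono j i hlt hi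
    rw [h.eq i hi, h.eq j hj, hij] at this
    exact absurd this (lt_irrefl _)

/-- A part of the lower neighbors that is a tail of the angular order has `tailDegree` elements. -/
theorem SortedBy.card_filter {φ : ℕ → ℝ} (h : SortedBy X.n v φ ord skey) {p : ℕ} {P : ℕ → Prop}
    (hP : ∀ j < X.n - 1, P (ord j) ↔ p ≤ j) :
    ((Finset.range X.n).filter fun u => LowerAt σ v u ∧ P u).card = tailDegree σ v ord p := by
  symm
  refine Finset.card_bij (fun j _ => ord j) ?_ ?_ ?_
  · intro j hj
    simp only [Finset.mem_filter, Finset.mem_Ico, Finset.mem_range] at hj ⊢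
    exact ⟨h.lt j hj.1.2, hj.2, (hP j hj.1.2).2 hj.1.1⟩
  · intro i hi j hj hij
    simp only [Finset.mem_filter, Finset.mem_Ico] at hi hj
    exact h.injOn hi.1.2 hj.1.2 hij
  · intro u hu
    simp only [Finset.mem_filter, Finset.mem_range] at hu
    obtain ⟨j, hj, rfl⟩ := h.surj u hu.1 hu.2.1.1.ne.symm
    exact ⟨j, by simpa [Finset.mem_filter, hj, hu.2.1] using (hP j hj).1 hu.2.2, rfl⟩

theorem SortedBy.tailDegree_zero {φ : ℕ → ℝ} (h : SortedBy X.n v φ ord skey) :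
    tailDegree σ v ord 0 = lowerDegree σ v := by
  rw [← h.card_filter (P := fun _ => True) (by simp), lowerDegree]
  simp

/-- The direction `(cos θ, - sin θ)`, with `θ` between two consecutive angles, is generic for `v`,
and the edges that it shows at `v` are those to the lower neighbors after `θ` and to the upper
neighbors before `θ`. -/
theorem SortedBy.card_probe (hX : X.GeneralPosition) (hv : v < X.n)
    (h : SortedBy X.n v (angleAt σ v) ord skey) {p : ℕ} (hp : 0 < p) (hpn : p < X.n - 1) {θ : ℝ}
    (hθ : θ = (skey (p - 1) + skey p) / 2) :
    (∀ u < X.n, u ≠ v → Real.cos θ * xAt σ u + -Real.sin θ * yAt σ u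
      ≠ Real.cos θ * xAt σ v + -Real.sin θ * yAt σ v) ∧
    ((Finset.range X.n).filter fun u => AdjAt σ v u ∧ Real.cos θ * xAt σ u + -Real.sin θ * yAt σ u
        < Real.cos θ * xAt σ v + -Real.sin θ * yAt σ v).card
      = tailDegree σ v ord p
        + ((Finset.range X.n).filter fun a => LowerAt σ a v ∧ angleAt σ v a < θ).card := by
  have hlt := h.mono (p - 1) p (by omega) hpn
  have hmono : ∀ i j, i ≤ j → j < X.n - 1 → skey i ≤ skey j := fun i j hij hj => by
    rcases hij.lt_or_eq with hij | rfl
    · exact (h.mono i j hij hj).le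
    · exact le_rfl
  have hafter : ∀ j < X.n - 1, p ≤ j → θ < skey j := fun j hj hpj => by
    have := hmono p j hpj hj; linarith
  have hbefore : ∀ j < X.n - 1, ¬ p ≤ j → skey j < θ := fun j hj hpj => by
    have := hmono j (p - 1) (by omega) (by omega); linarith
  have h₁ : -(Real.pi / 2) < θ := by
    have := Real.neg_pi_div_two_lt_arctan
      ((xAt σ (ord (p - 1)) - xAt σ v) / (yAt σ (ord (p - 1)) - yAt σ v))
    have e := h.eq (p - 1) (by omega)
    simp only [angleAt] at e
    linarith
  have h₂ : θ < Real.pi / 2 := by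
    have := Real.arctan_lt_pi_div_two
      ((xAt σ (ord p) - xAt σ v) / (yAt σ (ord p) - yAt σ v))
    have e := h.eq p hpn
    simp only [angleAt] at e
    linarith
  refine ⟨fun u hu huv => hX.height_ne hv hu huv h₁ h₂ ?_, ?_⟩
  · obtain ⟨j, hj, rfl⟩ := h.surj u hu huv
    rw [← h.eq j hj]
    by_cases hpj : p ≤ j
    · exact (hafter j hj hpj).ne'
    · exact (hbefore j hj hpj).ne
  · rw [← h.card_filter (P := fun u => θ < angleAt σ v u) (p := p), ← Finset.card_union_of_disjoint,
      ← Finset.filter_or]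
    · refine congrArg _ (Finset.filter_congr fun u hu => ?_)
      rw [Finset.mem_range] at hu
      by_cases huv : u = v
      · subst huv
        exact ⟨fun hA => (hA.1.ne rfl).elim, fun hA => hA.elim (fun hA => (hA.1.1.ne rfl).elim)
          fun hA => (hA.1.1.ne rfl).elim⟩
      · rw [hX.height_lt_iff hv hu huv h₁ h₂]
        simp only [LowerAt]
        constructor
        · rintro ⟨hA, hB | hB⟩
          · exact Or.inl ⟨⟨hA, hB.1⟩, hB.2⟩
          · exact Or.inr ⟨⟨hA.symm, hB.1⟩, hB.2⟩
        · rintro (⟨⟨hA, hB⟩, hC⟩ | ⟨⟨hA, hB⟩, hC⟩)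
          · exact ⟨hA, Or.inl ⟨hB, hC⟩⟩
          · exact ⟨hA.symm, Or.inr ⟨hB, hC⟩⟩
    · exact Finset.disjoint_filter.2 fun u _ hA hB => hA.1.asymm hB.1
    · intro j hj
      rw [← h.eq j hj]
      by_cases hpj : p ≤ j
      · simp [hpj, hafter j hj hpj]
      · simp [hpj, (hbefore j hj hpj).le]

/-! ### Lists of edges -/

/-- The pairs in the natural banks `2` and `3`, whose number is the first cell of the natural bank
`1`, are those with `S`, each listed once. -/
structure HoldsPairs (S : ℕ → ℕ → Prop) (μ : Memory) : Prop where
  inj : ∀ i < μ.nat 1 0, ∀ j < μ.nat 1 0, μ.nat 2 i = μ.nat 2 j → μ.nat 3 i = μ.nat 3 j → i = j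
  mem : ∀ i < μ.nat 1 0, S (μ.nat 2 i) (μ.nat 3 i)
  surj : ∀ a b, S a b → ∃ i < μ.nat 1 0, μ.nat 2 i = a ∧ μ.nat 3 i = b

variable {S : ℕ → ℕ → Prop} {μ μ' : Memory}

theorem HoldsPairs.congr {S' : ℕ → ℕ → Prop} (h : HoldsPairs S μ) (hS : ∀ a b, S a b ↔ S' a b)
    (h1 : μ'.nat 1 = μ.nat 1) (h2 : μ'.nat 2 = μ.nat 2) (h3 : μ'.nat 3 = μ.nat 3) :
    HoldsPairs S' μ' := by
  obtain rfl : S = S' := by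
    funext a b; exact propext (hS a b)
  exact ⟨by rw [h1, h2, h3]; exact h.inj, by rw [h1, h2, h3]; exact h.mem,
    by rw [h1, h2, h3]; exact h.surj⟩

theorem HoldsPairs.card (h : HoldsPairs S μ) {n : ℕ} (hS : ∀ a b, S a b → a < n ∧ b < n) :
    ((Finset.range n ×ˢ Finset.range n).filter fun p => S p.1 p.2).card = μ.nat 1 0 := by
  rw [← Finset.card_range (μ.nat 1 0)]
  symm
  refine Finset.card_bij (fun i _ => (μ.nat 2 i, μ.nat 3 i)) ?_ ?_ ?_
  · intro i hi
    have := h.mem i (Finset.mem_range.1 hi)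
    simp [this, hS _ _ this]
  · intro i hi j hj hij
    exact h.inj i (Finset.mem_range.1 hi) j (Finset.mem_range.1 hj) (Prod.ext_iff.1 hij).1
      (Prod.ext_iff.1 hij).2
  · rintro ⟨a, b⟩ hab
    obtain ⟨i, hi, ha, hb⟩ := h.surj a b (Finset.mem_filter.1 hab).2
    exact ⟨i, Finset.mem_range.2 hi, by rw [ha, hb]⟩

theorem HoldsPairs.card_filter (h : HoldsPairs S μ) {n : ℕ} (hS : ∀ a b, S a b → a < n) (b : ℕ)
    (P : ℕ → Prop) :
    ((Finset.range (μ.nat 1 0)).filter fun i => μ.nat 3 i = b ∧ P (μ.nat 2 i)).card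
      = ((Finset.range n).filter fun a => S a b ∧ P a).card := by
  refine Finset.card_bij (fun i _ => μ.nat 2 i) ?_ ?_ ?_
  · intro i hi
    simp only [Finset.mem_filter, Finset.mem_range] at hi ⊢
    have := h.mem i hi.1
    rw [hi.2.1] at this
    exact ⟨hS _ _ this, this, hi.2.2⟩
  · intro i hi j hj hij
    simp only [Finset.mem_filter, Finset.mem_range] at hi hj
    exact h.inj i hi.1 j hj.1 hij (hi.2.1.trans hj.2.1.symm)
  · intro a ha
    simp only [Finset.mem_filter, Finset.mem_range] at ha
    obtain ⟨i, hi, h2, h3⟩ := h.surj a b ha.2.1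
    exact ⟨i, by simp [hi, h2, h3, ha.2.2], h2⟩

theorem HoldsPairs.append {S' : ℕ → ℕ → Prop} (h : HoldsPairs S μ) {a b : ℕ}
    (hab : ¬ S a b) (hS : ∀ a' b', S' a' b' ↔ S a' b' ∨ (a' = a ∧ b' = b))
    (h1 : μ'.nat 1 0 = μ.nat 1 0 + 1)
    (h2 : μ'.nat 2 = Function.update (μ.nat 2) (μ.nat 1 0) a)
    (h3 : μ'.nat 3 = Function.update (μ.nat 3) (μ.nat 1 0) b) : HoldsPairs S' μ' := by
  have h2o : ∀ i < μ.nat 1 0, μ'.nat 2 i = μ.nat 2 i := fun i hi => by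
    rw [h2, Function.update_of_ne hi.ne]
  have h3o : ∀ i < μ.nat 1 0, μ'.nat 3 i = μ.nat 3 i := fun i hi => by
    rw [h3, Function.update_of_ne hi.ne]
  have h2n : μ'.nat 2 (μ.nat 1 0) = a := by rw [h2, Function.update_self]
  have h3n : μ'.nat 3 (μ.nat 1 0) = b := by rw [h3, Function.update_self]
  refine ⟨fun i hi j hj e2 e3 => ?_, fun i hi => ?_, fun a' b' h' => ?_⟩
  · rw [h1, Nat.lt_succ_iff_lt_or_eq] at hi hj
    rcases hi with hi | rfl <;> rcases hj with hj | rfl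
    · rw [h2o i hi, h2o j hj] at e2
      rw [h3o i hi, h3o j hj] at e3
      exact h.inj i hi j hj e2 e3
    · rw [h2o i hi, h2n] at e2
      rw [h3o i hi, h3n] at e3
      exact (hab (e2 ▸ e3 ▸ h.mem i hi)).elim
    · rw [h2o j hj, h2n] at e2
      rw [h3o j hj, h3n] at e3
      exact (hab (e2 ▸ e3 ▸ h.mem j hj)).elim
    · rfl
  · rw [h1, Nat.lt_succ_iff_lt_or_eq] at hi
    rcases hi with hi | rfl
    · rw [h2o i hi, h3o i hi]; exact (hS _ _).2 (Or.inl (h.mem i hi))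
    · rw [h2n, h3n]; exact (hS _ _).2 (Or.inr ⟨rfl, rfl⟩)
  · rcases (hS _ _).1 h' with h' | ⟨rfl, rfl⟩
    · obtain ⟨i, hi, e2, e3⟩ := h.surj a' b' h'
      exact ⟨i, by omega, by rw [h2o i hi, e2], by rw [h3o i hi, e3]⟩
    · exact ⟨μ.nat 1 0, by omega, h2n, h3n⟩

/-- Every edge has one lower endpoint. -/
theorem ImmersedGraph.GeneralPosition.card_lowerAt (hX : X.GeneralPosition) :
    ((Finset.range X.n ×ˢ Finset.range X.n).filter fun p => LowerAt σ p.1 p.2).card = X.m := by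
  refine Finset.card_bij (fun p hp =>
    have hl : LowerAt σ p.1 p.2 := (Finset.mem_filter.1 hp).2
    if σ ⟨p.1, hl.lt_left⟩ < σ ⟨p.2, hl.lt_right⟩ then (σ ⟨p.1, hl.lt_left⟩, σ ⟨p.2, hl.lt_right⟩)
      else (σ ⟨p.2, hl.lt_right⟩, σ ⟨p.1, hl.lt_left⟩)) ?_ ?_ ?_
  · rintro ⟨a, b⟩ hp
    have hl : LowerAt σ a b := (Finset.mem_filter.1 hp).2
    dsimp only
    rw [X.mem_edges]
    split_ifs with h
    · exact ⟨h, hl.1.2.2⟩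
    · exact ⟨lt_of_le_of_ne (not_lt.1 h) hl.1.2.2.ne', hl.1.2.2.symm⟩
  · rintro ⟨a, b⟩ hp ⟨a', b'⟩ hp' e
    have hl : LowerAt σ a b := (Finset.mem_filter.1 hp).2
    have hl' : LowerAt σ a' b' := (Finset.mem_filter.1 hp').2
    dsimp only at e
    have : (a = a' ∧ b = b') ∨ (a = b' ∧ b = a') := by
      split_ifs at e <;> simp [Fin.ext_iff] at e <;> tauto
    rcases this with ⟨rfl, rfl⟩ | ⟨rfl, rfl⟩
    · rfl
    · exact (hl.asymm hl').elim
  · rintro ⟨i, j⟩ he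
    rw [X.mem_edges] at he
    have hij : i ≠ j := he.2.ne
    have hA : AdjAt σ (σ.symm i) (σ.symm j) :=
      ⟨(σ.symm i).2, (σ.symm j).2, by simpa using he.2⟩
    have hy := hX.yAt_ne (σ := σ) (σ.symm i).2 (σ.symm j).2 hA.ne
    rcases lt_or_gt_of_ne hy with hy | hy
    · refine ⟨(σ.symm j, σ.symm i), Finset.mem_filter.2 ⟨by simp, hA.symm, hy⟩, ?_⟩
      simp [he.1.not_gt]
    · refine ⟨(σ.symm i, σ.symm j), Finset.mem_filter.2 ⟨by simp, hA, hy⟩, ?_⟩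
      simp [he.1]

/-- A list of all pairs of a vertex and a lower neighbor is a list of the edges. -/
theorem HoldsPairs.holdsEdges (hX : X.GeneralPosition) (h : HoldsPairs (LowerAt σ) μ) :
    HoldsEdges X σ μ := by
  have hm : μ.nat 1 0 = X.m :=
    (h.card fun a b hab => ⟨hab.lt_left, hab.lt_right⟩).symm.trans hX.card_lowerAt
  have hk : ∀ k : Fin X.m, LowerAt σ (μ.nat 2 k) (μ.nat 3 k) := fun k =>
    h.mem k (k.2.trans_eq hm.symm)
  refine ⟨hm, fun k => ⟨μ.nat 2 k, (hk k).lt_left⟩, fun k => ⟨μ.nat 3 k, (hk k).lt_right⟩,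
    fun k => ⟨rfl, rfl⟩, ?_, ?_⟩
  · intro k k' e
    rw [Sym2.eq_iff] at e
    simp only [EmbeddingLike.apply_eq_iff_eq, Fin.mk.injEq] at e
    rcases e with ⟨e2, e3⟩ | ⟨e2, e3⟩
    · exact Fin.ext (h.inj k (k.2.trans_eq hm.symm) k' (k'.2.trans_eq hm.symm) e2 e3)
    · have := hk k
      rw [e2, e3] at this
      exact (this.asymm (hk k')).elim
  · ext e
    constructor
    · rintro ⟨k, rfl⟩
      exact (hk k).1.2.2
    · induction e with
      | h i j =>
        intro hij
        rw [SimpleGraph.mem_edgeSet] at hij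
        have hA : AdjAt σ (σ.symm i) (σ.symm j) :=
          ⟨(σ.symm i).2, (σ.symm j).2, by simpa using hij⟩
        have hy := hX.yAt_ne (σ := σ) (σ.symm i).2 (σ.symm j).2 hA.ne
        rcases lt_or_gt_of_ne hy with hy | hy
        · obtain ⟨k, hk, e2, e3⟩ := h.surj _ _ ⟨hA.symm, hy⟩
          refine ⟨⟨k, hm ▸ hk⟩, ?_⟩
          simp [e2, e3, Sym2.eq_swap]
        · obtain ⟨k, hk, e2, e3⟩ := h.surj _ _ ⟨hA, hy⟩
          refine ⟨⟨k, hm ▸ hk⟩, ?_⟩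
          simp [e2, e3]

end

/-! ### Bisection for an edge -/

section Search

open ImmersedGraph

variable {τ : ImmersedGraph → ℕ} {X : ImmersedGraph} {σ : Equiv.Perm (Fin X.n)} {μ μ' : Memory}
  {B v r : ℕ} {S : ℕ → ℕ → Prop}

theorem card_le_oracleTime (τ : ImmersedGraph → ℕ) (X : ImmersedGraph) :
    X.n + X.m + 1 ≤ oracleTime τ X := by
  unfold oracleTime; omega

/-- The memory holds the number of vertices and, in the real banks `B + 13` and `B + 14`, their
first two coordinates in the order `σ`. The bank `B + 12` is ready for directions in the plane of
`e₁` and `e₂`. -/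
structure Loaded (σ : Equiv.Perm (Fin X.n)) (B : ℕ) (μ : Memory) : Prop where
  n : μ.nat 0 0 = X.n
  x : ∀ u < X.n, μ.real (B + 13) u = xAt σ u
  y : ∀ u < X.n, μ.real (B + 14) u = yAt σ u
  dir : ∀ j, 2 ≤ j → μ.real (B + 12) j = 0

theorem Loaded.congr (h : Loaded σ B μ) (h0 : μ'.nat 0 = μ.nat 0)
    (h13 : μ'.real (B + 13) = μ.real (B + 13)) (h14 : μ'.real (B + 14) = μ.real (B + 14))
    (h12 : ∀ j, 2 ≤ j → μ'.real (B + 12) j = 0) : Loaded σ B μ' :=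
  ⟨h0 ▸ h.n, h13 ▸ h.x, h14 ▸ h.y, h12⟩

/-- Choose the middle `p` (bank `B + 23`) between the bounds in the banks `B + 21` and `B + 22`, and
the direction `(cos θ, - sin θ)` with the angle `θ` between the angles at the places `p - 1` and `p`
of the angular order at `v`. The height of `v` goes into the bank `B + 18`. -/
def aim (B : ℕ) : Program :=
  .seq (.setNat (B + 23) (.const 0) (.half (.add (.var (B + 21)) (.var (B + 22)))))
    (.seq (.setReal (B + 19) (.const 0)
      (.div (.add (.read (B + 17) (.sub (.var (B + 23)) (.const 1)))
        (.read (B + 17) (.var (B + 23)))) (.ofNat (.const 2))))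
    (.seq (.setReal (B + 12) (.const 0) (.cos (.var (B + 19))))
    (.seq (.setReal (B + 12) (.const 1) (.sub (.ofNat (.const 0)) (.sin (.var (B + 19)))))
      (.setReal (B + 18) (.const 0)
        (.add (.mul (.read (B + 12) (.const 0)) (.read (B + 13) (.var (B + 15))))
          (.mul (.read (B + 12) (.const 1)) (.read (B + 14) (.var (B + 15)))))))))

/-- Query the direction chosen by `aim`, compare the number of edges that it shows at `v` with `r`
(bank `B + 20`) plus the number of known edges from upper neighbors that it shows, and halve the
interval between the bounds. -/
def probe (B : ℕ) : Program :=
  .seq (aim B) (.seq (.query (B + 12) (B + 4)) (.seq (countEdges B)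
    (.seq (.setNat (B + 24) (.const 0) (.var (B + 20)))
    (.seq (.countLoop (B + 10) (B + 24) (.var 1)
      (.and (.natEq (.read 3 (.var (B + 10))) (.var (B + 15)))
        (.realLt (.read (B + 15) (.read 2 (.var (B + 10)))) (.var (B + 19)))))
      (.ite (.natLt (.var (B + 24)) (.var (B + 11)))
        (.setNat (B + 21) (.const 0) (.var (B + 23)))
        (.setNat (B + 22) (.const 0) (.var (B + 23))))))))

/-- Find the lower neighbor of `v` after which there are `r` lower neighbors in the angular order,
by bisection, and append the edge to it to the list of known edges. -/
def findEdge (B : ℕ) : Program :=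
  .seq (.seq (.setNat (B + 21) (.const 0) (.const 0))
      (.setNat (B + 22) (.const 0) (.sub (.var 0) (.const 1))))
    (.seq (.while (.natLt (.add (.var (B + 21)) (.const 1)) (.var (B + 22))) (probe B))
      (.seq (.setNat 2 (.var 1) (.var (B + 15)))
        (.seq (.setNat 3 (.var 1) (.read (B + 17) (.var (B + 21))))
          (.setNat 1 (.const 0) (.add (.var 1) (.const 1))))))

theorem ends_aim {p : ℕ} (hL : Loaded σ B μ) (hv : μ.nat (B + 15) 0 = v) (hvn : v < X.n)
    (hp : (μ.nat (B + 21) 0 + μ.nat (B + 22) 0) / 2 = p) :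
    Ends τ X (aim B) μ 80 0 (fun μ' => ∃ θ,
      θ = (μ.real (B + 17) (p - 1) + μ.real (B + 17) p) / 2 ∧
      μ'.nat (B + 23) 0 = p ∧ μ'.real (B + 19) 0 = θ ∧ μ'.real (B + 12) 0 = Real.cos θ ∧
      μ'.real (B + 12) 1 = -Real.sin θ ∧ (∀ j, 2 ≤ j → μ'.real (B + 12) j = 0) ∧
      μ'.real (B + 18) 0 = Real.cos θ * xAt σ v + -Real.sin θ * yAt σ v) := by
  refine Ends.straight (by simp [Program.IsStraight, aim]) ⟨_, rfl, ?_⟩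
    (by simp [Program.maxCost, aim, NExp.cost, RExp.cost])
  simp only [aim, Program.exec, NExp.eval, RExp.eval]
  refine ⟨by simp [hp], by simp [hp], by simp [hp], by simp [hp], fun j hj => ?_, ?_⟩
  · simp [hL.dir j hj, show j ≠ 0 by omega, show j ≠ 1 by omega]
  · simp [hp, hv, hL.x v hvn, hL.y v hvn]

/-- The comparison of `probe` decides whether more than `r` lower neighbors follow the chosen angle,
because the known edges include all edges from upper neighbors. -/
theorem ends_probe (hX : X.GeneralPosition) (hL : Loaded σ B μ) (hv : μ.nat (B + 15) 0 = v)
    (hvn : v < X.n) (hr : μ.nat (B + 20) 0 = r)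
    (hφ : ∀ u < X.n, μ.real (B + 15) u = angleAt σ v u)
    (hs : SortedBy X.n v (angleAt σ v) (μ.nat (B + 17)) (μ.real (B + 17)))
    (hS : ∀ a b, S a b → LowerAt σ a b) (hSv : ∀ a, LowerAt σ a v → S a v)
    (hlist : HoldsPairs S μ) {p : ℕ} (hp : (μ.nat (B + 21) 0 + μ.nat (B + 22) 0) / 2 = p)
    (hp0 : 0 < p) (hpn : p < X.n - 1) :
    Ends τ X (probe B) μ (300 * oracleTime τ X) 1 (fun μ' =>
      (∀ j, 2 ≤ j → μ'.real (B + 12) j = 0) ∧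
      if r < tailDegree σ v (μ.nat (B + 17)) p
        then μ'.nat (B + 21) 0 = p ∧ μ'.nat (B + 22) 0 = μ.nat (B + 22) 0
        else μ'.nat (B + 21) 0 = μ.nat (B + 21) 0 ∧ μ'.nat (B + 22) 0 = p) := by
  have hPi := card_le_oracleTime τ X
  have hm : μ.nat 1 0 ≤ X.m := by
    rw [← hlist.card fun a b hab => ⟨(hS a b hab).lt_left, (hS a b hab).lt_right⟩,
      ← hX.card_lowerAt (σ := σ)]
    exact Finset.card_le_card fun q hq => by
      rw [Finset.mem_filter] at hq ⊢
      exact ⟨hq.1, hS _ _ hq.2⟩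
  refine (ends_aim hL hv hvn hp).seq_le (t₂ := oracleTime τ X + (100 * (X.n + X.m + 1) +
    (10 + (60 * X.m + 20 + 20)))) (q₂ := 1 + 0) (fun μ₁ f₁ h₁ => ?_) (by omega) (by simp)
  obtain ⟨θ, hθ, h23, h19, hc0, hc1, hd, h18⟩ := h₁
  refine Ends.seq_le (R := HoldsAnswer (B + 4) (X.dgm0 (μ₁.vector X.d (B + 12)))
    (X.dgm1 (μ₁.vector X.d (B + 12)))) (Ends.query hd (by rw [hc0, hc1]; simp))
    (t₂ := 100 * (X.n + X.m + 1) + (10 + (60 * X.m + 20 + 20))) (q₂ := 0) (fun μ₂ f₂ h₂ => ?_)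
    (by omega) (by simp)
  refine (ends_countEdges h₂).seq_le (t₂ := 10 + (60 * X.m + 20 + 20)) (q₂ := 0)
    (fun μ₃ f₃ h₃ => ?_) (by omega) (by simp)
  have h18₂ : μ₂.real (B + 18) = μ₁.real (B + 18) := f₂.real (by simp [Program.WritesReal])
  obtain ⟨hne, hcard⟩ := hs.card_probe hX hvn hp0 hpn hθ
  rw [h18₂, h18, ← hc0, ← hc1, card_edges_vector hd hvn (by rw [hc0, hc1]; exact hne), hc0, hc1,
    hcard] at h₃
  have hr₃ : μ₃.nat (B + 20) 0 = r := by
    rw [f₃.nat (by simp [countEdges, Program.countLoop, Program.forLoop, Program.WritesNat]),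
      f₂.nat (by simp [Program.WritesNat]), f₁.nat (by simp [aim, Program.WritesNat]), hr]
  refine Ends.seq_le (R := fun μ' => μ'.nat (B + 24) 0 = r) (t₁ := 10) (q₁ := 0)
    (Ends.straight (by simp [Program.IsStraight]) (by simp [Program.exec, NExp.eval, hr₃])
      (by simp [Program.maxCost, NExp.cost])) (t₂ := 60 * X.m + 20 + 20) (q₂ := 0)
    (fun μ₄ f₄ h₄ => ?_) (by omega) (by simp)
  have n₄ : ∀ b, b ≠ B + 23 → ¬ (B + 4 ≤ b ∧ b ≤ B + 4 + 4) → b ≠ B + 10 → b ≠ B + 11 →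
      b ≠ B + 24 → μ₄.nat b = μ.nat b := fun b _ hb _ _ _ => by
    rw [f₄.nat (by simpa [Program.WritesNat]), f₃.nat (by
      simp [countEdges, Program.countLoop, Program.forLoop, Program.WritesNat, *]),
      f₂.nat hb, f₁.nat (by simpa [aim, Program.WritesNat])]
  have h15₄ : μ₄.real (B + 15) = μ.real (B + 15) := by
    rw [f₄.real (by simp [Program.WritesReal]), f₃.real (by
      simp [countEdges, Program.countLoop, Program.forLoop, Program.WritesReal]),
      f₂.real (by simp [Program.WritesReal]), f₁.real (by simp [aim, Program.WritesReal])]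
  have h19₄ : μ₄.real (B + 19) 0 = θ := by
    rw [f₄.real (by simp [Program.WritesReal]), f₃.real (by
      simp [countEdges, Program.countLoop, Program.forLoop, Program.WritesReal]),
      f₂.real (by simp [Program.WritesReal]), h19]
  have h12₄ : μ₄.real (B + 12) = μ₁.real (B + 12) := by
    rw [f₄.real (by simp [Program.WritesReal]), f₃.real (by
      simp [countEdges, Program.countLoop, Program.forLoop, Program.WritesReal]),
      f₂.real (by simp [Program.WritesReal])]
  have h23₄ : μ₄.nat (B + 23) 0 = p := by
    rw [f₄.nat (by simp [Program.WritesNat]), f₃.nat (by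
      simp [countEdges, Program.countLoop, Program.forLoop, Program.WritesNat]),
      f₂.nat (by simp [Program.WritesNat]), h23]
  have h11₄ : μ₄.nat (B + 11) 0 = μ₃.nat (B + 11) 0 := by
    rw [f₄.nat (by simp [Program.WritesNat])]
  refine (Ends.countLoop (n := μ.nat 1 0) (j := B + 10) (acc := B + 24)
    (fun i => μ.nat 3 i = v ∧ μ.real (B + 15) (μ.nat 2 i) < θ) (by simp) (fun μ' f => ?_)
    (fun k hk μ' f hk' => ?_)).seq_le (t₂ := 20) (q₂ := 0) (fun μ₅ f₅ h₅ => ?_) ?_ (by simp)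
  · simp only [Program.countLoop, Program.forLoop] at f
    rw [NExp.eval, f.nat (by simp [Program.WritesNat]), n₄ 1 (by omega) (by omega) (by omega)
      (by omega) (by omega)]
    rfl
  · simp only [Program.countLoop, Program.forLoop] at f
    simp only [Cond.Holds, NExp.eval, RExp.eval, hk']
    rw [f.nat (b := 3) (by simp [Program.WritesNat]), f.nat (b := 2) (by simp [Program.WritesNat]),
      f.nat (b := B + 15) (by simp [Program.WritesNat]), f.real (by simp [Program.WritesReal]),
      f.real (by simp [Program.WritesReal]), h15₄, h19₄]
    iterate 3 rw [n₄ _ (by omega) (by omega) (by omega) (by omega) (by omega)]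
    rw [hv]
  · have hcount : ((Finset.range (μ.nat 1 0)).filter
        fun i => μ.nat 3 i = v ∧ μ.real (B + 15) (μ.nat 2 i) < θ).card
        = ((Finset.range X.n).filter fun a => LowerAt σ a v ∧ angleAt σ v a < θ).card := by
      rw [hlist.card_filter (n := X.n) (fun a b hab => (hS a b hab).lt_left) v
        (fun a => μ.real (B + 15) a < θ)]
      refine congrArg _ (Finset.filter_congr fun a ha => ?_)
      rw [hφ a (Finset.mem_range.1 ha)]
      exact and_congr_left fun _ => ⟨hS a v, hSv a⟩
    replace h₅ : μ₅.nat (B + 24) 0 = r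
        + ((Finset.range X.n).filter fun a => LowerAt σ a v ∧ angleAt σ v a < θ).card := by
      rw [h₅, h₄, ← hcount]
      congr!
    have h11₅ : μ₅.nat (B + 11) 0 = tailDegree σ v (μ.nat (B + 17)) p
        + ((Finset.range X.n).filter fun a => LowerAt σ a v ∧ angleAt σ v a < θ).card := by
      rw [f₅.nat (by simp [Program.countLoop, Program.forLoop, Program.WritesNat]), h11₄, h₃]
    have h23₅ : μ₅.nat (B + 23) 0 = p := by
      rw [f₅.nat (by simp [Program.countLoop, Program.forLoop, Program.WritesNat]), h23₄]
    have h21₅ : μ₅.nat (B + 21) = μ.nat (B + 21) := by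
      rw [f₅.nat (by simp [Program.countLoop, Program.forLoop, Program.WritesNat]),
        n₄ _ (by omega) (by omega) (by omega) (by omega) (by omega)]
    have h22₅ : μ₅.nat (B + 22) = μ.nat (B + 22) := by
      rw [f₅.nat (by simp [Program.countLoop, Program.forLoop, Program.WritesNat]),
        n₄ _ (by omega) (by omega) (by omega) (by omega) (by omega)]
    have hd₅ : ∀ j, 2 ≤ j → μ₅.real (B + 12) j = 0 := fun j hj => by
      rw [f₅.real (by simp [Program.countLoop, Program.forLoop, Program.WritesReal]), h12₄, hd j hj]
    refine Ends.straight (by simp [Program.IsStraight]) ?_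
      (by simp [Program.maxCost, NExp.cost, Cond.cost])
    simp only [Program.exec, Cond.Holds, NExp.eval, h₅, h11₅, Nat.add_lt_add_iff_right, h23₅]
    split_ifs with h
    · exact ⟨by simpa using hd₅, by simp, by simp [h22₅]⟩
    · exact ⟨by simpa using hd₅, by simp [h21₅], by simp⟩
  · simp only [Cond.cost, NExp.cost, RExp.cost]
    omega

end Search

section Sweep

open ImmersedGraph

variable {τ : ImmersedGraph → ℕ} {X : ImmersedGraph} {σ : Equiv.Perm (Fin X.n)} {μ μ' : Memory}
  {B v r L : ℕ} {D : ℕ → Prop}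

theorem probe_writesNat {b : ℕ} (h : (probe B).WritesNat b) :
    B + 4 ≤ b ∧ b ≠ B + 15 ∧ b ≠ B + 17 ∧ b ≠ B + 20 ∧ b ≠ B + 9 ∧ b ≠ B + 13 ∧ b ≠ B + 14 := by
  simp only [probe, aim, countEdges, Program.countLoop, Program.forLoop, Program.WritesNat,
    or_false] at h
  omega

theorem probe_writesReal {b : ℕ} (h : (probe B).WritesReal b) :
    b ≠ B + 13 ∧ b ≠ B + 14 ∧ b ≠ B + 15 ∧ b ≠ B + 17 ∧ B + 4 ≤ b := by
  simp only [probe, aim, countEdges, Program.countLoop, Program.forLoop, Program.WritesReal,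
    or_false, false_or] at h
  omega

theorem findEdge_writesNat {b : ℕ} (h : (findEdge B).WritesNat b) :
    b ≠ 0 ∧ b ≠ B + 15 ∧ b ≠ B + 17 ∧ b ≠ B + 20 ∧ b ≠ B + 9 ∧ b ≠ B + 13 ∧ b ≠ B + 14 := by
  simp only [findEdge, Program.WritesNat] at h
  rcases h with h | h | h
  · omega
  · have := probe_writesNat h
    omega
  · omega

theorem findEdge_writesReal {b : ℕ} (h : (findEdge B).WritesReal b) :
    b ≠ B + 13 ∧ b ≠ B + 14 ∧ b ≠ B + 15 ∧ b ≠ B + 17 ∧ B + 4 ≤ b := by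
  simp only [findEdge, Program.WritesReal, or_false, false_or] at h
  exact probe_writesReal h

/-- The pairs of a vertex and a lower neighbor that are known after all lower neighbors of the
vertices with `D` and the last `r` lower neighbors of `v` in the angular order have been found. -/
def Known (σ : Equiv.Perm (Fin X.n)) (D : ℕ → Prop) (v : ℕ) (ord : ℕ → ℕ) (r a b : ℕ) : Prop :=
  LowerAt σ a b ∧
    (D a ∨ (a = v ∧ ∃ j < X.n - 1, ord j = b ∧ tailDegree σ v ord (j + 1) < r))

/-- Bisection keeps more than `r` lower neighbors from the place `lo` on and at most `r` from `hi`
on. If `hi = lo + 1`, then the vertex at the place `lo` is a lower neighbor. -/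
theorem ends_findEdge (hX : X.GeneralPosition) (hn : X.n ≤ 2 ^ L) (hL : Loaded σ B μ)
    (hv : μ.nat (B + 15) 0 = v) (hvn : v < X.n) (hr : μ.nat (B + 20) 0 = r)
    (hφ : ∀ u < X.n, μ.real (B + 15) u = angleAt σ v u)
    (hs : SortedBy X.n v (angleAt σ v) (μ.nat (B + 17)) (μ.real (B + 17)))
    (hDv : ¬ D v) (hup : ∀ a, LowerAt σ a v → D a) (hrd : r < lowerDegree σ v)
    (hlist : HoldsPairs (Known σ D v (μ.nat (B + 17)) r) μ) :
    Ends τ X (findEdge B) μ (L * (300 * oracleTime τ X + 10) + 60) L (fun μ' =>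
      (∀ j, 2 ≤ j → μ'.real (B + 12) j = 0) ∧
      HoldsPairs (Known σ D v (μ.nat (B + 17)) (r + 1)) μ') := by
  have hrd' : r < tailDegree σ v (μ.nat (B + 17)) 0 := hs.tailDegree_zero ▸ hrd
  set g := tailDegree σ v (μ.nat (B + 17)) with hg
  have hn1 : 0 < X.n - 1 := by
    rcases Nat.eq_zero_or_pos (X.n - 1) with h | h
    · have h' : g (X.n - 1) = 0 := tailDegree_last
      rw [h] at h'
      omega
    · exact h
  refine Ends.seq_le (t₁ := 20) (q₁ := 0) (R := fun μ' =>
      μ'.nat (B + 21) 0 = 0 ∧ μ'.nat (B + 22) 0 = X.n - 1)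
    (Ends.straight (by simp [Program.IsStraight]) (by simp [Program.exec, NExp.eval, hL.n])
      (by simp [Program.maxCost, NExp.cost]))
    (t₂ := L * (300 * oracleTime τ X + 10) + 40) (q₂ := L + 0) (fun μ₁ f₁ h₁ => ?_)
    (by omega) (by simp)
  have h17₁ : μ₁.nat (B + 17) = μ.nat (B + 17) := f₁.nat (by simp [Program.WritesNat])
  have hr₁ : μ₁.real = μ.real := by
    funext b; exact f₁.real (by simp [Program.WritesReal])
  refine Ends.seq_le (R := fun μ' => ∃ lo, μ'.nat (B + 21) 0 = lo ∧ lo < X.n - 1 ∧ r < g lo ∧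
      g (lo + 1) ≤ r ∧ ∀ j, 2 ≤ j → μ'.real (B + 12) j = 0)
    (t₁ := L * (300 * oracleTime τ X + 10) + 10) (q₁ := L)
    ((Ends.while (l := L) (t := 300 * oracleTime τ X) (q := 1) (fun l μ' => ∃ lo hi,
      μ'.nat (B + 21) 0 = lo ∧ μ'.nat (B + 22) 0 = hi ∧ lo < hi ∧ hi ≤ X.n - 1 ∧
      hi - lo ≤ 2 ^ l ∧ r < g lo ∧ g hi ≤ r ∧ ∀ j, 2 ≤ j → μ'.real (B + 12) j = 0)
      ⟨0, X.n - 1, h₁.1, h₁.2, hn1, le_rfl, by omega, hrd', by rw [hg, tailDegree_last]; omega,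
        hr₁ ▸ hL.dir⟩ ?_).mono ?_ (by simp) fun μ' f h => ?_)
    (t₂ := 30) (q₂ := 0) (fun μ₂ f₂ h₂ => ?_) (by omega) (by simp)
  · rintro l μ' f ⟨lo, hi, hlo, hhi, hlt, hle, hpow, hglo, hghi, hd⟩ hc
    have hc' : lo + 1 < hi := by simpa [Cond.Holds, NExp.eval, hlo, hhi] using hc
    have hl0 : 0 < l := by
      rcases Nat.eq_zero_or_pos l with rfl | h
      · simp at hpow; omega
      · exact h
    have hpow' : 2 ^ l = 2 * 2 ^ (l - 1) := by
      rw [← pow_succ']; congr 1; omega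
    have fn : ∀ b, ¬ (probe B).WritesNat b → b ≠ B + 21 → b ≠ B + 22 → μ'.nat b = μ.nat b :=
      fun b hb h1 h2 => by rw [f.nat hb, f₁.nat (by simp [Program.WritesNat, h1, h2])]
    have fr : ∀ b, ¬ (probe B).WritesReal b → μ'.real b = μ.real b :=
      fun b hb => by rw [f.real hb, hr₁]
    have h17 : μ'.nat (B + 17) = μ.nat (B + 17) :=
      fn _ (fun h => by have := probe_writesNat h; omega) (by omega) (by omega)
    have hr17 : μ'.real (B + 17) = μ.real (B + 17) :=
      fr _ (fun h => by have := probe_writesReal h; omega)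
    refine ⟨hl0, (ends_probe (τ := τ) (p := (lo + hi) / 2) (r := r) (v := v) hX (hL.congr
      (fn _ (fun h => by have := probe_writesNat h; omega) (by omega) (by omega))
      (fr _ (fun h => by have := probe_writesReal h; omega))
      (fr _ (fun h => by have := probe_writesReal h; omega)) hd) ?_ hvn ?_ ?_ ?_
      (S := Known σ D v (μ.nat (B + 17)) r) (fun a b h => h.1) (fun a h => ⟨h, Or.inl (hup a h)⟩)
      (hlist.congr (fun _ _ => Iff.rfl)
        (fn _ (fun h => by have := probe_writesNat h; omega) (by omega) (by omega))
        (fn _ (fun h => by have := probe_writesNat h; omega) (by omega) (by omega))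
        (fn _ (fun h => by have := probe_writesNat h; omega) (by omega) (by omega)))
      (by rw [hlo, hhi]) (by omega) (by omega)).mono le_rfl le_rfl fun μ'' _ h => ?_⟩
    · rw [fn _ (fun h => by have := probe_writesNat h; omega) (by omega) (by omega), hv]
    · rw [fn _ (fun h => by have := probe_writesNat h; omega) (by omega) (by omega), hr]
    · rw [fr _ (fun h => by have := probe_writesReal h; omega)]; exact hφ
    · rw [h17, hr17]; exact hs
    · rw [h17, ← hg] at h
      obtain ⟨hd', h⟩ := h
      split_ifs at h with hcmp
      · exact ⟨(lo + hi) / 2, hi, h.1, by rw [h.2, hhi], by omega, hle, by omega, hcmp, hghi, hd'⟩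
      · exact ⟨lo, (lo + hi) / 2, by rw [h.1, hlo], h.2, by omega, by omega, by omega, hglo,
          by omega, hd'⟩
  · simp only [Cond.cost, NExp.cost]
    have : L * (1 + 1 + 1 + 1 + (1 + 1) + 1 + 300 * oracleTime τ X)
        ≤ L * (300 * oracleTime τ X + 10) := Nat.mul_le_mul_left _ (by omega)
    omega
  · obtain ⟨hc, l, lo, hi, hlo, hhi, hlt, hle, hpow, hglo, hghi, hd⟩ := h
    have hc' : ¬ lo + 1 < hi := by simpa [Cond.Holds, NExp.eval, hlo, hhi] using hc
    obtain rfl : hi = lo + 1 := by omega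
    exact ⟨lo, hlo, by omega, hglo, hghi, hd⟩
  · obtain ⟨lo, hlo, hlon, hglo, hghi, hd⟩ := h₂
    have fn : ∀ b, ¬ (probe B).WritesNat b → b ≠ B + 21 → b ≠ B + 22 → μ₂.nat b = μ.nat b :=
      fun b hb h1 h2 => by rw [f₂.nat hb, f₁.nat (by simp [Program.WritesNat, h1, h2])]
    have n₁ : μ₂.nat 1 = μ.nat 1 :=
      fn _ (fun h => by have := probe_writesNat h; omega) (by omega) (by omega)
    have n₂ : μ₂.nat 2 = μ.nat 2 :=
      fn _ (fun h => by have := probe_writesNat h; omega) (by omega) (by omega)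
    have n₃ : μ₂.nat 3 = μ.nat 3 :=
      fn _ (fun h => by have := probe_writesNat h; omega) (by omega) (by omega)
    have n₁₅ : μ₂.nat (B + 15) = μ.nat (B + 15) :=
      fn _ (fun h => by have := probe_writesNat h; omega) (by omega) (by omega)
    have n₁₇ : μ₂.nat (B + 17) = μ.nat (B + 17) :=
      fn _ (fun h => by have := probe_writesNat h; omega) (by omega) (by omega)
    have hstep := tailDegree_succ (σ := σ) (v := v) (ord := μ.nat (B + 17)) hlon
    rw [← hg] at hstep
    have hlow : LowerAt σ v (μ.nat (B + 17) lo) := by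
      by_contra hcon
      rw [if_neg hcon] at hstep
      omega
    rw [if_pos hlow] at hstep
    refine Ends.straight (by simp [Program.IsStraight]) ⟨by simpa [Program.exec] using hd, ?_⟩
      (by simp [Program.maxCost, NExp.cost])
    refine hlist.append (a := v) (b := μ.nat (B + 17) lo) ?_ (fun a b => ?_) ?_ ?_ ?_
    · rintro ⟨-, h | ⟨-, j, hj, hjo, hgj⟩⟩
      · exact hDv h
      · rw [hs.injOn hj hlon hjo] at hgj
        change g (lo + 1) < r at hgj
        omega
    · constructor
      · rintro ⟨hab, h | ⟨rfl, j, hj, rfl, hgj⟩⟩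
        · exact Or.inl ⟨hab, Or.inl h⟩
        · rcases Nat.lt_succ_iff_lt_or_eq.1 hgj with hgj | hgj
          · exact Or.inl ⟨hab, Or.inr ⟨rfl, j, hj, rfl, hgj⟩⟩
          · right
            -- both `j` and `lo` are lower neighbors with exactly `r` lower neighbors behind them
            refine ⟨rfl, ?_⟩
            have hstep' := tailDegree_succ (σ := σ) (v := a) (ord := μ.nat (B + 17)) hj
            rw [← hg, if_pos hab] at hstep'
            rcases lt_trichotomy j lo with hlt | rfl | hlt
            · have : g lo ≤ g (j + 1) := tailDegree_anti hlt
              rw [← hg] at hgj; omega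
            · rfl
            · have : g j ≤ g (lo + 1) := tailDegree_anti hlt
              rw [← hg] at hgj; omega
      · rintro (⟨hab, h | ⟨rfl, j, hj, rfl, hgj⟩⟩ | ⟨rfl, rfl⟩)
        · exact ⟨hab, Or.inl h⟩
        · exact ⟨hab, Or.inr ⟨rfl, j, hj, rfl, by omega⟩⟩
        · exact ⟨hlow, Or.inr ⟨rfl, lo, hlon, rfl, Nat.lt_succ_of_le hghi⟩⟩
    · simp [Program.exec, NExp.eval, n₁]
    · simp [Program.exec, NExp.eval, n₁, n₂, n₁₅, hv]
    · simp [Program.exec, NExp.eval, n₁, n₃, n₁₇, hlo]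

/-! ### All lower neighbors of a vertex -/

/-- Find the edges from the vertex `v` (bank `B + 15`) to its lower neighbors, the number of which
is the `v`-th cell of the natural bank `B + 13`. -/
def findEdges (B : ℕ) : Program :=
  .seq (sortByAngle B) (.forLoop (B + 20) (.read (B + 13) (.var (B + 15))) (findEdge B))

theorem sortByAngle_writesNat {b : ℕ} (h : (sortByAngle B).WritesNat b) :
    b = B + 10 ∨ B + 16 ≤ b ∧ b ≤ B + 19 := by
  simp only [sortByAngle, computeAngles, playTournament, extractWinner, compete, Program.forLoop,
    Program.WritesNat, or_false, false_or] at h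
  omega

theorem sortByAngle_writesReal {b : ℕ} (h : (sortByAngle B).WritesReal b) :
    B + 15 ≤ b ∧ b ≤ B + 17 := by
  simp only [sortByAngle, computeAngles, playTournament, extractWinner, compete, Program.forLoop,
    Program.WritesReal, or_false, false_or] at h
  omega

theorem findEdges_writesNat {b : ℕ} (h : (findEdges B).WritesNat b) :
    b ≠ 0 ∧ b ≠ B + 9 ∧ b ≠ B + 13 ∧ b ≠ B + 14 ∧ b ≠ B + 15 := by
  simp only [findEdges, Program.forLoop, Program.WritesNat] at h
  rcases h with h | h | h | h
  · have := sortByAngle_writesNat h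
    omega
  · omega
  · have := findEdge_writesNat h
    omega
  · omega

theorem findEdges_writesReal {b : ℕ} (h : (findEdges B).WritesReal b) :
    b ≠ B + 13 ∧ b ≠ B + 14 ∧ B + 4 ≤ b := by
  simp only [findEdges, Program.forLoop, Program.WritesReal, or_false, false_or] at h
  rcases h with h | h
  · have := sortByAngle_writesReal h
    omega
  · have := findEdge_writesReal h
    omega

theorem ends_findEdges (hX : X.GeneralPosition) (hn : X.n ≤ 2 ^ L) (hL : Loaded σ B μ)
    (hv : μ.nat (B + 15) 0 = v) (hvn : v < X.n) (hdeg : μ.nat (B + 13) v = lowerDegree σ v)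
    (hpos : 0 < lowerDegree σ v) (hDv : ¬ D v) (hup : ∀ a, LowerAt σ a v → D a)
    (hlist : HoldsPairs (fun a b => LowerAt σ a b ∧ D a) μ) :
    Ends τ X (findEdges B) μ (lowerDegree σ v * (1000 * (L + 1) * oracleTime τ X))
      (lowerDegree σ v * L) (fun μ' => (∀ j, 2 ≤ j → μ'.real (B + 12) j = 0) ∧
        HoldsPairs (fun a b => LowerAt σ a b ∧ (D a ∨ a = v)) μ') := by
  have hPi := card_le_oracleTime τ X
  refine (ends_sortByAngle (φ := angleAt σ v) (L := L) hL.n hn hv hvn (fun u hu => ?_)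
    (hX.angleAt_injective hvn)).seq_le
    (t₂ := lowerDegree σ v * (L * (300 * oracleTime τ X + 10) + 60 + 20) + 20)
    (q₂ := lowerDegree σ v * L) (fun μ₁ f₁ h₁ => ?_) ?_ (by simp)
  · rw [hL.x u hu, hL.x v hvn, hL.y u hu, hL.y v hvn]; rfl
  · obtain ⟨hφ₁, hs₁⟩ := h₁
    have fn : ∀ b, b ≠ B + 10 → ¬ (B + 16 ≤ b ∧ b ≤ B + 19) → μ₁.nat b = μ.nat b :=
      fun b hb hb' => f₁.nat fun h => by have := sortByAngle_writesNat h; omega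
    have fr : ∀ b, ¬ (B + 15 ≤ b ∧ b ≤ B + 17) → μ₁.real b = μ.real b :=
      fun b hb => f₁.real fun h => by have := sortByAngle_writesReal h; omega
    refine (Ends.forLoop (n := lowerDegree σ v) (t := L * (300 * oracleTime τ X + 10) + 60)
      (q := L) (fun r μ' => (∀ j, 2 ≤ j → μ'.real (B + 12) j = 0) ∧
        HoldsPairs (Known σ D v (μ₁.nat (B + 17)) r) μ')
      (fun h => by have := findEdge_writesNat h; omega) (fun μ' f => ?_) ⟨?_, ?_⟩ ?_).mono ?_ le_rfl
        fun μ' f h => ⟨h.1, ?_⟩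
    · have gn : ∀ b, b ≠ B + 20 → ¬ (findEdge B).WritesNat b → μ'.nat b = μ₁.nat b :=
        fun b hb hb' => f.nat (by simp [Program.forLoop, Program.WritesNat, hb, hb'])
      rw [NExp.eval, NExp.eval, NExp.eval,
        gn _ (by omega) (fun h => by have := findEdge_writesNat h; omega),
        gn _ (by omega) (fun h => by have := findEdge_writesNat h; omega),
        fn _ (by omega) (by omega), fn _ (by omega) (by omega), hv, hdeg]
    · simp only [Memory.setNat_real]
      rw [fr _ (by omega)]
      exact hL.dir
    · refine hlist.congr (fun a b => ?_) ?_ ?_ ?_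
      · simp [Known]
      all_goals rw [Memory.setNat_nat_of_ne _ _ _ (by omega), fn _ (by omega) (by omega)]
    · intro r hr μ' f hr' ⟨hd, hp⟩
      have gn : ∀ b, b ≠ B + 20 → ¬ (findEdge B).WritesNat b → μ'.nat b = μ₁.nat b :=
        fun b hb hb' => f.nat (by simp [Program.forLoop, Program.WritesNat, hb, hb'])
      have gr : ∀ b, ¬ (findEdge B).WritesReal b → μ'.real b = μ₁.real b :=
        fun b hb' => f.real (by simp [Program.forLoop, Program.WritesReal, hb'])
      have n₁₇ : μ'.nat (B + 17) = μ₁.nat (B + 17) :=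
        gn _ (by omega) (fun h => by have := findEdge_writesNat h; omega)
      have r₁₅ : μ'.real (B + 15) = μ₁.real (B + 15) :=
        gr _ (fun h => by have := findEdge_writesReal h; omega)
      have r₁₇ : μ'.real (B + 17) = μ₁.real (B + 17) :=
        gr _ (fun h => by have := findEdge_writesReal h; omega)
      refine (ends_findEdge (τ := τ) (σ := σ) (v := v) (D := D) hX hn (hL.congr ?_ ?_ ?_ hd) ?_ hvn
        hr' (r₁₅ ▸ hφ₁) (n₁₇ ▸ r₁₇ ▸ hs₁) hDv hup hr (n₁₇ ▸ hp)).mono le_rfl le_rfl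
          fun μ'' _ h => ⟨by simpa using h.1, ?_⟩
      · rw [gn _ (by omega) (fun h => by have := findEdge_writesNat h; omega),
          fn _ (by omega) (by omega)]
      · rw [gr _ (fun h => by have := findEdge_writesReal h; omega), fr _ (by omega)]
      · rw [gr _ (fun h => by have := findEdge_writesReal h; omega), fr _ (by omega)]
      · rw [gn _ (by omega) (fun h => by have := findEdge_writesNat h; omega),
          fn _ (by omega) (by omega), hv]
      · refine h.2.congr (fun a b => by rw [n₁₇]) ?_ ?_ ?_
        all_goals rw [Memory.setNat_nat_of_ne _ _ _ (by omega)]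
    · simp only [NExp.cost]
      have : lowerDegree σ v * (L * (300 * oracleTime τ X + 10) + 60 + (1 + 1 + 1) + 9)
        ≤ lowerDegree σ v * (L * (300 * oracleTime τ X + 10) + 60 + 20) :=
        Nat.mul_le_mul_left _ (by omega)
      omega
    · refine h.2.congr (fun a b => and_congr_right fun hab => or_congr_right
        ⟨fun h => h.1, ?_⟩) rfl rfl rfl
      rintro rfl
      obtain ⟨j, hj, rfl⟩ := hs₁.surj b hab.lt_right hab.1.ne.symm
      refine ⟨rfl, j, hj, rfl, ?_⟩
      have h1 := tailDegree_succ (σ := σ) (v := a) (ord := μ₁.nat (B + 17)) hj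
      have h2 : tailDegree σ a (μ₁.nat (B + 17)) j ≤ _ := tailDegree_anti (Nat.zero_le j)
      rw [if_pos hab] at h1
      rw [hs₁.tailDegree_zero] at h2
      omega
  · -- sorting is paid for by the first edge
    set k := lowerDegree σ v
    set p := oracleTime τ X
    have hp : X.n ≤ p := by omega
    have hp1 : 1 ≤ p := by omega
    have h₁ : 400 * X.n * (L + 1) ≤ k * (400 * p * (L + 1)) :=
      (Nat.mul_le_mul_right _ (Nat.mul_le_mul_left _ hp)).trans (Nat.le_mul_of_pos_left _ hpos)
    have h₂ : L * (300 * p + 10) + 60 + 20 ≤ 400 * p * (L + 1) := by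
      nlinarith [Nat.mul_le_mul_left L hp1]
    have h₃ : k * (L * (300 * p + 10) + 60 + 20) ≤ k * (400 * p * (L + 1)) :=
      Nat.mul_le_mul_left _ h₂
    have h₄ : 20 ≤ k * (200 * p * (L + 1)) := by
      have : 1 ≤ k * (p * (L + 1)) := Nat.mul_pos hpos (Nat.mul_pos hp1 (Nat.succ_pos L))
      have e : k * (200 * p * (L + 1)) = 200 * (k * (p * (L + 1))) := by ring
      omega
    have e : k * (1000 * (L + 1) * p)
      = k * (400 * p * (L + 1)) + k * (400 * p * (L + 1)) + k * (200 * p * (L + 1)) := by ring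
    omega

end Sweep

/-! ### The sweep over all vertices -/

section Rounds

open ImmersedGraph

variable {τ : ImmersedGraph → ℕ} {X : ImmersedGraph} {σ : Equiv.Perm (Fin X.n)} {μ μ' : Memory}
  {B v L k a : ℕ} {D : ℕ → Prop}

/-- Put the highest vertex that is not marked in the natural bank `B + 14` into the bank
`B + 15`. -/
def selectHighest (B : ℕ) : Program :=
  .seq (.setNat (B + 15) (.const 0) (.var 0))
    (.forLoop (B + 10) (.var 0)
      (.ite (.and (.natEq (.read (B + 14) (.var (B + 10))) (.const 0))
          (.not (.and (.natLt (.var (B + 15)) (.var 0))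
            (.not (.realLt (.read (B + 14) (.var (B + 15))) (.read (B + 14) (.var (B + 10))))))))
        (.setNat (B + 15) (.const 0) (.var (B + 10))) .skip))

/-- Select the highest vertex that is not marked, mark it, and find the edges to its lower
neighbors. -/
def sweepVertex (B : ℕ) : Program :=
  .seq (selectHighest B) (.seq (.setNat (B + 14) (.var (B + 15)) (.const 1))
    (.ite (.natLt (.const 0) (.read (B + 13) (.var (B + 15)))) (findEdges B) .skip))

theorem ends_selectHighest (hL : Loaded σ B μ) (hvn : v < X.n) (hv : μ.nat (B + 14) v = 0)
    (hmax : ∀ u < X.n, μ.nat (B + 14) u = 0 → u ≠ v → yAt σ u < yAt σ v) :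
    Ends τ X (selectHighest B) μ (60 * X.n + 20) 0 (fun μ' => μ'.nat (B + 15) 0 = v) := by
  refine Ends.seq_le (t₁ := 6) (q₁ := 0) (R := fun μ' => μ'.nat (B + 15) 0 = X.n)
    (Ends.straight (by simp [Program.IsStraight]) (by simp [Program.exec, NExp.eval, hL.n])
      (by simp [Program.maxCost, NExp.cost])) (t₂ := 60 * X.n + 10) (q₂ := 0)
    (fun μ₁ f₁ h₁ => ?_) (by omega) (by simp)
  refine (Ends.forLoop (n := X.n) (t := 40) (q := 0) (fun k μ' => ∃ w, μ'.nat (B + 15) 0 = w ∧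
      ((w = X.n ∧ ∀ j < k, j < X.n → μ.nat (B + 14) j ≠ 0) ∨
        (w < X.n ∧ μ.nat (B + 14) w = 0 ∧
          ∀ j < k, j < X.n → μ.nat (B + 14) j = 0 → yAt σ j ≤ yAt σ w)))
      (by simp [Program.WritesNat]) (fun μ' f => ?_) ⟨X.n, by simp [h₁], Or.inl ⟨rfl, by simp⟩⟩
      ?_).mono ?_ (by simp) fun μ' f h => ?_
  · rw [NExp.eval, f.nat (by simp [Program.forLoop, Program.WritesNat]),
      f₁.nat (by simp [Program.WritesNat])]
    exact hL.n
  · rintro k hk μ' f hk' ⟨w, hw, h⟩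
    have n₀ : μ'.nat 0 0 = X.n := by
      rw [f.nat (by simp [Program.forLoop, Program.WritesNat]),
        f₁.nat (by simp [Program.WritesNat]), hL.n]
    have n₁₄ : μ'.nat (B + 14) = μ.nat (B + 14) := by
      rw [f.nat (by simp [Program.forLoop, Program.WritesNat]),
        f₁.nat (by simp [Program.WritesNat])]
    have r₁₄ : μ'.real (B + 14) = μ.real (B + 14) := by
      rw [f.real (by simp [Program.forLoop, Program.WritesReal]),
        f₁.real (by simp [Program.WritesReal])]
    refine Ends.straight (by simp [Program.IsStraight]) ?_
      (by simp [Program.maxCost, NExp.cost, Cond.cost, RExp.cost])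
    simp only [Program.exec, Cond.Holds, NExp.eval, RExp.eval, n₀, n₁₄, r₁₄, hk', hw]
    split_ifs with hc
    · refine ⟨k, by simp, Or.inr ⟨hk, hc.1, fun j hj hjn hj0 => ?_⟩⟩
      rcases Nat.lt_succ_iff_lt_or_eq.1 hj with hj | rfl
      · rcases h with ⟨-, h⟩ | ⟨hwn, hw0, h⟩
        · exact (h j hj hjn hj0).elim
        · have := hc.2
          rw [not_and, not_not, hL.y w hwn, hL.y k hk] at this
          exact (h j hj hjn hj0).trans (this hwn).le
      · exact le_rfl
    · refine ⟨w, by simp [hw], ?_⟩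
      rcases h with ⟨rfl, h⟩ | ⟨hwn, hw0, h⟩
      · refine Or.inl ⟨rfl, fun j hj hjn hj0 => ?_⟩
        rcases Nat.lt_succ_iff_lt_or_eq.1 hj with hj | rfl
        · exact h j hj hjn hj0
        · exact hc ⟨hj0, fun h => lt_irrefl _ h.1⟩
      · refine Or.inr ⟨hwn, hw0, fun j hj hjn hj0 => ?_⟩
        rcases Nat.lt_succ_iff_lt_or_eq.1 hj with hj | rfl
        · exact h j hj hjn hj0
        · by_contra! hlt
          refine hc ⟨hj0, fun h => h.2 ?_⟩
          rw [hL.y w hwn, hL.y j hk]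
          exact hlt
  · simp only [NExp.cost]; omega
  · obtain ⟨w, hw, ⟨-, h⟩ | ⟨hwn, hw0, h⟩⟩ := h
    · exact (h v hvn hvn hv).elim
    · rw [hw]
      by_contra hne
      exact absurd (h v hvn hvn hv) (not_le.2 (hmax w hwn hw0 hne))

/-- The vertex `v` adds `lowerDegree σ v` pairs to those of the vertices with `D`. -/
theorem card_lowerAt_or (hvn : v < X.n) (hDv : ¬ D v) :
    ((Finset.range X.n ×ˢ Finset.range X.n).filter
        fun p => LowerAt σ p.1 p.2 ∧ (D p.1 ∨ p.1 = v)).card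
      = ((Finset.range X.n ×ˢ Finset.range X.n).filter fun p => LowerAt σ p.1 p.2 ∧ D p.1).card
        + lowerDegree σ v := by
  have h : lowerDegree σ v = ((Finset.range X.n ×ˢ Finset.range X.n).filter
      fun p => LowerAt σ p.1 p.2 ∧ p.1 = v).card := by
    refine Finset.card_bij (fun b _ => (v, b)) ?_ ?_ ?_
    · intro b hb
      simp only [Finset.mem_filter, Finset.mem_product, Finset.mem_range] at hb ⊢
      exact ⟨⟨hvn, hb.1⟩, hb.2, trivial⟩
    · intro b _ b' _ h
      exact (Prod.ext_iff.1 h).2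
    · rintro ⟨a, b⟩ hab
      simp only [Finset.mem_filter, Finset.mem_product, Finset.mem_range] at hab
      obtain ⟨⟨ha, hb⟩, hl, rfl⟩ := hab
      exact ⟨b, by simp [hb, hl], rfl⟩
  rw [h, ← Finset.card_union_of_disjoint, ← Finset.filter_or]
  · exact congrArg _ (Finset.filter_congr fun p _ => and_or_left)
  · refine Finset.disjoint_filter.2 fun p _ h₁ h₂ => hDv ?_
    rw [← h₂.2]
    exact h₁.2

theorem HoldsPairs.add_lowerDegree (h : HoldsPairs (fun a b => LowerAt σ a b ∧ D a) μ)
    (hvn : v < X.n) (hDv : ¬ D v) :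
    μ.nat 1 0 + lowerDegree σ v = ((Finset.range X.n ×ˢ Finset.range X.n).filter
        fun p => LowerAt σ p.1 p.2 ∧ (D p.1 ∨ p.1 = v)).card := by
  rw [card_lowerAt_or hvn hDv,
    ← h.card (n := X.n) fun a b hab => ⟨hab.1.lt_left, hab.1.lt_right⟩]
  congr!

theorem HoldsPairs.card_eq_add_lowerDegree
    (h : HoldsPairs (fun a b => LowerAt σ a b ∧ D a) μ)
    (h' : HoldsPairs (fun a b => LowerAt σ a b ∧ (D a ∨ a = v)) μ')
    (hvn : v < X.n) (hDv : ¬ D v) : μ'.nat 1 0 = μ.nat 1 0 + lowerDegree σ v := by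
  rw [h.add_lowerDegree hvn hDv,
    ← h'.card (n := X.n) fun a b hab => ⟨hab.1.lt_left, hab.1.lt_right⟩]
  congr!

theorem HoldsPairs.add_lowerDegree_le (hX : X.GeneralPosition)
    (h : HoldsPairs (fun a b => LowerAt σ a b ∧ D a) μ) (hvn : v < X.n) (hDv : ¬ D v) :
    μ.nat 1 0 + lowerDegree σ v ≤ X.m := by
  rw [h.add_lowerDegree hvn hDv, ← hX.card_lowerAt (σ := σ)]
  exact Finset.card_le_card fun p hp => by
    rw [Finset.mem_filter] at hp ⊢
    exact ⟨hp.1, hp.2.1⟩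

/-- The state of the sweep after the `k` highest vertices: they are marked in the natural bank
`B + 14`, the edges from them to lower vertices are known, and `a` edges remain to be found. The
natural bank `B + 13` holds the numbers of lower neighbors. -/
structure Swept (σ : Equiv.Perm (Fin X.n)) (B k a : ℕ) (μ : Memory) : Prop where
  loaded : Loaded σ B μ
  degree : ∀ u < X.n, μ.nat (B + 13) u = lowerDegree σ u
  pairs : HoldsPairs (fun a b => LowerAt σ a b ∧ μ.nat (B + 14) a ≠ 0) μ
  upper : ∀ a < X.n, ∀ b < X.n, μ.nat (B + 14) a ≠ 0 → yAt σ a < yAt σ b → μ.nat (B + 14) b ≠ 0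
  card : ((Finset.range X.n).filter fun u => μ.nat (B + 14) u ≠ 0).card = k
  budget : μ.nat 1 0 + a = X.m

theorem Swept.setCounter (h : Swept σ B k a μ) (c : ℕ) :
    Swept σ B k a (μ.setNat (B + 9) 0 c) := by
  have n₁ : (μ.setNat (B + 9) 0 c).nat 1 = μ.nat 1 := Memory.setNat_nat_of_ne _ _ _ (by omega)
  have n₁₄ : (μ.setNat (B + 9) 0 c).nat (B + 14) = μ.nat (B + 14) :=
    Memory.setNat_nat_of_ne _ _ _ (by omega)
  refine ⟨h.loaded.congr (Memory.setNat_nat_of_ne _ _ _ (by omega)) rfl rfl h.loaded.dir, ?_,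
    h.pairs.congr (fun a b => by rw [n₁₄]) n₁ (Memory.setNat_nat_of_ne _ _ _ (by omega))
      (Memory.setNat_nat_of_ne _ _ _ (by omega)), by rw [n₁₄]; exact h.upper,
    by rw [n₁₄]; exact h.card, by rw [n₁]; exact h.budget⟩
  rw [Memory.setNat_nat_of_ne _ _ _ (by omega)]
  exact h.degree

theorem Swept.exists_highest (hX : X.GeneralPosition) (h : Swept σ B k a μ) (hk : k < X.n) :
    ∃ v < X.n, μ.nat (B + 14) v = 0 ∧
      ∀ u < X.n, μ.nat (B + 14) u = 0 → u ≠ v → yAt σ u < yAt σ v := by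
  have hne : ((Finset.range X.n).filter fun u => μ.nat (B + 14) u = 0).Nonempty := by
    by_contra hcon
    rw [Finset.not_nonempty_iff_eq_empty, Finset.filter_eq_empty_iff] at hcon
    have := h.card
    rw [Finset.filter_true_of_mem (fun u hu => hcon hu), Finset.card_range] at this
    omega
  obtain ⟨v, hv, hmax⟩ := Finset.exists_max_image _ (yAt σ) hne
  simp only [Finset.mem_filter, Finset.mem_range] at hv hmax
  exact ⟨v, hv.1, hv.2, fun u hu hu0 huv =>
    lt_of_le_of_ne (hmax u ⟨hu, hu0⟩) (hX.yAt_ne hu hv.1 huv)⟩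

theorem Swept.ends_sweepVertex (hX : X.GeneralPosition) (hn : X.n ≤ 2 ^ L) (h : Swept σ B k a μ)
    (hk : k < X.n) : ∃ e ≤ a, Ends τ X (sweepVertex B) μ
      (60 * X.n + 50 + e * (1000 * (L + 1) * oracleTime τ X)) (0 + e * L)
      (Swept σ B (k + 1) (a - e)) := by
  obtain ⟨v, hvn, hv0, hmax⟩ := h.exists_highest hX hk
  have hbd : μ.nat 1 0 + lowerDegree σ v ≤ X.m :=
    h.pairs.add_lowerDegree_le (D := fun u => μ.nat (B + 14) u ≠ 0) hX hvn (by simp [hv0])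
  have hb := h.budget
  -- the budget of the round is the number of edges that it finds
  refine ⟨lowerDegree σ v, by omega, ?_⟩
  -- what remains to be shown for the memory after the round
  have finish : ∀ μ₃ : Memory, μ₃.nat 0 = μ.nat 0 → μ₃.real (B + 13) = μ.real (B + 13) →
      μ₃.real (B + 14) = μ.real (B + 14) → μ₃.nat (B + 13) = μ.nat (B + 13) →
      μ₃.nat (B + 14) = Function.update (μ.nat (B + 14)) v 1 →
      (∀ j, 2 ≤ j → μ₃.real (B + 12) j = 0) →
      HoldsPairs (fun a b => LowerAt σ a b ∧ (μ.nat (B + 14) a ≠ 0 ∨ a = v)) μ₃ →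
      Swept σ B (k + 1) (a - lowerDegree σ v) μ₃ := by
    intro μ₃ n₀ r₁₃ r₁₄ n₁₃ n₁₄ hd hp
    have hmark : ∀ u, μ₃.nat (B + 14) u ≠ 0 ↔ μ.nat (B + 14) u ≠ 0 ∨ u = v := fun u => by
      rw [n₁₄]
      by_cases e : u = v
      · simp [e]
      · simp [e]
    refine ⟨h.loaded.congr n₀ r₁₃ r₁₄ hd, n₁₃ ▸ h.degree, hp.congr (fun a b => ?_) rfl rfl rfl,
      fun a ha b hb hma hab => ?_, ?_, ?_⟩
    · rw [hmark]
    · rw [hmark] at hma ⊢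
      rcases hma with hma | rfl
      · exact Or.inl (h.upper a ha b hb hma hab)
      · left
        intro hb0
        exact lt_asymm hab (hmax b hb hb0 (by rintro rfl; exact lt_irrefl _ hab))
    · rw [Finset.filter_congr fun u _ => hmark u, Finset.filter_or, Finset.card_union_of_disjoint,
        h.card, Finset.filter_eq', if_pos (Finset.mem_range.2 hvn), Finset.card_singleton]
      refine Finset.disjoint_filter.2 fun u _ h₁ h₂ => h₁ (h₂ ▸ hv0)
    · have := HoldsPairs.card_eq_add_lowerDegree (D := fun u => μ.nat (B + 14) u ≠ 0) h.pairs hp hvn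
        (by simp [hv0])
      omega
  refine (ends_selectHighest h.loaded hvn hv0 hmax).seq_le
    (t₂ := 10 + (6 + lowerDegree σ v * (1000 * (L + 1) * oracleTime τ X)))
    (q₂ := 0 + lowerDegree σ v * L) (fun μ₁ f₁ h₁ => ?_) (by omega) (by simp)
  have n₁ : ∀ b, b ≠ B + 15 → b ≠ B + 10 → μ₁.nat b = μ.nat b := fun b hb hb' =>
    f₁.nat (by simp [selectHighest, Program.forLoop, Program.WritesNat, hb, hb'])
  have r₁ : ∀ b, μ₁.real b = μ.real b := fun b =>
    f₁.real (by simp [selectHighest, Program.forLoop, Program.WritesReal])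
  refine Ends.seq_le (t₁ := 10) (q₁ := 0)
    (R := fun μ' => μ'.nat (B + 14) = Function.update (μ.nat (B + 14)) v 1)
    (Ends.straight (by simp [Program.IsStraight])
      (by simp [Program.exec, NExp.eval, h₁, n₁])
      (by simp [Program.maxCost, NExp.cost]))
    (t₂ := 6 + lowerDegree σ v * (1000 * (L + 1) * oracleTime τ X))
    (q₂ := lowerDegree σ v * L) (fun μ₂ f₂ h₂ => ?_) le_rfl le_rfl
  have n₂ : ∀ b, b ≠ B + 15 → b ≠ B + 10 → b ≠ B + 14 → μ₂.nat b = μ.nat b :=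
    fun b h1 h2 h3 => by rw [f₂.nat (by simpa [Program.WritesNat]), n₁ b h1 h2]
  have r₂ : ∀ b, μ₂.real b = μ.real b := fun b => by
    rw [f₂.real (by simp [Program.WritesReal]), r₁]
  have h₁₅ : μ₂.nat (B + 15) 0 = v := by
    rw [f₂.nat (by simp [Program.WritesNat]), h₁]
  have n₁₃ : μ₂.nat (B + 13) = μ.nat (B + 13) := n₂ _ (by omega) (by omega) (by omega)
  have hd₂ : ∀ j, 2 ≤ j → μ₂.real (B + 12) j = 0 := by rw [r₂]; exact h.loaded.dir
  have hL₂ : Loaded σ B μ₂ :=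
    h.loaded.congr (n₂ _ (by omega) (by omega) (by omega)) (r₂ _) (r₂ _) hd₂
  have hp₂ : HoldsPairs (fun a b => LowerAt σ a b ∧ μ.nat (B + 14) a ≠ 0) μ₂ :=
    h.pairs.congr (fun _ _ => Iff.rfl) (n₂ _ (by omega) (by omega) (by omega))
      (n₂ _ (by omega) (by omega) (by omega)) (n₂ _ (by omega) (by omega) (by omega))
  refine (Ends.ite (t := 1 + lowerDegree σ v * (1000 * (L + 1) * oracleTime τ X)) (fun hc => ?_)
    fun hc => ?_).mono (by simp only [Cond.cost, NExp.cost]; omega) le_rfl fun _ _ h => h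
  · have hpos : 0 < lowerDegree σ v := by
      simpa [Cond.Holds, NExp.eval, h₁₅, n₁₃, h.degree v hvn] using hc
    refine (ends_findEdges (D := fun u => μ.nat (B + 14) u ≠ 0) hX hn hL₂ h₁₅ hvn
      (by rw [n₁₃, h.degree v hvn]) hpos (by simp [hv0]) (fun a ha h0 => ?_) hp₂).mono
        (by omega) le_rfl fun μ₃ f₃ h₃ => ?_
    · exact lt_asymm ha.2 (hmax a ha.lt_left h0 ha.1.ne)
    · have n₃ : ∀ b, ¬ (findEdges B).WritesNat b → μ₃.nat b = μ₂.nat b := fun b hb => f₃.nat hb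
      refine finish μ₃ ?_ ?_ ?_ ?_ ?_ h₃.1 h₃.2
      · rw [f₃.nat (fun h => by have := findEdges_writesNat h; omega),
          n₂ _ (by omega) (by omega) (by omega)]
      · rw [f₃.real (fun h => by have := findEdges_writesReal h; omega), r₂]
      · rw [f₃.real (fun h => by have := findEdges_writesReal h; omega), r₂]
      · rw [f₃.nat (fun h => by have := findEdges_writesNat h; omega), n₁₃]
      · rw [f₃.nat (fun h => by have := findEdges_writesNat h; omega), h₂]
  · have hzero : lowerDegree σ v = 0 := by
      simpa [Cond.Holds, NExp.eval, h₁₅, n₁₃, h.degree v hvn] using hc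
    refine Ends.straight (by simp [Program.IsStraight]) ?_
      (by simp only [Program.maxCost]; omega)
    refine finish μ₂ (n₂ _ (by omega) (by omega) (by omega)) (r₂ _) (r₂ _) n₁₃ h₂ hd₂
      (hp₂.congr (fun a b => and_congr_right fun hab => ?_) rfl rfl rfl)
    refine ⟨Or.inl, fun h => h.resolve_right ?_⟩
    rintro rfl
    rw [lowerDegree, Finset.card_eq_zero, Finset.filter_eq_empty_iff] at hzero
    exact hzero (Finset.mem_range.2 hab.lt_right) hab

theorem sweepVertex_writesNat {b : ℕ} (h : (sweepVertex B).WritesNat b) : b ≠ 0 ∧ b ≠ B + 9 := by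
  simp only [sweepVertex, selectHighest, Program.forLoop, Program.WritesNat, or_false] at h
  rcases h with h | h | h
  · omega
  · omega
  · have := findEdges_writesNat h
    omega

theorem sweepVertex_writesReal {b : ℕ} (h : (sweepVertex B).WritesReal b) : B + 4 ≤ b := by
  simp only [sweepVertex, selectHighest, Program.forLoop, Program.WritesReal, or_false,
    false_or] at h
  have := findEdges_writesReal h
  omega

/-! ### The complete program -/

/-- Copy the first two coordinates of the vertices into the real banks `B + 13` and `B + 14`. -/
def loadCoords (B : ℕ) : Program :=
  .seq (.setNat (B + 12) (.const 0) (.const 0))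
    (.forLoop (B + 9) (.var 0)
      (.seq (.setReal (B + 13) (.var (B + 9)) (.read 0 (.var (B + 12))))
        (.seq (.setReal (B + 14) (.var (B + 9)) (.read 0 (.add (.var (B + 12)) (.const 1))))
          (.setNat (B + 12) (.const 0) (.add (.var (B + 12)) .dim)))))

/-- Query the direction `e₂`, and start with an empty list of known edges. -/
def queryUp (B : ℕ) : Program :=
  .seq (.seq (.setNat 1 (.const 0) (.const 0))
    (.seq (.setReal (B + 12) (.const 0) (.ofNat (.const 0)))
      (.setReal (B + 12) (.const 1) (.ofNat (.const 1)))))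
    (.query (B + 12) (B + 4))

/-- Compute the numbers of lower neighbors into the natural bank `B + 13` from the answer in
direction `e₂`, and unmark all vertices. -/
def countLower (B : ℕ) : Program :=
  .forLoop (B + 9) (.var 0)
    (.seq (.setReal (B + 18) (.const 0) (.read (B + 14) (.var (B + 9))))
      (.seq (countEdges B)
        (.seq (.setNat (B + 13) (.var (B + 9)) (.var (B + 11)))
          (.setNat (B + 14) (.var (B + 9)) (.const 0)))))

/-- Find all edges, when the vertices are known. The real bank `B + 12`, of which only the first two
cells are written, has to hold zeros, because all queries are made in its direction. -/
def findAllEdges (B : ℕ) : Program :=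
  .seq (loadCoords B) (.seq (queryUp B) (.seq (countLower B)
    (.forLoop (B + 9) (.var 0) (sweepVertex B))))

theorem findAllEdges_writesNat {b : ℕ} (h : (findAllEdges B).WritesNat b) : b ≠ 0 := by
  simp only [findAllEdges, loadCoords, queryUp, countLower, countEdges, Program.countLoop,
    Program.forLoop, Program.WritesNat, or_false, false_or] at h
  rcases h with h | h | h | h | h | h
  · omega
  · omega
  · omega
  · omega
  · exact (sweepVertex_writesNat h).1
  · omega

theorem findAllEdges_writesReal {b : ℕ} (h : (findAllEdges B).WritesReal b) : B + 4 ≤ b := by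
  simp only [findAllEdges, loadCoords, queryUp, countLower, countEdges, Program.countLoop,
    Program.forLoop, Program.WritesReal, or_false, false_or] at h
  rcases h with h | h | h | h
  · omega
  · omega
  · omega
  · exact sweepVertex_writesReal h

theorem ends_loadCoords (h : HoldsVertices X σ μ) (hz : ∀ j, μ.real (B + 12) j = 0) :
    Ends τ X (loadCoords B) μ (60 * X.n + 20) 0 (Loaded σ B) := by
  have hd := X.two_le_d
  refine Ends.seq_le (t₁ := 6) (q₁ := 0) (R := fun μ' => μ'.nat (B + 12) 0 = 0)
    (Ends.straight (by simp [Program.IsStraight]) (by simp [Program.exec, NExp.eval])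
      (by simp [Program.maxCost, NExp.cost])) (t₂ := 60 * X.n + 10) (q₂ := 0)
    (fun μ₁ f₁ h₁ => ?_) (by omega) (by simp)
  refine (Ends.forLoop (n := X.n) (t := 40) (q := 0) (fun k μ' => μ'.nat (B + 12) 0 = k * X.d ∧
      (∀ u < k, u < X.n → μ'.real (B + 13) u = xAt σ u) ∧
      ∀ u < k, u < X.n → μ'.real (B + 14) u = yAt σ u)
      (by simp [Program.WritesNat]) (fun μ' f => ?_) ⟨by simp [h₁], by simp, by simp⟩
      ?_).mono ?_ (by simp) fun μ' f h' => ?_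
  · rw [NExp.eval, f.nat (by simp [Program.forLoop, Program.WritesNat]),
      f₁.nat (by simp [Program.WritesNat])]
    exact h.1
  · rintro k hk μ' f hk' ⟨ho, hx, hy⟩
    have r₀ : μ'.real 0 = μ.real 0 := by
      rw [f.real (by simp [Program.forLoop, Program.WritesReal]),
        f₁.real (by simp [Program.WritesReal])]
    have hx' : μ.real 0 (k * X.d) = xAt σ k := by
      have := h.2 ⟨k, hk⟩ ⟨0, by omega⟩
      simpa [xAt, hk, fstCoord] using this
    have hy' : μ.real 0 (k * X.d + 1) = yAt σ k := by
      have := h.2 ⟨k, hk⟩ ⟨1, by omega⟩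
      simpa [yAt, hk, sndCoord] using this
    refine Ends.straight (by simp [Program.IsStraight]) ?_
      (by simp [Program.maxCost, NExp.cost, RExp.cost])
    simp only [Program.exec, NExp.eval, RExp.eval, hk', ho]
    refine ⟨by simp [ho, Nat.succ_mul], fun u hu hun => ?_, fun u hu hun => ?_⟩
    · rcases Nat.lt_succ_iff_lt_or_eq.1 hu with hu | rfl
      · simp [hu.ne, hx u hu hun]
      · simp [r₀, hx']
    · rcases Nat.lt_succ_iff_lt_or_eq.1 hu with hu | rfl
      · simp [hk', hu.ne, hy u hu hun]
      · simp [r₀, hk', ho, hy']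
  · simp only [NExp.cost]; omega
  · refine ⟨?_, fun u hu => h'.2.1 u hu hu, fun u hu => h'.2.2 u hu hu, fun j _ => ?_⟩
    · rw [f.nat (by simp [Program.forLoop, Program.WritesNat]),
        f₁.nat (by simp [Program.WritesNat])]
      exact h.1
    · rw [f.real (by simp [Program.forLoop, Program.WritesReal]),
        f₁.real (by simp [Program.WritesReal]), hz]

theorem ends_queryUp (hL : Loaded σ B μ) :
    Ends τ X (queryUp B) μ (20 + oracleTime τ X) (0 + 1) (fun μ' => Loaded σ B μ' ∧ μ'.nat 1 0 = 0 ∧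
      ∃ ν : Memory, ν.real (B + 12) 0 = 0 ∧ ν.real (B + 12) 1 = 1 ∧
        (∀ j, 2 ≤ j → ν.real (B + 12) j = 0) ∧
        HoldsAnswer (B + 4) (X.dgm0 (ν.vector X.d (B + 12)))
          (X.dgm1 (ν.vector X.d (B + 12))) μ') := by
  refine Ends.seq (t := 20) (q := 0) (R := fun μ' => μ'.nat 1 0 = 0 ∧ μ'.real (B + 12) 0 = 0 ∧
      μ'.real (B + 12) 1 = 1 ∧ ∀ j, 2 ≤ j → μ'.real (B + 12) j = 0)
    (Ends.straight (by simp [Program.IsStraight]) ?_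
      (by simp [Program.maxCost, NExp.cost, RExp.cost])) fun μ₁ f₁ h₁ =>
    (Ends.query h₁.2.2.2 (by simp [h₁.2.1, h₁.2.2.1])).mono le_rfl le_rfl fun μ₂ f₂ h₂ => ?_
  · simp only [Program.exec, NExp.eval, RExp.eval]
    refine ⟨by simp, by simp, by simp, fun j hj => ?_⟩
    simp [show j ≠ 0 by omega, show j ≠ 1 by omega, hL.dir j hj]
  · refine ⟨hL.congr ?_ ?_ ?_ fun j hj => ?_, ?_, μ₁, h₁.2.1, h₁.2.2.1, h₁.2.2.2, h₂⟩
    · rw [f₂.nat (by simp [Program.WritesNat]), f₁.nat (by simp [Program.WritesNat])]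
    · rw [f₂.real (by simp [Program.WritesReal]), f₁.real (by simp [Program.WritesReal])]
    · rw [f₂.real (by simp [Program.WritesReal]), f₁.real (by simp [Program.WritesReal])]
    · rw [f₂.real (by simp [Program.WritesReal]), h₁.2.2.2 j hj]
    · rw [f₂.nat (by simp only [Program.WritesNat]; omega), h₁.1]

theorem HoldsAnswer.congr {b : ℕ} {D₀ D₁ : Multiset (ℝ × WithTop ℝ)} (h : HoldsAnswer b D₀ D₁ μ)
    (h0 : μ'.nat b = μ.nat b) (h1 : μ'.nat (b + 1) = μ.nat (b + 1))
    (h2 : μ'.real (b + 1) = μ.real (b + 1)) (h3 : μ'.real (b + 4) = μ.real (b + 4)) :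
    HoldsAnswer b D₀ D₁ μ' := by
  obtain ⟨e0, e1, e2, e3⟩ := h
  rw [← h0] at e0 e1
  rw [← h1, ← h2] at e2
  rw [← h3] at e3
  exact ⟨e0, e1, e2, e3⟩

theorem ends_countLower (hX : X.GeneralPosition) (hL : Loaded σ B μ) (h1 : μ.nat 1 0 = 0)
    {ν : Memory} (hν0 : ν.real (B + 12) 0 = 0) (hν1 : ν.real (B + 12) 1 = 1)
    (hν : ∀ j, 2 ≤ j → ν.real (B + 12) j = 0)
    (hA : HoldsAnswer (B + 4) (X.dgm0 (ν.vector X.d (B + 12))) (X.dgm1 (ν.vector X.d (B + 12))) μ) :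
    Ends τ X (countLower B) μ (X.n * (100 * (X.n + X.m + 1) + 60) + 10) 0 (Swept σ B 0 X.m) := by
  refine (Ends.forLoop (n := X.n) (t := 10 + (100 * (X.n + X.m + 1) + 20)) (q := 0)
    (fun k μ' => (∀ u < k, μ'.nat (B + 13) u = lowerDegree σ u) ∧ ∀ u < k, μ'.nat (B + 14) u = 0)
    (by simp [Program.WritesNat, countEdges, Program.countLoop, Program.forLoop])
    (fun μ' f => ?_) (by simp) ?_).mono ?_ (by simp) fun μ' f h => ?_
  · rw [NExp.eval, f.nat (by
      simp [Program.WritesNat, countEdges, Program.countLoop, Program.forLoop])]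
    exact hL.n
  · rintro k hk μ' f hk' ⟨hdeg, hmark⟩
    have r₁₄ : μ'.real (B + 14) = μ.real (B + 14) := f.real (by
      simp [Program.WritesReal, countEdges, Program.countLoop, Program.forLoop])
    have hA' := hA.congr (μ' := μ')
      (f.nat (by simp [Program.WritesNat, countEdges, Program.countLoop, Program.forLoop]))
      (f.nat (by simp [Program.WritesNat, countEdges, Program.countLoop, Program.forLoop]))
      (f.real (by simp [Program.WritesReal, countEdges, Program.countLoop, Program.forLoop]))
      (f.real (by simp [Program.WritesReal, countEdges, Program.countLoop, Program.forLoop]))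
    refine Ends.seq (t := 10) (q := 0) (R := fun μ₁ => μ₁.real (B + 18) 0 = yAt σ k)
      (Ends.straight (by simp [Program.IsStraight])
        (by simp [Program.exec, NExp.eval, RExp.eval, hk', r₁₄, hL.y k hk])
        (by simp [Program.maxCost, NExp.cost, RExp.cost])) fun μ₁ f₁ h₁ =>
      Ends.seq_le (q₁ := 0) (ends_countEdges (hA'.congr (f₁.nat (by simp [Program.WritesNat]))
        (f₁.nat (by simp [Program.WritesNat])) (f₁.real (by simp [Program.WritesReal]))
        (f₁.real (by simp [Program.WritesReal])))) (t₂ := 20) (q₂ := 0)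
        (fun μ₂ f₂ h₂ => ?_) le_rfl le_rfl
    have hcard := card_edges_vector (σ := σ) hν hk (fun u hu huk => by
      simpa [hν0, hν1] using hX.yAt_ne hu hk huk)
    simp only [hν0, hν1, zero_mul, zero_add, one_mul] at hcard
    replace h₂ : μ₂.nat (B + 11) 0 = lowerDegree σ k := by
      rw [h₂, h₁, hcard, lowerDegree]
      congr!
    have nk : ∀ b, b ≠ B + 10 → b ≠ B + 11 → μ₂.nat b = μ'.nat b := fun b hb hb' => by
      rw [f₂.nat (by simp [Program.WritesNat, countEdges, Program.countLoop, Program.forLoop, *]),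
        f₁.nat (by simp [Program.WritesNat])]
    refine Ends.straight (by simp [Program.IsStraight]) ?_
      (by simp [Program.maxCost, NExp.cost])
    simp only [Program.exec, NExp.eval, nk (B + 9) (by omega) (by omega), hk', h₂]
    refine ⟨fun u hu => ?_, fun u hu => ?_⟩
    · rcases Nat.lt_succ_iff_lt_or_eq.1 hu with hu | rfl
      · simp [hu.ne, nk, hdeg u hu]
      · simp
    · rcases Nat.lt_succ_iff_lt_or_eq.1 hu with hu | rfl
      · simp [hu.ne, nk, hmark u hu, hk']
      · simp [nk, hk']
  · simp only [NExp.cost]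
    have : X.n * (10 + (100 * (X.n + X.m + 1) + 20) + (1 + 1) + 9)
      ≤ X.n * (100 * (X.n + X.m + 1) + 60) := Nat.mul_le_mul_left _ (by omega)
    omega
  · have n₁ : μ'.nat 1 0 = 0 := by
      rw [f.nat, h1]
      simp only [Program.WritesNat, countEdges, Program.countLoop, Program.forLoop, or_false,
        false_or]
      omega
    refine ⟨hL.congr ?_ ?_ ?_ ?_, h.1, ⟨?_, ?_, fun a b hab => ?_⟩,
      fun a ha b hb h₁ _ => ?_, ?_, ?_⟩
    · exact f.nat (by
        simp [Program.WritesNat, countEdges, Program.countLoop, Program.forLoop])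
    · exact f.real (by
        simp [Program.WritesReal, countEdges, Program.countLoop, Program.forLoop])
    · exact f.real (by
        simp [Program.WritesReal, countEdges, Program.countLoop, Program.forLoop])
    · rw [f.real (by
        simp [Program.WritesReal, countEdges, Program.countLoop, Program.forLoop])]
      exact hL.dir
    · simp [n₁]
    · simp [n₁]
    · exact (hab.2 (h.2 a hab.1.lt_left)).elim
    · exact (h₁ (h.2 a ha)).elim
    · rw [Finset.card_eq_zero, Finset.filter_eq_empty_iff]
      intro u hu
      simp [h.2 u (Finset.mem_range.1 hu)]
    · rw [n₁, zero_add]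

theorem Swept.holdsEdges (hX : X.GeneralPosition) (h : Swept σ B X.n a μ) : HoldsEdges X σ μ := by
  have hall : ∀ u < X.n, μ.nat (B + 14) u ≠ 0 := by
    have := Finset.eq_of_subset_of_card_le (Finset.filter_subset
      (fun u => μ.nat (B + 14) u ≠ 0) (Finset.range X.n)) (by rw [h.card, Finset.card_range])
    intro u hu
    have hu' := Finset.mem_range.2 hu
    rw [← this] at hu'
    exact (Finset.mem_filter.1 hu').2
  exact (h.pairs.congr (fun a b => ⟨fun h => h.1, fun h => ⟨h, hall a h.lt_left⟩⟩)
    rfl rfl rfl).holdsEdges hX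

theorem ends_findAllEdges (hX : X.GeneralPosition) (hn : X.n ≤ 2 ^ L) (h : HoldsVertices X σ μ)
    (hz : ∀ j, μ.real (B + 12) j = 0) :
    Ends τ X (findAllEdges B) μ
      (X.n * (300 * (X.n + X.m + 1)) + X.m * (1000 * (L + 1) * oracleTime τ X)
        + oracleTime τ X + 80)
      (1 + X.m * L) (fun μ' => HoldsVertices X σ μ' ∧ HoldsEdges X σ μ') := by
  refine Ends.mono (Q := fun μ' => HoldsEdges X σ μ') (t := 60 * X.n + 20 + (20 + oracleTime τ X +
      (X.n * (100 * (X.n + X.m + 1) + 60) + 10 + (X.n * (60 * X.n + 70) +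
        X.m * (1000 * (L + 1) * oracleTime τ X) + 10))))
    (q := 0 + (0 + 1 + (0 + (0 + X.m * L)))) ?_ ?_ (by omega)
    fun μ' f h' => ⟨⟨?_, fun i j => ?_⟩, h'⟩
  · refine (ends_loadCoords h hz).seq fun μ₁ f₁ h₁ => (ends_queryUp h₁).seq fun μ₂ f₂ h₂ => ?_
    obtain ⟨hL, h1, ν, hν0, hν1, hν, hA⟩ := h₂
    refine (ends_countLower hX hL h1 hν0 hν1 hν hA).seq fun μ₃ f₃ h₃ => ?_
    refine (Ends.forLoop_budget (n := X.n) (t := 60 * X.n + 50)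
      (t' := 1000 * (L + 1) * oracleTime τ X) (q := 0) (q' := L) (Swept σ B) (a := X.m)
      (fun h => by have := sweepVertex_writesNat h; omega) (fun μ' f => ?_) ?_ ?_).mono ?_ (by simp)
      fun μ' _ ⟨_, h⟩ => h.holdsEdges hX
    · rw [NExp.eval, f.nat]
      · exact h₃.loaded.n
      · simp only [Program.forLoop, Program.WritesNat]
        rintro (h | h | h)
        · omega
        · exact (sweepVertex_writesNat h).1 rfl
        · omega
    · exact h₃.setCounter 0
    · intro k a hk μ' f hk' hS
      obtain ⟨e, he, hends⟩ := hS.ends_sweepVertex (τ := τ) hX hn hk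
      exact ⟨e, he, hends.mono le_rfl le_rfl fun μ'' _ h => h.setCounter _⟩
    · simp only [NExp.cost]
      have : X.n * (60 * X.n + 50 + (1 + 1) + 9) ≤ X.n * (60 * X.n + 70) :=
        Nat.mul_le_mul_left _ (by omega)
      omega
  · have e₁ : X.n * (300 * (X.n + X.m + 1))
      = 300 * (X.n * X.n) + 300 * (X.n * X.m) + 300 * X.n := by ring
    have e₂ : X.n * (100 * (X.n + X.m + 1) + 60)
      = 100 * (X.n * X.n) + 100 * (X.n * X.m) + 160 * X.n := by ring
    have e₃ : X.n * (60 * X.n + 70) = 60 * (X.n * X.n) + 70 * X.n := by ring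
    omega
  · rw [f.nat fun h => findAllEdges_writesNat h rfl, h.1]
  · rw [f.real fun h => by have := findAllEdges_writesReal h; omega, h.2]

end Rounds

/-! ### Time and query bounds -/

section Bounds

variable {τ : ImmersedGraph → ℕ} {X : ImmersedGraph}

theorem ImmersedGraph.two_le_n_of_m_pos (h : 0 < X.m) : 2 ≤ X.n := by
  obtain ⟨e, he⟩ := Finset.card_pos.1 h
  have h₁ := (X.mem_edges.1 he).1
  have h₂ := e.2.2
  rw [Fin.lt_def] at h₁
  omega

theorem clog_le_log {n : ℕ} (hn : 2 ≤ n) : (Nat.clog 2 n : ℝ) ≤ 3 * Real.log n := by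
  have h₁ : ((2 : ℕ) ^ (Nat.clog 2 n - 1) : ℕ) < n := Nat.pow_pred_clog_lt_self one_lt_two hn
  have h₂ : 0 < Nat.clog 2 n := Nat.clog_pos one_lt_two hn
  have h₃ : ((Nat.clog 2 n - 1 : ℕ) : ℝ) * Real.log 2 ≤ Real.log n := by
    rw [← Real.log_pow]
    exact Real.log_le_log (by positivity) (by exact_mod_cast h₁.le)
  rw [Nat.cast_sub h₂, Nat.cast_one] at h₃
  have h₄ : Real.log 2 ≤ Real.log n := Real.log_le_log two_pos (by exact_mod_cast hn)
  have h₅ := Real.log_two_gt_d9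
  have h₆ : (0 : ℝ) ≤ Nat.clog 2 n := Nat.cast_nonneg _
  nlinarith

/-- If there is an edge, then `n ≥ 2` and `log n ≥ 1 / 2`. -/
theorem m_le_log (X : ImmersedGraph) : (X.m : ℝ) ≤ 2 * (X.m * Real.log X.n) := by
  rcases Nat.eq_zero_or_pos X.m with h | h
  · simp [h]
  · have h₄ : Real.log 2 ≤ Real.log X.n :=
      Real.log_le_log two_pos (by exact_mod_cast X.two_le_n_of_m_pos h)
    have h₅ := Real.log_two_gt_d9
    have h₆ : (0 : ℝ) < X.m := by exact_mod_cast h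
    nlinarith

theorem m_mul_clog_le (X : ImmersedGraph) :
    (X.m : ℝ) * Nat.clog 2 X.n ≤ 3 * (X.m * Real.log X.n) := by
  rcases Nat.eq_zero_or_pos X.m with h | h
  · simp [h]
  · have h₄ := clog_le_log (X.two_le_n_of_m_pos h)
    have h₆ : (0 : ℝ) < X.m := by exact_mod_cast h
    nlinarith

theorem findAllEdges_time_le (τ : ImmersedGraph → ℕ) (X : ImmersedGraph) :
    ((X.n * (300 * (X.n + X.m + 1)) + X.m * (1000 * (Nat.clog 2 X.n + 1) * oracleTime τ X)
      + oracleTime τ X + 80 : ℕ) : ℝ)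
      ≤ 6000 * ((X.n : ℝ) ^ 2 + ((X.m : ℝ) * Real.log X.n + 1) * ((X.d : ℝ) + oracleTime τ X)) := by
  have h₁ := m_le_log X
  have h₂ := m_mul_clog_le X
  have h₃ : (X.n : ℝ) + X.m + 1 ≤ oracleTime τ X := by exact_mod_cast card_le_oracleTime τ X
  have hn : (X.n : ℝ) ≤ X.n ^ 2 := by exact_mod_cast Nat.le_self_pow two_ne_zero _
  have hn0 : (0 : ℝ) ≤ X.n := Nat.cast_nonneg _
  have hm0 : (0 : ℝ) ≤ X.m := Nat.cast_nonneg _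
  have hd0 : (0 : ℝ) ≤ X.d := Nat.cast_nonneg _
  push_cast
  generalize (X.m : ℝ) * Real.log X.n = a at *
  generalize (oracleTime τ X : ℝ) = p at *
  generalize (Nat.clog 2 X.n : ℝ) = l at *
  generalize (X.n : ℝ) = n at *
  generalize (X.m : ℝ) = m at *
  generalize (X.d : ℝ) = d at *
  have ha : 0 ≤ a := by linarith
  have hp : 0 ≤ p := by linarith
  have e₁ : n * m ≤ 2 * (a * p) := by nlinarith [mul_le_mul_of_nonneg_left h₁ hp]
  have e₂ : m * l * p ≤ 3 * (a * p) := by nlinarith [mul_le_mul_of_nonneg_right h₂ hp]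
  have e₃ : m * p ≤ 2 * (a * p) := by nlinarith [mul_le_mul_of_nonneg_right h₁ hp]
  have e₄ : 0 ≤ a * d := mul_nonneg ha hd0
  have e₅ : 0 ≤ a * p := mul_nonneg ha hp
  nlinarith

end Bounds

theorem mainTheorem2 :
    ∃ C : ℝ, 0 < C ∧ ∀ M : Program, ∃ A : Program,
      ∀ (𝒞 : Set ImmersedGraph), (∀ X ∈ 𝒞, X.GeneralPosition) →
      ∀ (τ : ImmersedGraph → ℕ) (T K : ImmersedGraph → ℝ),
        ReconstructsVertices M 𝒞 τ T K →
        ReconstructsGraphs A 𝒞 τ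
          (fun X => T X + C * ((X.n : ℝ) ^ 2
            + ((X.m : ℝ) * Real.log X.n + 1) * ((X.d : ℝ) + oracleTime τ X)))
          (fun X => K X + 1 + C * ((X.m : ℝ) * Real.log X.n)) := by
  refine ⟨6000, by norm_num, fun M => ?_⟩
  obtain ⟨B, hB⟩ := M.exists_bank_bound
  refine ⟨.seq M (findAllEdges B), fun 𝒞 h𝒞 τ T K hM X hX => ?_⟩
  obtain ⟨μ, t, q, hrun, ht, hq, σ, hσ⟩ := hM X hX
  obtain ⟨μ', t', q', hrun', ht', hq', hV, hE⟩ := ends_findAllEdges (τ := τ) (h𝒞 X hX)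
    (Nat.le_pow_clog one_lt_two X.n) hσ
    (B := B) (fun j => by rw [hrun.frame.real (hB (B + 12) (by omega)).2]; rfl)
  refine ⟨μ', t + t', q + q', .seq hrun hrun', ?_, ?_, σ, hV, hE⟩
  · have h₁ : (t' : ℝ) ≤ _ := (Nat.cast_le (α := ℝ).2 ht').trans (findAllEdges_time_le τ X)
    push_cast
    linarith
  · have h₁ : (q' : ℝ) ≤ 1 + X.m * Nat.clog 2 X.n := by exact_mod_cast hq'
    have h₂ := m_mul_clog_le X
    have h₃ : 0 ≤ (X.m : ℝ) * Real.log X.n :=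
      mul_nonneg (Nat.cast_nonneg _) (Real.log_natCast_nonneg _)
    push_cast
    linarith
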